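/- Let $n,k\ge 1$ and $w\ge 0$ be integers. Strings of length $n$ over the alphabet $\{1,\dots,k\}$ are ordered lexicographically, and the weight of a string is the sum of its symbols. A necklace is a string that is lexicographically smallest among its rotations; the aperiodic prefix of a string $\mathbf s$ is the shortest string $\mathbf t$ with $\mathbf s=\mathbf t^j$ for some $j\ge1$. For an integer $v$ let $\mathcal G_k(n,v^\uparrow)$ be the concatenation of the aperiodic prefixes of all necklaces of length $n$ over $\{1,\dots,k\}$ of weight at least $v$, taken in lexicographic order. Let $\overline{\mathbf s}$ denote the complement of a sequence $\mathbf s$, obtained by replacing each symbol $x$ by $k-x+1$, and put $$\mathcal G_k(n,w_\downarrow)=\overline{\mathcal G_k(n,(kn-w+n)^\uparrow)}.$$ Let $\mathbf S_k(n,w_\downarrow)$ be the set of strings of length $n$ over $\{1,\dots,k\}$ of weight at most $w$. A universal cycle for a set $\mathbf S$ of strings of length $n$ is a cyclic sequence of length $|\mathbf S|$ in which every $\mathbf s\in\mathbf S$ occurs exactly once as a (cyclic) substring; the position, counted from $1$, at which $\mathbf s$ starts is the rank of $\mathbf s$. Then $\mathcal G_k(n,w_\downarrow)$ is a universal cycle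 for $\mathbf S_k(n,w_\downarrow)$. Moreover, on a unit-cost RAM (instructions: constants, copying, addition, truncated subtraction, multiplication, integer division, indirect loads and stores, jumps and comparisons; each costs one step): 1. there is a program that, given $n,k\ge1$, $w$ and a string $\mathbf s\in\mathbf S_k(n,w_\downarrow)$, computes the rank of $\mathbf s$ in $\mathcal G_k(n,w_\downarrow)$ in $O(n^3k^2)$ time using $O(n^3k)$ space; 2. there is a program that, given $n\ge1$, $k\ge2$, $w$ and a rank $1\le r\le|\mathbf S_k(n,w_\downarrow)|$, computes the string in $\mathbf S_k(n,w_\downarrow)$ that has rank $r$ in $\mathcal G_k(n,w_\downarrow)$ in $O(n^4k^2\log k)$ time using $O(n^3k)$ space. Here time is the number of steps, space is the number of memory words used (besides a fixed number of registers), every number stored by the program is at most $(n+k+w+k^n)^{C}$, and the program, the constant $C$ and the implied constants do not depend on the input. -/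

import Mathlib

/-! Strings are lists of natural numbers; the alphabet of size `k` is `{1, …, k}`.
Lists carry Mathlib's lexicographic order. -/

namespace UCycle

/-- The length-`n` strings over the alphabet `{1, …, k}`. -/
def strings (k n : ℕ) : Finset (List ℕ) :=
  (Fintype.piFinset fun _ : Fin n => Finset.Icc 1 k).image List.ofFn

theorem mem_strings {k n : ℕ} {s : List ℕ} :
    s ∈ strings k n ↔ s.length = n ∧ ∀ x ∈ s, 1 ≤ x ∧ x ≤ k := by
  unfold strings
  simp only [Finset.mem_image, Fintype.mem_piFinset, Finset.mem_Icc]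
  constructor
  · rintro ⟨f, hf, rfl⟩
    refine ⟨List.length_ofFn, fun x hx => ?_⟩
    obtain ⟨i, rfl⟩ := List.mem_ofFn.1 hx
    exact hf i
  · rintro ⟨rfl, h⟩
    exact ⟨s.get, fun i => h _ (List.get_mem s i), List.ofFn_get s⟩

/-- The weight of a string: the sum of its symbols. -/
def weight (s : List ℕ) : ℕ := s.sum

/-- The length-`n` strings over `{1, …, k}` of weight at least `w`. -/
def stringsAtLeast (k n : ℕ) (w : ℤ) : Finset (List ℕ) :=
  (strings k n).filter fun s => w ≤ (weight s : ℤ)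

/-- The length-`n` strings over `{1, …, k}` of weight at most `w`. -/
def stringsAtMost (k n : ℕ) (w : ℤ) : Finset (List ℕ) :=
  (strings k n).filter fun s => (weight s : ℤ) ≤ w

/-- A necklace: a string that is lexicographically smallest among its rotations. -/
def IsNecklace (s : List ℕ) : Prop := ∀ i < s.length, s ≤ s.rotate i

instance : DecidablePred IsNecklace := fun s =>
  inferInstanceAs (Decidable (∀ i < s.length, s ≤ s.rotate i))

/-- The aperiodic prefix of `s`: the shortest string `t` with `s = t ^ j` for some `j ≥ 1`
(such a `t` is necessarily a prefix of `s`). -/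
noncomputable def aperiodicPrefix (s : List ℕ) : List ℕ :=
  s.take (sInf {p | ∃ j, 1 ≤ j ∧ s = (List.replicate j (s.take p)).flatten})

/-- The necklaces of length `n` over `{1, …, k}` and weight at least `w`, in lexicographic
order. -/
def necklacesAtLeast (k n : ℕ) (w : ℤ) : List (List ℕ) :=
  ((stringsAtLeast k n w).filter IsNecklace).sort (· ≤ ·)

/-- The concatenation, in lexicographic order, of the aperiodic prefixes of the necklaces of
length `n` over `{1, …, k}` and weight at least `w`. -/
noncomputable def cycleAtLeast (k n : ℕ) (w : ℤ) : List ℕ :=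
  ((necklacesAtLeast k n w).map aperiodicPrefix).flatten

/-- The complement of a string over `{1, …, k}`: each symbol `x` becomes `k - x + 1`. -/
def complement (k : ℕ) (s : List ℕ) : List ℕ := s.map fun x => k + 1 - x

/-- The complement of the sequence for weight at least `k n - w + n`. -/
noncomputable def cycleAtMost (k n : ℕ) (w : ℤ) : List ℕ :=
  complement k (cycleAtLeast k n ((k : ℤ) * n - w + n))

/-- The substring of length `n` of the cyclic sequence `u` that starts at the (0-based)
position `i`; it wraps around as often as necessary. -/
def cyclicSubstring (u : List ℕ) (n i : ℕ) : List ℕ :=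
  (List.range n).map fun j => u.getD ((i + j) % u.length) 0

/-- The string `s` has rank `r` in the cyclic sequence `u`: it is the substring of `u` that
starts at the position `r`, where positions are counted from 1. -/
def HasRank (u s : List ℕ) (r : ℕ) : Prop :=
  1 ≤ r ∧ r ≤ u.length ∧ cyclicSubstring u s.length (r - 1) = s

/-- The cyclic sequence `u` is a universal cycle for the set `S` of strings: its length is
`|S|`, and every element of `S` occurs in it exactly once as a substring. -/
def IsUniversalCycle (u : List ℕ) (S : Finset (List ℕ)) : Prop :=
  u.length = S.card ∧ ∀ s ∈ S, ∃! r, HasRank u s r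

end UCycle

/-! The unit-cost random access machine. A program is a finite list of instructions, so it
mentions finitely many registers only; the main memory is accessed through addresses held in
registers. Each instruction costs one step. The machine is parametrized by the number of memory
cells and by the largest number that a register or a cell can hold: it gets stuck when it leaves
these bounds. -/

namespace RAM

/-- The arithmetic operations; subtraction is truncated at `0`, and division is rounded down. -/
inductive ArithOp where
  | add
  | sub
  | mul
  | div

def ArithOp.eval : ArithOp → ℕ → ℕ → ℕ
  | .add, x, y => x + y
  | .sub, x, y => x - y
  | .mul, x, y => x * y
  | .div, x, y => x / y

/-- The instructions; `d`, `a`, `b` are names of registers, `l` is a position in the program. -/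
inductive Instr where
  /-- `R[d] := c` -/
  | const (d c : ℕ)
  /-- `R[d] := R[a]` -/
  | move (d a : ℕ)
  /-- `R[d] := R[a] o R[b]` -/
  | arith (o : ArithOp) (d a b : ℕ)
  /-- `R[d] := M[R[a]]` -/
  | load (d a : ℕ)
  /-- `M[R[a]] := R[b]` -/
  | store (a b : ℕ)
  /-- go to `l` -/
  | jump (l : ℕ)
  /-- if `R[a] = R[b]` go to `l` -/
  | jumpEq (a b l : ℕ)
  /-- if `R[a] < R[b]` go to `l` -/
  | jumpLt (a b l : ℕ)

/-- A state: the program counter, the registers, and the main memory. -/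
structure State where
  pc : ℕ
  reg : ℕ → ℕ
  mem : ℕ → ℕ

/-- Write `v` into the register `d` and go on to the next instruction; `none` if `v` does not
fit into a word. -/
def State.setReg (W : ℕ) (σ : State) (d v : ℕ) : Option State :=
  if v ≤ W then some ⟨σ.pc + 1, Function.update σ.reg d v, σ.mem⟩ else none

/-- The effect of one instruction on a machine with the memory cells `0, …, S - 1` whose words
hold the numbers `0, …, W`; `none` if the instruction cannot be executed within these bounds. -/
def Instr.next (S W : ℕ) (σ : State) : Instr → Option State
  | .const d c => σ.setReg W d c
  | .move d a => σ.setReg W d (σ.reg a)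
  | .arith o d a b => σ.setReg W d (o.eval (σ.reg a) (σ.reg b))
  | .load d a => if σ.reg a < S then σ.setReg W d (σ.mem (σ.reg a)) else none
  | .store a b =>
      if σ.reg a < S ∧ σ.reg b ≤ W then
        some ⟨σ.pc + 1, σ.reg, Function.update σ.mem (σ.reg a) (σ.reg b)⟩
      else none
  | .jump l => some ⟨l, σ.reg, σ.mem⟩
  | .jumpEq a b l => some ⟨if σ.reg a = σ.reg b then l else σ.pc + 1, σ.reg, σ.mem⟩
  | .jumpLt a b l => some ⟨if σ.reg a < σ.reg b then l else σ.pc + 1, σ.reg, σ.mem⟩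

/-- `HaltsIn P S W σ t τ`: started in the state `σ`, the program `P` halts in the state `τ` after
exactly `t` steps, with memory addresses below `S` and written numbers at most `W` all along.
The machine halts when the program counter leaves the program. -/
inductive HaltsIn (P : List Instr) (S W : ℕ) : State → ℕ → State → Prop
  | halt (σ : State) (h : P.length ≤ σ.pc) : HaltsIn P S W σ 0 σ
  | step (σ τ ρ : State) (i : Instr) (t : ℕ) (hi : P[σ.pc]? = some i)
      (hn : i.next S W σ = some τ) (ht : HaltsIn P S W τ t ρ) : HaltsIn P S W σ (t + 1) ρ

/-- The initial state with the numbers of the list `x` in the registers `0, 1, …` and the numbers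
of the list `y` in the memory cells `0, 1, …`; everything else is `0`. -/
def initial (x y : List ℕ) : State := ⟨0, fun i => x.getD i 0, fun i => y.getD i 0⟩

end RAM

/-! Complementing turns the task into one about strings of weight at least `V = k n + n - w`
(truncated at 0), the set `S` below.

Universal cycle. A necklace has as many distinct rotations as its aperiodic prefix has symbols, and
different necklaces have disjoint rotation classes (`sum_length_aperiodicPrefix`). So the cycle has
`|S|` symbols, and it suffices to find each string somewhere: a surjection from positions onto `S`
is then a bijection. Let `ν = p q` be the least rotation of `s = q p`. If `q` is not all `k`,
raising `q` to `k…k` preserves the weight condition and moves every rotation above `ν`. Hence the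
next necklace lies between `ν` and `p k…k` and starts with `p` (`exists_next`). The block of `ν`
ends with `q`, so `s` is read across its end. If `q` is all `k`, then `s` is found where the
necklaces with prefix `p` begin: the block before them ends with `q`
(`aperiodicPrefix_eq_append_top`), or, if there is none, the end of the cycle does (`reads_top`).

Ranking. Up to an explicit offset, the position is the number of strings with some rotation at most
a given word, so one counts the strings all of whose rotations exceed a word `a`. For a prenecklace
`a` these are the strings that a matching automaton reads from some state `j < n` back to `j`
(`forall_lexLt_iff`), and `j` is unique. Cutting at the resets of the automaton gives a recurrence
for the table `resetCount` and a final sum (`aboveCount_eq`). There are `n (V + 1)` entries at `O(n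
k)` steps each, which is `O(n³ k²)`. A word that is not a prenecklace is first lowered without
changing the count (`aboveCount_decrease`).

Unranking. The block that covers position `i` belongs to the smallest word `α` such that more than
`i` strings have a rotation at most `α`. It is found symbol by symbol with binary search, hence by
`O(n log k)` counts; the string is read off `α` and, where necessary, the following block.

Machine. The programs are written in a small structured language; `reach_cmd` proves its compilation
correct with exact step counts, and the `Run` rules reduce correctness and running time to
invariants. -/

namespace RAM

/-! ### A structured language and its compilation to the machine -/

/-- Arithmetic expressions over variables and memory cells. -/
inductive Expr where
  | lit (c : ℕ)
  | var (x : ℕ)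
  | bin (o : ArithOp) (a b : Expr)
  | cell (a : Expr)

/-- Structured commands; the only test is `a < b`. -/
inductive Cmd where
  | assign (x : ℕ) (e : Expr)
  | put (a e : Expr)
  | seq (c d : Cmd)
  | ite (a b : Expr) (c d : Cmd)
  | loop (a b : Expr) (c : Cmd)

/-- The variables, the memory and the number of steps made so far. -/
structure Store where
  reg : ℕ → ℕ
  mem : ℕ → ℕ
  clk : ℕ

namespace Store

/-- Write a variable. -/
def set (σ : Store) (x v : ℕ) : Store := ⟨Function.update σ.reg x v, σ.mem, σ.clk⟩
/-- Write a memory cell. -/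
def put (σ : Store) (a v : ℕ) : Store := ⟨σ.reg, Function.update σ.mem a v, σ.clk⟩
/-- Let `t` steps pass. -/
def tick (σ : Store) (t : ℕ) : Store := ⟨σ.reg, σ.mem, σ.clk + t⟩

variable (σ : Store) (x v a t y : ℕ)
@[simp] theorem set_reg : (σ.set x v).reg y = if y = x then v else σ.reg y := by
  simp [set, Function.update_apply]
@[simp] theorem set_mem : (σ.set x v).mem = σ.mem := rfl
@[simp] theorem set_clk : (σ.set x v).clk = σ.clk := rfl
@[simp] theorem put_reg : (σ.put a v).reg = σ.reg := rfl
@[simp] theorem put_mem : (σ.put a v).mem y = if y = a then v else σ.mem y := by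
  simp [put, Function.update_apply]
@[simp] theorem put_clk : (σ.put a v).clk = σ.clk := rfl
@[simp] theorem tick_reg : (σ.tick t).reg = σ.reg := rfl
@[simp] theorem tick_mem : (σ.tick t).mem = σ.mem := rfl
@[simp] theorem tick_clk : (σ.tick t).clk = σ.clk + t := rfl

end Store

namespace Expr

/-- The value of an expression. -/
def eval (σ : Store) : Expr → ℕ
  | lit c => c
  | var x => σ.reg x
  | bin o a b => o.eval (a.eval σ) (b.eval σ)
  | cell a => σ.mem (a.eval σ)

/-- The number of instructions that evaluate an expression. -/
def cost : Expr → ℕ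
  | lit _ => 1
  | var _ => 1
  | bin _ a b => a.cost + b.cost + 1
  | cell a => a.cost + 1

/-- The evaluation stays within `S` memory cells and numbers up to `W`. -/
def Safe (S W : ℕ) (σ : Store) : Expr → Prop
  | lit c => c ≤ W
  | var x => x < 64
  | bin .add a b => a.Safe S W σ ∧ b.Safe S W σ ∧ a.eval σ + b.eval σ ≤ W
  | bin .mul a b => a.Safe S W σ ∧ b.Safe S W σ ∧ a.eval σ * b.eval σ ≤ W
  | bin _ a b => a.Safe S W σ ∧ b.Safe S W σ
  | cell a => a.Safe S W σ ∧ a.eval σ < S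

/-- Instructions that write the value of an expression to the register `d`, using the registers
from `d` on. -/
def code (d : ℕ) : Expr → List Instr
  | lit c => [.const d c]
  | var x => [.move d x]
  | bin o a b => a.code d ++ (b.code (d + 1) ++ [.arith o d d (d + 1)])
  | cell a => a.code d ++ [.load d d]

theorem length_code (e : Expr) (d : ℕ) : (e.code d).length = e.cost := by
  induction e generalizing d with
  | lit | var => rfl
  | bin o a b iha ihb => simp [code, cost, iha, ihb]; omega
  | cell a iha => simp [code, cost, iha]

end Expr

instance : Add Expr := ⟨.bin .add⟩
instance : Sub Expr := ⟨.bin .sub⟩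
instance : Mul Expr := ⟨.bin .mul⟩
instance : Div Expr := ⟨.bin .div⟩
-- The machine has no remainder instruction. Both operands are evaluated twice, and for `b = 0` the
-- value is `a`, in accordance with `%` on `ℕ`.
instance : Mod Expr := ⟨fun a b => a - a / b * b⟩

namespace Expr
variable (S W : ℕ) (σ : Store) (a b : Expr) (c x : ℕ)

@[simp] theorem eval_lit : (lit c).eval σ = c := rfl
@[simp] theorem eval_var : (var x).eval σ = σ.reg x := rfl
@[simp] theorem eval_add : (a + b).eval σ = a.eval σ + b.eval σ := rfl
@[simp] theorem eval_sub : (a - b).eval σ = a.eval σ - b.eval σ := rfl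
@[simp] theorem eval_mul : (a * b).eval σ = a.eval σ * b.eval σ := rfl
@[simp] theorem eval_div : (a / b).eval σ = a.eval σ / b.eval σ := rfl
@[simp] theorem eval_mod : (a % b).eval σ = a.eval σ % b.eval σ := by
  change a.eval σ - a.eval σ / b.eval σ * b.eval σ = _
  rw [mul_comm, ← Nat.mod_eq_sub_mul_div]
@[simp] theorem eval_cell : (cell a).eval σ = σ.mem (a.eval σ) := rfl
@[simp] theorem cost_lit : (lit c).cost = 1 := rfl
@[simp] theorem cost_var : (var x).cost = 1 := rfl
@[simp] theorem cost_add : (a + b).cost = a.cost + b.cost + 1 := rfl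
@[simp] theorem cost_sub : (a - b).cost = a.cost + b.cost + 1 := rfl
@[simp] theorem cost_mul : (a * b).cost = a.cost + b.cost + 1 := rfl
@[simp] theorem cost_div : (a / b).cost = a.cost + b.cost + 1 := rfl
@[simp] theorem cost_mod : (a % b).cost = 2 * a.cost + 2 * b.cost + 3 := by
  change a.cost + (a.cost + b.cost + 1 + b.cost + 1) + 1 = _
  ring
@[simp] theorem cost_cell : (cell a).cost = a.cost + 1 := rfl
@[simp] theorem safe_lit : (lit c).Safe S W σ ↔ c ≤ W := Iff.rfl
@[simp] theorem safe_var : (var x).Safe S W σ ↔ x < 64 := Iff.rfl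
@[simp] theorem safe_add :
    (a + b).Safe S W σ ↔ a.Safe S W σ ∧ b.Safe S W σ ∧ a.eval σ + b.eval σ ≤ W := Iff.rfl
@[simp] theorem safe_mul :
    (a * b).Safe S W σ ↔ a.Safe S W σ ∧ b.Safe S W σ ∧ a.eval σ * b.eval σ ≤ W := Iff.rfl
@[simp] theorem safe_sub : (a - b).Safe S W σ ↔ a.Safe S W σ ∧ b.Safe S W σ := Iff.rfl
@[simp] theorem safe_div : (a / b).Safe S W σ ↔ a.Safe S W σ ∧ b.Safe S W σ := Iff.rfl
@[simp] theorem safe_mod : (a % b).Safe S W σ ↔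
    a.Safe S W σ ∧ b.Safe S W σ ∧ a.eval σ / b.eval σ * b.eval σ ≤ W := by
  change a.Safe S W σ ∧ (a.Safe S W σ ∧ b.Safe S W σ) ∧ b.Safe S W σ ∧ _ ↔ _
  tauto
@[simp] theorem safe_cell : (cell a).Safe S W σ ↔ a.Safe S W σ ∧ a.eval σ < S := Iff.rfl

end Expr

/-- The big-step semantics of commands. -/
inductive Exec (S W : ℕ) : Cmd → Store → Store → Prop
  | assign {x e σ} (hx : x < 64) (he : e.Safe S W σ) :
      Exec S W (.assign x e) σ ((σ.set x (e.eval σ)).tick (e.cost + 1))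
  | put {a e σ} (ha : a.Safe S W σ) (he : e.Safe S W σ) (h : a.eval σ < S) :
      Exec S W (.put a e) σ ((σ.put (a.eval σ) (e.eval σ)).tick (a.cost + e.cost + 1))
  | seq {c d σ ρ τ} (hc : Exec S W c σ ρ) (hd : Exec S W d ρ τ) : Exec S W (.seq c d) σ τ
  | iteTrue {a b c d σ τ} (ha : a.Safe S W σ) (hb : b.Safe S W σ) (h : a.eval σ < b.eval σ)
      (hc : Exec S W c (σ.tick (a.cost + b.cost + 1)) τ) : Exec S W (.ite a b c d) σ τ
  -- The extra ticks in this and the following rules are the unconditional jumps of the compiled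
  -- code: over the other branch, back to the head of a loop, and out of a loop.
  | iteFalse {a b c d σ τ} (ha : a.Safe S W σ) (hb : b.Safe S W σ) (h : ¬ a.eval σ < b.eval σ)
      (hd : Exec S W d (σ.tick (a.cost + b.cost + 1)) τ) : Exec S W (.ite a b c d) σ (τ.tick 1)
  | loopTrue {a b c σ ρ τ} (ha : a.Safe S W σ) (hb : b.Safe S W σ) (h : a.eval σ < b.eval σ)
      (hc : Exec S W c (σ.tick (a.cost + b.cost + 1)) ρ)
      (hl : Exec S W (.loop a b c) (ρ.tick 1) τ) : Exec S W (.loop a b c) σ τ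
  | loopFalse {a b c σ} (ha : a.Safe S W σ) (hb : b.Safe S W σ) (h : ¬ a.eval σ < b.eval σ) :
      Exec S W (.loop a b c) σ (σ.tick (a.cost + b.cost + 2))

/-- The length of the code of a command. -/
def Cmd.size : Cmd → ℕ
  | assign _ e => e.cost + 1
  | put a e => a.cost + e.cost + 1
  | seq c d => c.size + d.size
  | ite a b c d => a.cost + b.cost + 1 + d.size + 1 + c.size
  | loop a b c => a.cost + b.cost + 2 + c.size + 1

/-- The code of a command that is placed at the position `o` of a program. -/
def Cmd.code (o : ℕ) : Cmd → List Instr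
  | assign x e => e.code 64 ++ [.move x 64]
  | put a e => a.code 64 ++ (e.code 65 ++ [.store 64 65])
  | seq c d => c.code o ++ d.code (o + c.size)
  | ite a b c d => a.code 64 ++ (b.code 65 ++
      ([.jumpLt 64 65 (o + (a.cost + b.cost + 1 + d.size + 1))] ++
      (d.code (o + (a.cost + b.cost + 1)) ++
      ([.jump (o + (a.cost + b.cost + 1 + d.size + 1 + c.size))] ++
      c.code (o + (a.cost + b.cost + 1 + d.size + 1))))))
  | loop a b c => a.code 64 ++ (b.code 65 ++
      ([.jumpLt 64 65 (o + (a.cost + b.cost + 2)), .jump (o + (a.cost + b.cost + 2 + c.size + 1))] ++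
      (c.code (o + (a.cost + b.cost + 2)) ++ [.jump o])))

theorem Cmd.length_code (c : Cmd) (o : ℕ) : (c.code o).length = c.size := by
  induction c generalizing o with
  | assign | put => simp [code, size, Expr.length_code]; try omega
  | seq c d ihc ihd => simp [code, size, ihc, ihd]
  | ite a b c d ihc ihd => simp [code, size, ihc, ihd, Expr.length_code]; omega
  | loop a b c ihc => simp [code, size, ihc, Expr.length_code]; omega

/-- The program `P` contains the list `l` at the position `o`. -/
def CodeAt (P : List Instr) (o : ℕ) (l : List Instr) : Prop :=
  ∀ i (h : i < l.length), P[o + i]? = some l[i]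

theorem CodeAt.append {P : List Instr} {o : ℕ} {l m : List Instr} (h : CodeAt P o (l ++ m)) :
    CodeAt P o l ∧ CodeAt P (o + l.length) m := by
  constructor
  · intro i hi
    rw [h i (by simp; omega), List.getElem_append_left hi]
  · intro i hi
    rw [add_assoc, h (l.length + i) (by simp; omega), List.getElem_append_right (by omega)]
    simp

theorem CodeAt.head {P : List Instr} {o : ℕ} {i : Instr} {l : List Instr}
    (h : CodeAt P o (i :: l)) : P[o]? = some i := h 0 (by simp)

/-- Within `m` steps the machine gets from `σ` to `τ`. -/
def Reach (P : List Instr) (S W m : ℕ) (σ τ : State) : Prop :=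
  ∀ t υ, HaltsIn P S W τ t υ → HaltsIn P S W σ (m + t) υ

theorem Reach.trans {P : List Instr} {S W m l : ℕ} {σ ρ τ : State} (h : Reach P S W m σ ρ)
    (g : Reach P S W l ρ τ) : Reach P S W (m + l) σ τ := fun t υ hτ => by
  rw [add_assoc]; exact h _ _ (g _ _ hτ)

theorem Reach.single {P : List Instr} {S W : ℕ} {σ τ : State} {i : Instr} (h : P[σ.pc]? = some i)
    (g : i.next S W σ = some τ) : Reach P S W 1 σ τ := fun t υ hτ => by
  rw [add_comm]; exact .step _ _ _ _ _ h g hτ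

/-- All numbers in the state are at most `W`. -/
def State.Bounded (W : ℕ) (ρ : State) : Prop := (∀ r, ρ.reg r ≤ W) ∧ ∀ a, ρ.mem a ≤ W

/-- The machine state `ρ` represents the store `σ`. -/
structure Repr (W : ℕ) (σ : Store) (ρ : State) : Prop where
  reg : ∀ r < 64, ρ.reg r = σ.reg r
  mem : ρ.mem = σ.mem
  bdd : ρ.Bounded W

theorem State.Bounded.setReg {W : ℕ} {ρ : State} (h : ρ.Bounded W) {d v : ℕ} (hv : v ≤ W) :
    State.Bounded W ⟨ρ.pc + 1, Function.update ρ.reg d v, ρ.mem⟩ := by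
  refine ⟨fun r => ?_, h.2⟩
  simp only [Function.update_apply]
  split
  · exact hv
  · exact h.1 r

/-- Evaluation into `d` leaves all registers below `d` alone. So a first operand kept in `d`
survives the evaluation of the second one in `d + 1`, and the variables, which are the registers
below 64, are never disturbed. -/
theorem reach_expr {P : List Instr} {S W : ℕ} {σ : Store} (e : Expr) (he : e.Safe S W σ) {d : ℕ}
    (hd : 64 ≤ d) {ρ : State} (hP : CodeAt P ρ.pc (e.code d)) (hR : Repr W σ ρ) :
    ∃ ρ', Reach P S W e.cost ρ ρ' ∧ Repr W σ ρ' ∧ ρ'.pc = ρ.pc + e.cost ∧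
      ρ'.reg d = e.eval σ ∧ ∀ r < d, ρ'.reg r = ρ.reg r := by
  have key : ∀ {ρ : State} {v : ℕ} {i : Instr}, Repr W σ ρ → P[ρ.pc]? = some i → v ≤ W →
      i.next S W ρ = ρ.setReg W d v →
      ∃ ρ', Reach P S W 1 ρ ρ' ∧ Repr W σ ρ' ∧ ρ'.pc = ρ.pc + 1 ∧
      ρ'.reg d = v ∧ ∀ r < d, ρ'.reg r = ρ.reg r := by
    intro ρ v i hR hi hv hn
    refine ⟨⟨ρ.pc + 1, Function.update ρ.reg d v, ρ.mem⟩, .single hi ?_,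
      ⟨fun r hr => ?_, hR.mem, hR.bdd.setReg hv⟩, rfl, by simp, fun r hr => ?_⟩
    · rw [hn, State.setReg, if_pos hv]
    · rw [← hR.reg r hr]; simp [Function.update_apply]; omega
    · simp [Function.update_apply]; omega
  induction e generalizing d ρ with
  | lit c => exact key hR hP.head he rfl
  | var x =>
    obtain ⟨ρ', h1, h2, h3, h4, h5⟩ := key hR hP.head (hR.bdd.1 x) rfl
    exact ⟨ρ', h1, h2, h3, by rw [h4, hR.reg x he]; rfl, h5⟩
  | bin o a b iha ihb =>
    have hs : a.Safe S W σ ∧ b.Safe S W σ := by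
      cases o <;> simp only [Expr.Safe] at he <;> tauto
    obtain ⟨ha, hb⟩ := hP.append
    obtain ⟨hb, hc⟩ := hb.append
    rw [Expr.length_code] at hb hc
    rw [Expr.length_code] at hc
    obtain ⟨ρ₁, r1, R1, p1, v1, f1⟩ := iha hs.1 hd ha hR key
    rw [← p1] at hb hc
    obtain ⟨ρ₂, r2, R2, p2, v2, f2⟩ := ihb hs.2 (by omega) hb R1 (fun {ρ v i} hR hi hv hn => by
      refine ⟨⟨ρ.pc + 1, Function.update ρ.reg (d + 1) v, ρ.mem⟩, .single hi ?_,
        ⟨fun r hr => ?_, hR.mem, hR.bdd.setReg hv⟩, rfl, by simp, fun r hr => ?_⟩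
      · rw [hn, State.setReg, if_pos hv]
      · rw [← hR.reg r hr]; simp [Function.update_apply]; omega
      · simp [Function.update_apply]; omega)
    rw [← p2] at hc
    have hva : ρ₂.reg d = a.eval σ := by rw [f2 d (by omega), v1]
    -- Safety bounds sums and products; a difference or a quotient is at most its first operand,
    -- which already sits in a register.
    have hle : o.eval (a.eval σ) (b.eval σ) ≤ W := by
      have h1 := R2.bdd.1 d
      rw [hva] at h1
      cases o with
      | add => exact he.2.2
      | mul => exact he.2.2
      | sub => exact (Nat.sub_le _ _).trans h1
      | div => exact (Nat.div_le_self _ _).trans h1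
    obtain ⟨ρ₃, r3, R3, p3, v3, f3⟩ := key R2 hc.head hle
      (by simp only [Instr.next]; rw [hva, v2])
    refine ⟨ρ₃, (r1.trans r2).trans r3, R3, by rw [p3, p2, p1]; simp only [Expr.cost]; omega, v3,
      fun r hr => ?_⟩
    rw [f3 r hr, f2 r (by omega), f1 r hr]
  | cell a iha =>
    obtain ⟨ha, hc⟩ := hP.append
    rw [Expr.length_code] at hc
    obtain ⟨ρ₁, r1, R1, p1, v1, f1⟩ := iha he.1 hd ha hR key
    rw [← p1] at hc
    obtain ⟨ρ₂, r2, R2, p2, v2, f2⟩ := key R1 hc.head (R1.bdd.2 (a.eval σ))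
      (by simp only [Instr.next]; rw [v1, if_pos he.2])
    exact ⟨ρ₂, r1.trans r2, R2, by rw [p2, p1]; rfl, by rw [v2, R1.mem]; rfl,
      fun r hr => by rw [f2 r hr, f1 r hr]⟩

theorem reach_exprs {P : List Instr} {S W : ℕ} {σ : Store} (a b : Expr) (ha : a.Safe S W σ)
    (hb : b.Safe S W σ) {l : List Instr} {ρ : State}
    (hP : CodeAt P ρ.pc (a.code 64 ++ (b.code 65 ++ l))) (hR : Repr W σ ρ) :
    ∃ ρ', Reach P S W (a.cost + b.cost) ρ ρ' ∧ Repr W σ ρ' ∧ ρ'.pc = ρ.pc + (a.cost + b.cost) ∧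
      ρ'.reg 64 = a.eval σ ∧ ρ'.reg 65 = b.eval σ ∧ CodeAt P (ρ.pc + (a.cost + b.cost)) l := by
  obtain ⟨pa, hP⟩ := hP.append
  obtain ⟨pb, hP⟩ := hP.append
  rw [Expr.length_code] at pb hP
  rw [Expr.length_code] at hP
  obtain ⟨ρ₁, r1, R1, p1, v1, f1⟩ := reach_expr a ha le_rfl pa hR
  rw [← p1] at pb
  obtain ⟨ρ₂, r2, R2, p2, v2, f2⟩ := reach_expr b hb (by omega) pb R1
  refine ⟨ρ₂, r1.trans r2, R2, by omega, by rw [f2 _ (by omega), v1], v2, ?_⟩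
  rwa [← add_assoc]

/-- Induction on the execution, following the layout of the code. The clock of the store advances by
exactly the number of machine steps, so all time bounds can be proved for stores. -/
theorem reach_cmd {P : List Instr} {S W : ℕ} {c : Cmd} {σ τ : Store} (h : Exec S W c σ τ)
    {ρ : State} (hP : CodeAt P ρ.pc (c.code ρ.pc)) (hR : Repr W σ ρ) :
    ∃ ρ' m, Reach P S W m ρ ρ' ∧ Repr W τ ρ' ∧ ρ'.pc = ρ.pc + c.size ∧ τ.clk = σ.clk + m := by
  induction h generalizing ρ with
  | @assign x e σ hx he =>
    obtain ⟨he', hm⟩ := hP.append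
    obtain ⟨ρ₁, r1, R1, p1, v1, f1⟩ := reach_expr e he le_rfl he' hR
    rw [Expr.length_code, ← p1] at hm
    have hv := R1.bdd.1 64
    refine ⟨⟨ρ₁.pc + 1, Function.update ρ₁.reg x (ρ₁.reg 64), ρ₁.mem⟩, _,
      r1.trans (.single hm.head (by simp only [Instr.next, State.setReg]; rw [if_pos hv])),
      ⟨fun r hr => ?_, R1.mem, R1.bdd.setReg hv⟩, by rw [p1]; rfl, rfl⟩
    simp [Function.update_apply, v1, R1.reg r hr]
  | @put a e σ ha he hS =>
    obtain ⟨ρ₁, r1, R1, p1, v1, v2, hl⟩ := reach_exprs a e ha he hP hR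
    rw [← p1] at hl
    have hv := R1.bdd.1 65
    refine ⟨⟨ρ₁.pc + 1, ρ₁.reg, Function.update ρ₁.mem (ρ₁.reg 64) (ρ₁.reg 65)⟩, _,
      r1.trans (.single hl.head (by simp only [Instr.next]; rw [if_pos ⟨by omega, hv⟩])),
      ⟨R1.reg, ?_, ⟨R1.bdd.1, fun b => ?_⟩⟩, by rw [p1]; rfl, rfl⟩
    · rw [v1, v2, R1.mem]; rfl
    · simp only [Function.update_apply]
      split
      · exact hv
      · exact R1.bdd.2 b
  | @seq c d σ ρ τ _ _ ihc ihd =>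
    obtain ⟨h1, h2⟩ := hP.append
    rw [Cmd.length_code] at h2
    obtain ⟨ρ₁, m1, r1, R1, p1, k1⟩ := ihc h1 hR
    rw [← p1] at h2
    obtain ⟨ρ₂, m2, r2, R2, p2, k2⟩ := ihd h2 R1
    exact ⟨ρ₂, _, r1.trans r2, R2, by rw [p2, p1]; simp only [Cmd.size]; omega, by omega⟩
  | @iteTrue a b c d σ τ ha hb hlt _ ihc =>
    obtain ⟨ρ₁, r1, R1, p1, v1, v2, hl⟩ := reach_exprs a b ha hb hP hR
    obtain ⟨hj, hl⟩ := hl.append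
    obtain ⟨hd, hl⟩ := hl.append
    obtain ⟨hj', hc⟩ := hl.append
    simp only [List.length_singleton, Cmd.length_code] at hc
    rw [← p1] at hj
    have r2 : Reach P S W 1 ρ₁
        ⟨ρ.pc + (a.cost + b.cost + 1 + d.size + 1), ρ₁.reg, ρ₁.mem⟩ :=
      .single hj.head (by simp only [Instr.next]; rw [v1, v2, if_pos hlt])
    have e1 : ρ.pc + (a.cost + b.cost) + 1 + d.size + 1 =
      ρ.pc + (a.cost + b.cost + 1 + d.size + 1) := by omega
    rw [e1] at hc
    obtain ⟨ρ₂, m2, r3, R2, p2, k2⟩ := ihc (ρ := ⟨ρ.pc + (a.cost + b.cost + 1 + d.size + 1), ρ₁.reg, ρ₁.mem⟩)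
      hc ⟨R1.reg, R1.mem, R1.bdd⟩
    exact ⟨ρ₂, _, (r1.trans r2).trans r3, R2, by rw [p2]; simp only [Cmd.size]; omega,
      by rw [k2]; simp only [Store.tick_clk]; omega⟩
  | @iteFalse a b c d σ τ ha hb hlt _ ihd =>
    obtain ⟨ρ₁, r1, R1, p1, v1, v2, hl⟩ := reach_exprs a b ha hb hP hR
    obtain ⟨hj, hl⟩ := hl.append
    obtain ⟨hd, hl⟩ := hl.append
    obtain ⟨hj', hc⟩ := hl.append
    simp only [List.length_singleton, Cmd.length_code] at hd hj'
    rw [← p1] at hj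
    have r2 : Reach P S W 1 ρ₁ ⟨ρ.pc + (a.cost + b.cost + 1), ρ₁.reg, ρ₁.mem⟩ :=
      .single hj.head (by simp only [Instr.next]; rw [v1, v2, if_neg hlt, p1]; rfl)
    rw [add_assoc ρ.pc] at hd hj'
    obtain ⟨ρ₂, m2, r3, R2, p2, k2⟩ := ihd (ρ := ⟨ρ.pc + (a.cost + b.cost + 1), ρ₁.reg, ρ₁.mem⟩)
      hd ⟨R1.reg, R1.mem, R1.bdd⟩
    rw [add_assoc ρ.pc, ← add_assoc ρ.pc] at hj'
    rw [← p2] at hj'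
    have r4 : Reach P S W 1 ρ₂
        ⟨ρ.pc + (a.cost + b.cost + 1 + d.size + 1 + c.size), ρ₂.reg, ρ₂.mem⟩ :=
      .single hj'.head rfl
    exact ⟨_, _, ((r1.trans r2).trans r3).trans r4, ⟨R2.reg, R2.mem, R2.bdd⟩, rfl,
      by simp only [Store.tick_clk] at k2 ⊢; omega⟩
  | @loopTrue a b c σ ρ' τ ha hb hlt _ _ ihc ihl =>
    obtain ⟨ρ₁, r1, R1, p1, v1, v2, hl⟩ := reach_exprs a b ha hb hP hR
    obtain ⟨hj, hl⟩ := hl.append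
    obtain ⟨hc, hj'⟩ := hl.append
    simp only [List.length_cons, List.length_nil, Cmd.length_code] at hc hj'
    rw [← p1] at hj
    have r2 : Reach P S W 1 ρ₁ ⟨ρ.pc + (a.cost + b.cost + 2), ρ₁.reg, ρ₁.mem⟩ :=
      .single hj.head (by simp only [Instr.next]; rw [v1, v2, if_pos hlt])
    rw [add_assoc ρ.pc] at hc hj'
    obtain ⟨ρ₂, m2, r3, R2, p2, k2⟩ := ihc (ρ := ⟨ρ.pc + (a.cost + b.cost + 2), ρ₁.reg, ρ₁.mem⟩)
      hc ⟨R1.reg, R1.mem, R1.bdd⟩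
    have p2' : ρ₂.pc = ρ.pc + (a.cost + b.cost + (0 + 1 + 1)) + c.size := p2
    rw [← p2'] at hj'
    have r4 : Reach P S W 1 ρ₂ ⟨ρ.pc, ρ₂.reg, ρ₂.mem⟩ := .single hj'.head rfl
    obtain ⟨ρ₃, m3, r5, R3, p3, k3⟩ := ihl (ρ := ⟨ρ.pc, ρ₂.reg, ρ₂.mem⟩) hP
      ⟨R2.reg, R2.mem, R2.bdd⟩
    exact ⟨ρ₃, _, (((r1.trans r2).trans r3).trans r4).trans r5, R3, p3,
      by simp only [Store.tick_clk] at k2 k3 ⊢; omega⟩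
  | @loopFalse a b c σ ha hb hlt =>
    obtain ⟨ρ₁, r1, R1, p1, v1, v2, hl⟩ := reach_exprs a b ha hb hP hR
    obtain ⟨hj, hl⟩ := hl.append
    have hj2 := hj 1 (by simp)
    rw [← p1] at hj hj2
    have r2 : Reach P S W 1 ρ₁ ⟨ρ₁.pc + 1, ρ₁.reg, ρ₁.mem⟩ :=
      .single hj.head (by simp only [Instr.next]; rw [v1, v2, if_neg hlt])
    have r3 : Reach P S W 1 ⟨ρ₁.pc + 1, ρ₁.reg, ρ₁.mem⟩
        ⟨ρ.pc + (a.cost + b.cost + 2 + c.size + 1), ρ₁.reg, ρ₁.mem⟩ := .single hj2 rfl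
    exact ⟨_, _, (r1.trans r2).trans r3, ⟨R1.reg, R1.mem, R1.bdd⟩, rfl, by simp⟩

/-- The command `c` started in `σ` terminates in a store that satisfies `Q`. -/
def Run (S W : ℕ) (c : Cmd) (Q : Store → Prop) (σ : Store) : Prop := ∃ τ, Exec S W c σ τ ∧ Q τ

/-- The only passage from commands to the machine: a program is verified as a command and then
transferred, with its running time read off the clock. -/
theorem Run.haltsIn {S W : ℕ} {c : Cmd} {Q : Store → Prop} {x y : List ℕ}
    (h : Run S W c Q ⟨(initial x y).reg, (initial x y).mem, 0⟩) (hx : ∀ a ∈ x, a ≤ W)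
    (hy : ∀ a ∈ y, a ≤ W) :
    ∃ t σ τ, HaltsIn (c.code 0) S W (initial x y) t σ ∧ Q τ ∧ τ.clk = t ∧
      (∀ r < 64, σ.reg r = τ.reg r) ∧ σ.mem = τ.mem := by
  obtain ⟨τ, hc, hQ⟩ := h
  have hb : ∀ l : List ℕ, (∀ a ∈ l, a ≤ W) → ∀ i, l.getD i 0 ≤ W := fun l hl i => by
    rw [List.getD_eq_getElem?_getD]
    rcases h : l[i]? with _ | v
    · simp
    · exact hl v (List.mem_of_getElem? h)
  obtain ⟨ρ, m, hr, R, hp, hk⟩ := reach_cmd (P := c.code 0) hc (ρ := initial x y)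
    (fun i hi => by simp [initial]) ⟨fun _ _ => rfl, rfl, hb x hx, hb y hy⟩
  refine ⟨m, ρ, τ, hr 0 ρ (.halt _ ?_), hQ, by simpa using hk, R.reg, R.mem⟩
  rw [hp, Cmd.length_code]
  exact Nat.le_add_left _ _

section
variable {S W : ℕ} {Q : Store → Prop} {σ : Store}

-- This and the following rules are equivalences, so that `simp` executes straight-line code
-- symbolically and leaves arithmetic side goals.
@[simp] theorem run_assign {x : ℕ} {e : Expr} : Run S W (.assign x e) Q σ ↔
    (x < 64 ∧ e.Safe S W σ) ∧ Q ((σ.set x (e.eval σ)).tick (e.cost + 1)) :=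
  ⟨fun ⟨_, h, q⟩ => by cases h with | assign hx he => exact ⟨⟨hx, he⟩, q⟩,
    fun ⟨⟨hx, he⟩, q⟩ => ⟨_, .assign hx he, q⟩⟩

@[simp] theorem run_put {a e : Expr} : Run S W (.put a e) Q σ ↔
    (a.Safe S W σ ∧ e.Safe S W σ ∧ a.eval σ < S) ∧
      Q ((σ.put (a.eval σ) (e.eval σ)).tick (a.cost + e.cost + 1)) :=
  ⟨fun ⟨_, h, q⟩ => by cases h with | put ha he hS => exact ⟨⟨ha, he, hS⟩, q⟩,
    fun ⟨⟨ha, he, hS⟩, q⟩ => ⟨_, .put ha he hS, q⟩⟩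

@[simp] theorem run_seq {c d : Cmd} : Run S W (.seq c d) Q σ ↔ Run S W c (Run S W d Q) σ :=
  ⟨fun ⟨_, h, q⟩ => by cases h with | seq hc hd => exact ⟨_, hc, _, hd, q⟩,
    fun ⟨_, hc, _, hd, q⟩ => ⟨_, .seq hc hd, q⟩⟩

theorem Run.mono {c : Cmd} {Q' : Store → Prop} (h : Run S W c Q σ) (hQ : ∀ τ, Q τ → Q' τ) :
    Run S W c Q' σ := h.imp fun _ h => ⟨h.1, hQ _ h.2⟩

@[simp] theorem run_ite {a b : Expr} {c d : Cmd} : Run S W (.ite a b c d) Q σ ↔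
    (a.Safe S W σ ∧ b.Safe S W σ) ∧
      (a.eval σ < b.eval σ → Run S W c Q (σ.tick (a.cost + b.cost + 1))) ∧
      (¬ a.eval σ < b.eval σ →
        Run S W d (fun τ => Q (τ.tick 1)) (σ.tick (a.cost + b.cost + 1))) := by
  constructor
  · rintro ⟨_, h, q⟩
    cases h with
    | iteTrue ha hb h hc => exact ⟨⟨ha, hb⟩, fun _ => ⟨_, hc, q⟩, fun h' => absurd h h'⟩
    | iteFalse ha hb h hc => exact ⟨⟨ha, hb⟩, fun h' => absurd h' h, fun _ => ⟨_, hc, q⟩⟩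
  · rintro ⟨⟨ha, hb⟩, h1, h2⟩
    by_cases h : a.eval σ < b.eval σ
    · obtain ⟨τ, hc, q⟩ := h1 h
      exact ⟨τ, .iteTrue ha hb h hc, q⟩
    · obtain ⟨τ, hc, q⟩ := h2 h
      exact ⟨_, .iteFalse ha hb h hc, q⟩

/-- The rule for loops: `I` is the invariant, `μ` bounds the number of iterations, and an iteration
takes at most `K` steps. -/
theorem Run.loop {a b : Expr} {c : Cmd} (I : (ℕ → ℕ) → (ℕ → ℕ) → Prop) (μ : (ℕ → ℕ) → ℕ) (K : ℕ)
    (h0 : I σ.reg σ.mem)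
    (hs : ∀ ρ, I ρ.reg ρ.mem → a.Safe S W ρ ∧ b.Safe S W ρ)
    (hb : ∀ ρ, I ρ.reg ρ.mem → a.eval ρ < b.eval ρ →
      Run S W c (fun τ => I τ.reg τ.mem ∧ μ τ.reg < μ ρ.reg ∧ τ.clk ≤ ρ.clk + K) ρ)
    (hQ : ∀ ρ, I ρ.reg ρ.mem → ¬ a.eval ρ < b.eval ρ →
      ρ.clk ≤ σ.clk + μ σ.reg * (K + a.cost + b.cost + 2) + (a.cost + b.cost + 2) → Q ρ) :
    Run S W (.loop a b c) Q σ := by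
  have ev : ∀ (e : Expr) (ρ : Store) t, e.eval (ρ.tick t) = e.eval ρ := fun e ρ t => by
    induction e with
    | bin o a b iha ihb => simp only [Expr.eval, iha, ihb]
    | cell a iha => simp only [Expr.eval, iha]; rfl
    | _ => rfl
  induction hm : μ σ.reg using Nat.strong_induction_on generalizing σ with
  | _ m ih =>
    obtain ⟨ha, hb'⟩ := hs σ h0
    by_cases h : a.eval σ < b.eval σ
    · obtain ⟨τ, hc, hI, hμ, hk⟩ := hb (σ.tick (a.cost + b.cost + 1)) h0 (by rwa [ev, ev])
      simp only [Store.tick_reg, Store.tick_clk] at hμ hk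
      obtain ⟨υ, hl, hq⟩ := ih (μ τ.reg) (by omega) (σ := τ.tick 1) hI (fun ρ hρ hn hk' => by
        refine hQ ρ hρ hn (hk'.trans ?_)
        simp only [Store.tick_reg, Store.tick_clk]
        obtain ⟨e, he⟩ := Nat.exists_eq_add_of_lt hμ
        rw [he]
        nlinarith [Nat.zero_le (e * (K + a.cost + b.cost + 2))]) rfl
      exact ⟨υ, .loopTrue ha hb' h hc hl, hq⟩
    · refine ⟨_, .loopFalse ha hb' h, hQ _ h0 (by rwa [ev, ev]) ?_⟩
      simp only [Store.tick_clk]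
      have := Nat.zero_le (μ σ.reg * (K + a.cost + b.cost + 2))
      omega

/-- `for x in 0, …, e - 1 do c` -/
def Cmd.for (x : ℕ) (e : Expr) (c : Cmd) : Cmd :=
  .seq (.assign x (.lit 0)) (.loop (.var x) e (.seq c (.assign x (.var x + .lit 1))))

/-- The bound `e` is evaluated again before each iteration and must keep the value `N`. An iteration
costs `K` for the body, 4 for the increment and `e.cost + 3` for the test and the jump back; the
start and the final test make up `e.cost + 5`. -/
theorem Run.for {x : ℕ} {e : Expr} {c : Cmd} (N : ℕ) (I : ℕ → (ℕ → ℕ) → (ℕ → ℕ) → Prop) (K : ℕ)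
    (hx : x < 64) (hN : N ≤ W) (hW : 1 ≤ W)
    (h0 : I 0 (σ.set x 0).reg σ.mem)
    (he : ∀ i ≤ N, ∀ ρ, I i ρ.reg ρ.mem → ρ.reg x = i → e.Safe S W ρ ∧ e.eval ρ = N)
    (hb : ∀ i < N, ∀ ρ, I i ρ.reg ρ.mem → ρ.reg x = i →
      Run S W c (fun τ => τ.clk ≤ ρ.clk + K ∧ τ.reg x = i ∧
        I (i + 1) (τ.set x (i + 1)).reg τ.mem) ρ)
    (hQ : ∀ ρ, I N ρ.reg ρ.mem → ρ.reg x = N →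
      ρ.clk ≤ σ.clk + (N * (K + e.cost + 7) + (e.cost + 5)) → Q ρ) :
    Run S W (.for x e c) Q σ := by
  rw [Cmd.for, run_seq, run_assign]
  refine ⟨⟨hx, Nat.zero_le _⟩, ?_⟩
  refine Run.loop (fun r m => r x ≤ N ∧ I (r x) r m) (fun r => N - r x) (K + 4) ?_ ?_ ?_ ?_
  · simpa [Store.set] using h0
  · intro ρ ⟨h1, h2⟩
    exact ⟨hx, (he _ h1 ρ h2 rfl).1⟩
  · intro ρ ⟨h1, h2⟩ hlt
    rw [(he _ h1 ρ h2 rfl).2] at hlt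
    simp only [Expr.eval_var] at hlt
    rw [run_seq]
    refine (hb _ hlt ρ h2 rfl).mono fun τ ⟨t1, t2, t3⟩ => ?_
    simp only [run_assign, Expr.safe_add, Expr.safe_var, Expr.safe_lit, Expr.eval_add,
      Expr.eval_var, Expr.eval_lit, Expr.cost_add, Expr.cost_var, Expr.cost_lit, t2]
    refine ⟨⟨hx, hx, hW, by omega⟩, ?_, ?_, ?_⟩
    · simp only [Store.tick_reg, Store.set_reg, if_true, Store.tick_mem, Store.set_mem]
      exact ⟨hlt, t3⟩
    · simp; omega
    · simp; omega
  · intro ρ ⟨h1, h2⟩ hn hk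
    rw [(he _ h1 ρ h2 rfl).2] at hn
    simp only [Expr.eval_var] at hn
    have hN : ρ.reg x = N := by omega
    rw [hN] at h2
    refine hQ ρ h2 hN (hk.trans ?_)
    simp only [Store.tick_reg, Store.set_reg, Store.tick_clk, Store.set_clk, if_true,
      Expr.cost_var, Expr.cost_lit, Expr.eval_lit, Nat.sub_zero]
    have : K + 4 + 1 + e.cost + 2 = K + e.cost + 7 := by ring
    rw [this]
    omega

end

end RAM

/-! ### The matching automaton and the strings all of whose rotations exceed a word -/

namespace UCycle

/-- The word `a 0, …, a (n - 1)` is a prefix of a power of a necklace. -/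
def IsPrenecklace (n : ℕ) (a : ℕ → ℕ) : Prop :=
  ∀ d i, d + i < n → (∀ l < i, a l = a (d + l)) → a i ≤ a (d + i)

/-- The word `f 0, …, f (n - 1)` is lexicographically smaller than `g 0, …, g (n - 1)`. -/
def LexLt (n : ℕ) (f g : ℕ → ℕ) : Prop := ∃ i < n, (∀ l < i, f l = g l) ∧ f i < g i

/-- The automaton that compares the input with `a`: the state is the number of symbols that agree,
it is reset when a symbol exceeds the one expected, and there is no next state if the symbol is
smaller than the one expected or the word is used up. -/
def step (n : ℕ) (a : ℕ → ℕ) (j c : ℕ) : Option ℕ :=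
  if n ≤ j ∨ c < a j then none else if c = a j then some (j + 1) else some 0

/-- The state after reading a string. -/
def run (n : ℕ) (a : ℕ → ℕ) : ℕ → List ℕ → Option ℕ
  | j, [] => some j
  | j, c :: y => (step n a j c).bind fun i => run n a i y

/-- The first `i` symbols of `a` are a suffix of the first `j` symbols. -/
def Border (a : ℕ → ℕ) (i j : ℕ) : Prop := i ≤ j ∧ ∀ l < i, a l = a (j - i + l)

theorem Border.zero (a : ℕ → ℕ) (j : ℕ) : Border a 0 j := ⟨Nat.zero_le _, by simp⟩

section
variable {n : ℕ} {a : ℕ → ℕ}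

theorem run_append (j : ℕ) (y z : List ℕ) :
    run n a j (y ++ z) = (run n a j y).bind fun i => run n a i z := by
  induction y generalizing j with
  | nil => rfl
  | cons c y ih =>
    simp only [List.cons_append, run, Option.bind_assoc, ih]

theorem run_concat (j : ℕ) (y : List ℕ) (c : ℕ) :
    run n a j (y ++ [c]) = (run n a j y).bind fun i => step n a i c := by
  rw [run_append]
  congr 1
  funext i
  simp [run]

theorem step_eq_some {j c e : ℕ} : step n a j c = some e ↔
    j < n ∧ (c = a j ∧ e = j + 1 ∨ a j < c ∧ e = 0) := by
  unfold step
  split_ifs with h1 h2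
  · simp; omega
  · simp; omega
  · simp; omega

theorem run_append_eq_some {j e : ℕ} {y z : List ℕ} : run n a j (y ++ z) = some e ↔
    ∃ i, run n a j y = some i ∧ run n a i z = some e := by
  rw [run_append, Option.bind_eq_some_iff]

theorem run_concat_eq_some {j e : ℕ} {y : List ℕ} {c : ℕ} : run n a j (y ++ [c]) = some e ↔
    ∃ i, run n a j y = some i ∧ step n a i c = some e := by
  rw [run_concat, Option.bind_eq_some_iff]

theorem run_cons_eq_some {j e : ℕ} {y : List ℕ} {c : ℕ} : run n a j (c :: y) = some e ↔
    ∃ i, step n a j c = some i ∧ run n a i y = some e := by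
  rw [run, Option.bind_eq_some_iff]

/-- If the first `i` symbols of `a` end its first `j` symbols, the prenecklace property gives `a i ≤
a j`. Hence a symbol that is allowed in state `j` is allowed in state `i`, and the two states remain
nested. -/
theorem step_border (h : IsPrenecklace n a) {i j c e : ℕ} (hb : Border a i j)
    (hs : step n a j c = some e) : ∃ e', step n a i c = some e' ∧ Border a e' e := by
  obtain ⟨hij, hl⟩ := hb
  obtain ⟨hj, hs⟩ := step_eq_some.1 hs
  have hle := h (j - i) i (by omega) hl
  rw [Nat.sub_add_cancel hij] at hle
  simp only [step_eq_some]
  rcases hs with ⟨rfl, rfl⟩ | ⟨hc, rfl⟩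
  · rcases hle.eq_or_lt with hle | hle
    · refine ⟨i + 1, ⟨by omega, .inl ⟨hle.symm, rfl⟩⟩, by omega, fun l hl' => ?_⟩
      rw [Nat.add_sub_add_right]
      rcases Nat.lt_succ_iff_lt_or_eq.1 hl' with hl' | rfl
      · exact hl l hl'
      · rw [hle, Nat.sub_add_cancel hij]
    · exact ⟨0, ⟨by omega, .inr ⟨hle, rfl⟩⟩, .zero _ _⟩
  · exact ⟨0, ⟨by omega, .inr ⟨by omega, rfl⟩⟩, .zero _ _⟩

theorem run_border (h : IsPrenecklace n a) {y : List ℕ} {i j e : ℕ} (hb : Border a i j)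
    (hs : run n a j y = some e) : ∃ e', run n a i y = some e' ∧ Border a e' e := by
  induction y generalizing i j with
  | nil =>
    obtain rfl : j = e := by simpa [run] using hs
    exact ⟨i, rfl, hb⟩
  | cons c y ih =>
    obtain ⟨j', hj, hs⟩ := run_cons_eq_some.1 hs
    obtain ⟨i', hi, hb⟩ := step_border h hb hj
    obtain ⟨e', he, hb⟩ := ih hb hs
    exact ⟨e', run_cons_eq_some.2 ⟨_, hi, he⟩, hb⟩

/-- After a reset the state tells which symbols have been read. -/
theorem run_eq_append {y : List ℕ} {j e : ℕ} (h : run n a j y = some e) :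
    e = j + y.length ∨ ∃ z, y = z ++ (List.range e).map a ∧ run n a j z = some 0 := by
  induction y using List.reverseRecOn generalizing e with
  | nil =>
    left
    simpa [run, eq_comm] using h
  | append_singleton y c ih =>
    obtain ⟨i, hi, hs⟩ := run_concat_eq_some.1 h
    obtain ⟨-, hs⟩ := step_eq_some.1 hs
    rcases hs with ⟨rfl, rfl⟩ | ⟨hc, rfl⟩
    · rcases ih hi with rfl | ⟨z, hz, hr⟩
      · left; simp; omega
      · exact .inr ⟨z, by rw [List.range_succ, List.map_append, ← List.append_assoc, ← hz]; rfl, hr⟩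
    · exact .inr ⟨y ++ [c], by simp, h⟩

theorem run_of_append {z : List ℕ} {j e : ℕ} (he : e ≤ n) (h : run n a j z = some 0) :
    run n a j (z ++ (List.range e).map a) = some e := by
  induction e with
  | zero => simpa using h
  | succ e ih =>
    rw [List.range_succ, List.map_append, ← List.append_assoc]
    exact run_concat_eq_some.2 ⟨e, ih (by omega), step_eq_some.2 ⟨by omega, .inl ⟨rfl, rfl⟩⟩⟩

/-- Reading `n` symbols and ending below `n` forces a reset. At that reset the run from 0 is nested
in the run from `j`, so it is in state 0 too, and the two runs coincide from there on. -/
theorem run_reset (h : IsPrenecklace n a) {y : List ℕ} (hy : y.length = n) {j e : ℕ} (he : e < n)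
    (hr : run n a j y = some e) : run n a 0 y = some e := by
  rcases run_eq_append hr with h' | ⟨z, rfl, hz⟩
  · omega
  · obtain ⟨e', hz', hb⟩ := run_border h (.zero a j) hz
    obtain rfl : e' = 0 := by have := hb.1; omega
    exact run_of_append he.le hz'

theorem getD_append_single (y : List ℕ) (c l : ℕ) :
    (y ++ [c]).getD l 0 = if l < y.length then y.getD l 0 else if l = y.length then c else 0 := by
  simp only [List.getD_eq_getElem?_getD, List.getElem?_append]
  split_ifs with h1 h2
  · rfl
  · simp [h2]
  · rw [List.getElem?_eq_none (by simp; omega)]; rfl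

/-- Before the first reset the input agrees with `a`, and the symbol that causes the reset exceeds
`a`. -/
theorem run_zero_lt {y : List ℕ} {e : ℕ} (h : run n a 0 y = some e) :
    e = y.length ∧ (∀ l < y.length, a l = y.getD l 0) ∨
      y.length ≠ 0 ∧ LexLt y.length a fun l => y.getD l 0 := by
  induction y using List.reverseRecOn generalizing e with
  | nil => left; simpa [run, eq_comm] using h
  | append_singleton y c ih =>
    obtain ⟨i, hi, hs⟩ := run_concat_eq_some.1 h
    obtain ⟨-, hs⟩ := step_eq_some.1 hs
    simp only [List.length_append, List.length_singleton, getD_append_single]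
    rcases ih hi with ⟨rfl, hl⟩ | ⟨-, i, hi, hl, hlt⟩
    · rcases hs with ⟨rfl, rfl⟩ | ⟨hc, rfl⟩
      · left
        refine ⟨rfl, fun l hl' => ?_⟩
        split_ifs with h1 h2
        · exact hl l h1
        · rw [h2]
        · omega
      · right
        refine ⟨by omega, y.length, by omega, fun l hl' => ?_, by simpa using hc⟩
        simp only [if_pos hl']
        exact hl l hl'
    · right
      refine ⟨by omega, i, by omega, fun l hl' => ?_, ?_⟩
      · simp only [if_pos (show l < y.length by omega)]; exact hl l hl'
      · simpa only [if_pos hi] using hlt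

theorem run_zero_suffix {y : List ℕ} {e : ℕ} (h : run n a 0 y = some e) :
    e ≤ y.length ∧ ∀ l < e, a l = y.getD (y.length - e + l) 0 := by
  induction y using List.reverseRecOn generalizing e with
  | nil =>
    obtain rfl : e = 0 := by simpa [run, eq_comm] using h
    simp
  | append_singleton y c ih =>
    obtain ⟨i, hi, hs⟩ := run_concat_eq_some.1 h
    obtain ⟨-, hs⟩ := step_eq_some.1 hs
    simp only [List.length_append, List.length_singleton, getD_append_single]
    obtain ⟨h1, h2⟩ := ih hi
    rcases hs with ⟨rfl, rfl⟩ | ⟨hc, rfl⟩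
    · refine ⟨by omega, fun l hl => ?_⟩
      rw [Nat.add_sub_add_right]
      rcases Nat.lt_succ_iff_lt_or_eq.1 hl with hl | rfl
      · rw [if_pos (by omega)]; exact h2 l hl
      · rw [if_neg (by omega), if_pos (by omega)]
    · simp

theorem getD_rotate {y : List ℕ} {l : ℕ} (hl : l < y.length) (r : ℕ) :
    (y.rotate r).getD l 0 = y.getD ((r + l) % y.length) 0 := by
  rw [List.getD_eq_getElem?_getD, List.getD_eq_getElem?_getD, List.getElem?_rotate hl, add_comm]

theorem map_getD_range (y : List ℕ) : (List.range y.length).map (fun l => y.getD l 0) = y :=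
  List.ext_getElem (by simp) fun i h1 h2 => by simp [h2]

/-- All rotations of `y` exceed `a` if and only if the automaton can read `y` around a cycle. -/
theorem forall_lexLt_iff (h : IsPrenecklace n a) (hn : 0 < n) {y : List ℕ} (hy : y.length = n) :
    (∀ r, LexLt n a fun l => y.getD ((r + l) % n) 0) ↔ ∃ j < n, run n a j y = some j := by
  constructor
  · intro hr
    set s : ℕ → ℕ := fun l => y.getD (l % n) 0 with hs
    -- The automaton never gets stuck on the periodic continuation of `y`. In state `e` the last `e`
    -- symbols match `a`; the rotation that starts with them exceeds `a`, so the next symbol is at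
    -- least `a e`. The state stays below `n` because no rotation equals `a`.
    have key : ∀ i, ∃ e < n, run n a 0 ((List.range i).map s) = some e := by
      intro i
      induction i with
      | zero => exact ⟨0, hn, rfl⟩
      | succ i ih =>
        obtain ⟨e, he, hi⟩ := ih
        obtain ⟨h1, h2⟩ := run_zero_suffix hi
        simp only [List.length_map, List.length_range] at h1 h2
        obtain ⟨t, ht, ht1, ht2⟩ := hr (i - e)
        change ∀ l < t, a l = s (i - e + l) at ht1
        change a t < s (i - e + t) at ht2
        have het : e ≤ t := by
          by_contra hlt
          have := h2 t (by omega)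
          rw [List.getD_eq_getElem?_getD, List.getElem?_map, List.getElem?_range (by omega)] at this
          simp at this
          omega
        rw [List.range_succ, List.map_append]
        rcases het.eq_or_lt with rfl | hlt
        · rw [Nat.sub_add_cancel h1] at ht2
          exact ⟨0, hn, run_concat_eq_some.2 ⟨_, hi, step_eq_some.2 ⟨he, .inr ⟨ht2, rfl⟩⟩⟩⟩
        · have := ht1 e hlt
          rw [Nat.sub_add_cancel h1] at this
          exact ⟨e + 1, by omega, run_concat_eq_some.2 ⟨_, hi, step_eq_some.2
            ⟨he, .inl ⟨this.symm, rfl⟩⟩⟩⟩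
    have hy' : (List.range n).map s = y := by
      conv_rhs => rw [← map_getD_range y, hy]
      refine List.map_congr_left fun l hl => ?_
      simp only [hs, Nat.mod_eq_of_lt (List.mem_range.1 hl)]
    obtain ⟨e₁, he₁, h1⟩ := key n
    obtain ⟨e₂, he₂, h2⟩ := key (n + n)
    rw [hy'] at h1
    rw [List.range_add, List.map_append, hy', List.map_map] at h2
    have : (List.range n).map (s ∘ fun l => n + l) = y := by
      rw [← hy']
      refine List.map_congr_left fun l _ => ?_
      simp [hs]
    rw [this] at h2
    -- The second pass over `y` starts in `e₁`; by `run_reset` it ends where a pass from 0 ends,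
    -- which is `e₁` again.
    obtain ⟨i, hi, h2⟩ := run_append_eq_some.1 h2
    obtain rfl : e₁ = i := by rw [hi] at h1; exact (Option.some.inj h1).symm
    have h3 := run_reset h hy he₂ h2
    obtain rfl : e₁ = e₂ := by rw [hi] at h3; exact Option.some.inj h3
    exact ⟨e₁, he₁, h2⟩
  · rintro ⟨j, hj, hr⟩ r
    have hlt : r % n < n := Nat.mod_lt _ hn
    rw [← List.take_append_drop (r % n) y] at hr
    obtain ⟨e, h1, h2⟩ := run_append_eq_some.1 hr
    have he : e < n := by
      rcases hd : y.drop (r % n) with _ | ⟨c, z⟩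
      · have := congrArg List.length hd; simp at this; omega
      · rw [hd] at h2
        obtain ⟨i, hi, -⟩ := run_cons_eq_some.1 h2
        exact (step_eq_some.1 hi).1
    have h3 : run n a e (y.drop (r % n) ++ y.take (r % n)) = some e :=
      run_append_eq_some.2 ⟨j, h2, h1⟩
    rw [← List.rotate_eq_drop_append_take (by omega)] at h3
    -- The rotated string is read from `e` back to `e`, hence also from 0, and its final state `e' ≤
    -- e < n` excludes equality with `a`.
    obtain ⟨e', h4, hb⟩ := run_border h (.zero a e) h3
    rcases run_zero_lt h4 with ⟨h5, -⟩ | ⟨-, h5⟩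
    · rw [List.length_rotate] at h5
      have := hb.1
      omega
    · rw [List.length_rotate, hy] at h5
      obtain ⟨i, hi, h6, h7⟩ := h5
      have e1 : ∀ l < n, (y.rotate (r % n)).getD l 0 = y.getD ((r + l) % n) 0 := fun l hl => by
        rw [getD_rotate (by omega), hy, Nat.mod_add_mod]
      exact ⟨i, hi, fun l hl => (h6 l hl).trans (e1 l (by omega)), h7.trans_eq (e1 i hi)⟩

/-- The words of length `m` and weight at least `x` that lead from the state `j` to the state `0`. -/
def resetCount (k n : ℕ) (a : ℕ → ℕ) (j m x : ℕ) : ℕ :=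
  ((strings k m).filter fun y => run n a j y = some 0 ∧ x ≤ y.sum).card

theorem card_filter_strings_succ (k m : ℕ) (P : List ℕ → Prop) [DecidablePred P] :
    ((strings k (m + 1)).filter P).card =
      ∑ c ∈ Finset.Icc 1 k, ((strings k m).filter fun y => P (c :: y)).card := by
  rw [Finset.card_eq_sum_card_fiberwise (f := fun y => y.headD 0) (t := Finset.Icc 1 k)]
  · refine Finset.sum_congr rfl fun c hc => ?_
    symm
    refine Finset.card_bij (fun y _ => c :: y) ?_ ?_ ?_
    · intro y hy
      simp only [Finset.mem_filter, mem_strings, Finset.mem_Icc] at hy hc ⊢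
      refine ⟨⟨⟨by simp [hy.1.1], ?_⟩, hy.2⟩, rfl⟩
      simpa using ⟨hc, hy.1.2⟩
    · intro y _ z _ h
      exact (List.cons.inj h).2
    · intro y hy
      simp only [Finset.mem_filter, mem_strings] at hy
      obtain ⟨⟨⟨h1, h2⟩, h3⟩, h4⟩ := hy
      rcases y with _ | ⟨b, y⟩
      · simp at h1
      · obtain rfl : b = c := h4
        refine ⟨y, ?_, rfl⟩
        simp only [Finset.mem_filter, mem_strings]
        exact ⟨⟨by simpa using h1, fun x hx => h2 x (List.mem_cons_of_mem _ hx)⟩, h3⟩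
  · intro y hy
    simp only [Finset.coe_filter, Set.mem_ofPred_eq, mem_strings] at hy
    rcases y with _ | ⟨b, y⟩
    · simp at hy
    · simpa using hy.1.2 b (by simp)

theorem strings_zero (k : ℕ) : strings k 0 = {[]} := by
  ext y
  simp +contextual [mem_strings]

theorem resetCount_zero (k j x : ℕ) :
    resetCount k n a j 0 x = if j = 0 ∧ x = 0 then 1 else 0 := by
  rw [resetCount, strings_zero, Finset.filter_singleton]
  simp only [run, Option.some.injEq, List.sum_nil, Nat.le_zero]
  split_ifs <;> simp

/-- The first symbol either continues the match or exceeds it and resets. A match with the symbol 0,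
which is outside the alphabet, contributes nothing. Truncated subtraction suits the required weight,
since 0 imposes no condition. -/
theorem resetCount_succ {k j : ℕ} (hj : j < n) (ha : a j ≤ k) (m x : ℕ) :
    resetCount k n a j (m + 1) x =
      (if a j = 0 then 0 else 1) * resetCount k n a (j + 1) m (x - a j) +
      ∑ c ∈ Finset.range (k - a j), resetCount k n a 0 m (x - (a j + 1 + c)) := by
  rw [resetCount, card_filter_strings_succ]
  have : ∀ c ∈ Finset.Icc 1 k, ((strings k m).filter fun y =>
      run n a j (c :: y) = some 0 ∧ x ≤ (c :: y).sum).card =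
      (if c = a j then resetCount k n a (j + 1) m (x - a j) else 0) +
      if a j < c then resetCount k n a 0 m (x - c) else 0 := by
    intro c _
    rcases lt_trichotomy c (a j) with h | rfl | h
    · rw [if_neg (by omega), if_neg (by omega), Finset.card_eq_zero, Finset.filter_eq_empty_iff]
      rintro y - ⟨h', -⟩
      obtain ⟨i, h', -⟩ := run_cons_eq_some.1 h'
      have := step_eq_some.1 h'
      omega
    · rw [if_pos rfl, if_neg (by omega), add_zero, resetCount]
      congr 1
      refine Finset.filter_congr fun y _ => ?_
      simp [run_cons_eq_some, step_eq_some, hj, add_comm]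
    · rw [if_neg (by omega), if_pos h, zero_add, resetCount]
      congr 1
      refine Finset.filter_congr fun y _ => ?_
      simp [run_cons_eq_some, step_eq_some, hj, h, h.ne', add_comm]
  rw [Finset.sum_congr rfl this, Finset.sum_add_distrib]
  congr 1
  · rw [Finset.sum_ite_eq']
    by_cases h : a j = 0
    · simp [h]
    · rw [if_pos (by simp; omega), if_neg h, one_mul]
  · rw [← Finset.sum_filter]
    have : (Finset.Icc 1 k).filter (fun c => a j < c) = Finset.Ico (a j + 1) (k + 1) := by
      ext c; simp; omega
    rw [this, Finset.sum_Ico_eq_sum_range, Nat.add_sub_add_right]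

/-- `1` if the first `j` symbols of `a` are positive, otherwise `0`. -/
def live (a : ℕ → ℕ) (j : ℕ) : ℕ := ∏ l ∈ Finset.range j, if a l = 0 then 0 else 1

/-- The contribution to `blockSum` of the blocks that agree with `a` in `j` symbols. -/
def blockTerm (T : ℕ → ℕ → ℕ) (a : ℕ → ℕ) (k m x j : ℕ) : ℕ :=
  live a j * ∑ c ∈ Finset.range (k - a j),
    T (m - 1 - j) (x - ∑ l ∈ Finset.range j, a l - (a j + 1 + c))

/-- The sum over the blocks `a 0, …, a (j - 1), c` with `a j < c ≤ k` and `j < m` of the values of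
`T` that belong to the remaining length and weight; the weight of a block in the sum is
`1 + f * j`. -/
def blockSum (T : ℕ → ℕ → ℕ) (a : ℕ → ℕ) (k f m x : ℕ) : ℕ :=
  ∑ j ∈ Finset.range m, (1 + f * j) * blockTerm T a k m x j

/-- The words are cut at their first reset: they follow `a` from state `j` for `i` symbols and then
exceed it. Without a reset the final state can be 0 only for the empty word and `j = 0`. -/
theorem resetCount_eq {k : ℕ} (ha : ∀ j < n, a j ≤ k) (j m x : ℕ) (h : j + m ≤ n) :
    resetCount k n a j m x = (if m = 0 ∧ j = 0 ∧ x = 0 then 1 else 0) +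
      ∑ i ∈ Finset.range m, blockTerm (resetCount k n a 0) (fun l => a (j + l)) k m x i := by
  induction m generalizing j x with
  | zero => simp [resetCount_zero]
  | succ m ih =>
    rw [resetCount_succ (by omega) (ha j (by omega)), Finset.sum_range_succ', ih _ _ (by omega),
      if_neg (show ¬(m = 0 ∧ j + 1 = 0 ∧ x - a j = 0) by omega),
      if_neg (show ¬(m + 1 = 0 ∧ j = 0 ∧ x = 0) by omega), zero_add, zero_add, Finset.mul_sum]
    congr 1
    · refine Finset.sum_congr rfl fun i _ => ?_
      have e : (fun l => a (j + 1 + l)) = fun l => a (j + (l + 1)) := by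
        funext l; congr 1; omega
      rw [e]
      simp only [blockTerm, live, Finset.prod_range_succ', Finset.sum_range_succ', add_zero]
      rw [← mul_assoc, mul_comm (if a j = 0 then 0 else 1)]
      refine congrArg _ (Finset.sum_congr rfl fun c _ => ?_)
      congr 1 <;> omega
    · simp [blockTerm, live]

/-- The strings all of whose rotations exceed `a`. -/
noncomputable def aboveCount (k n x : ℕ) (a : ℕ → ℕ) : ℕ := by
  classical
  exact ((strings k n).filter fun y =>
    x ≤ y.sum ∧ ∀ r, LexLt n a fun l => y.getD ((r + l) % n) 0).card

/-- The right side uses only lengths below `m`, so a table can be filled by increasing length. -/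
theorem resetCount_recurrence {k : ℕ} (ha : ∀ j < n, a j ≤ k) {m : ℕ} (hm : m ≤ n)
    (x : ℕ) : resetCount k n a 0 m x = (if m = 0 ∧ x = 0 then 1 else 0) +
      blockSum (resetCount k n a 0) a k 0 m x := by
  rw [resetCount_eq ha 0 m x (by omega)]
  simp [blockSum]

/-- Since `j < n`, a string of length `n` read from `j` to `j` passes a reset and ends with the
first `j` symbols of `a`; removing them leaves a word that leads from `j` to 0. -/
theorem card_run_self {k j : ℕ} (ha : ∀ l < n, a l ≤ k) (hj : j < n) (x : ℕ) :
    ((strings k n).filter fun y => x ≤ y.sum ∧ run n a j y = some j).card =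
      live a j * resetCount k n a j (n - j) (x - ∑ l ∈ Finset.range j, a l) := by
  have hsum : ((List.range j).map a).sum = ∑ l ∈ Finset.range j, a l := rfl
  have hsuf : ∀ y ∈ (strings k n).filter fun y => x ≤ y.sum ∧ run n a j y = some j,
      ∃ z, y = z ++ (List.range j).map a ∧ run n a j z = some 0 := by
    intro y hy
    simp only [Finset.mem_filter, mem_strings] at hy
    rcases run_eq_append hy.2.2 with h | h
    · omega
    · exact h
  by_cases h : ∀ l < j, a l ≠ 0
  · have : live a j = 1 := Finset.prod_eq_one fun l hl => if_neg (h l (Finset.mem_range.1 hl))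
    rw [this, one_mul, resetCount]
    symm
    refine Finset.card_bij (fun z _ => z ++ (List.range j).map a) ?_ ?_ ?_
    · intro z hz
      simp only [Finset.mem_filter, mem_strings] at hz ⊢
      refine ⟨⟨by simp; omega, fun b hb => ?_⟩, by rw [List.sum_append, hsum]; omega,
        run_of_append hj.le hz.2.1⟩
      rcases List.mem_append.1 hb with hb | hb
      · exact hz.1.2 b hb
      · obtain ⟨l, hl, rfl⟩ := List.mem_map.1 hb
        rw [List.mem_range] at hl
        exact ⟨Nat.pos_of_ne_zero (h l hl), ha l (by omega)⟩
    · intro y _ z _ h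
      exact List.append_cancel_right h
    · intro y hy
      obtain ⟨z, rfl, hz⟩ := hsuf y hy
      simp only [Finset.mem_filter, mem_strings, List.length_append, List.length_map,
        List.length_range, List.sum_append, hsum] at hy
      refine ⟨z, ?_, rfl⟩
      simp only [Finset.mem_filter, mem_strings]
      exact ⟨⟨by omega, fun b hb => hy.1.2 b (List.mem_append_left _ hb)⟩, hz, by omega⟩
  · push Not at h
    obtain ⟨l, hl, h0⟩ := h
    have : live a j = 0 := Finset.prod_eq_zero (Finset.mem_range.2 hl) (if_pos h0)
    rw [this, zero_mul, Finset.card_eq_zero, Finset.eq_empty_iff_forall_notMem]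
    intro y hy
    obtain ⟨z, rfl, hz⟩ := hsuf y hy
    simp only [Finset.mem_filter, mem_strings] at hy
    have := hy.1.2 (a l) (List.mem_append_right _ (List.mem_map.2 ⟨l, List.mem_range.2 hl, rfl⟩))
    omega

/-- By `forall_lexLt_iff` the count is the sum over the states `j < n` of the strings read from `j`
to `j`; `run_reset` makes these sets disjoint. Cyclically, the final `j` symbols join the part up to
the first reset into one block `a 0, …, a (i - 1), c` with `j ≤ i`. Such a block arises for the `i +
1` values `j = 0, …, i`, and this is its weight in `blockSum` for `f = 1`. -/
theorem aboveCount_eq {k : ℕ} (h : IsPrenecklace n a) (ha : ∀ j < n, a j ≤ k) (hn : 0 < n)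
    (x : ℕ) : aboveCount k n x a = blockSum (resetCount k n a 0) a k 1 n x := by
  classical
  have h1 : aboveCount k n x a = ∑ j ∈ Finset.range n,
      ((strings k n).filter fun y => x ≤ y.sum ∧ run n a j y = some j).card := by
    rw [aboveCount, ← Finset.card_biUnion]
    · congr 1
      ext y
      simp only [Finset.mem_filter, Finset.mem_biUnion, Finset.mem_range]
      constructor
      · rintro ⟨h1, h2, h3⟩
        obtain ⟨j, hj, hr⟩ := (forall_lexLt_iff h hn (mem_strings.1 h1).1).1 h3
        exact ⟨j, hj, h1, h2, hr⟩
      · rintro ⟨j, hj, h1, h2, hr⟩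
        exact ⟨h1, h2, (forall_lexLt_iff h hn (mem_strings.1 h1).1).2 ⟨j, hj, hr⟩⟩
    · intro i hi j hj hij
      rw [Function.onFun, Finset.disjoint_left]
      intro y h1 h2
      simp only [Finset.mem_filter, mem_strings, Finset.mem_coe, Finset.mem_range] at h1 h2 hi hj
      have e1 := run_reset h h1.1.1 hi h1.2.2
      have e2 := run_reset h h2.1.1 hj h2.2.2
      rw [e1] at e2
      exact hij (Option.some.inj e2)
  have h2 : ∀ j ∈ Finset.range n,
      ((strings k n).filter fun y => x ≤ y.sum ∧ run n a j y = some j).card =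
      ∑ i ∈ Finset.Ico j n, blockTerm (resetCount k n a 0) a k n x i := by
    intro j hj
    rw [Finset.mem_range] at hj
    rw [card_run_self ha hj, resetCount_eq ha _ _ _ (by omega), if_neg (by omega), zero_add,
      Finset.mul_sum, Finset.sum_Ico_eq_sum_range]
    refine Finset.sum_congr rfl fun i _ => ?_
    simp only [blockTerm, live]
    rw [← mul_assoc, ← Finset.prod_range_add, Finset.sum_range_add]
    refine congrArg _ (Finset.sum_congr rfl fun c _ => ?_)
    congr 1 <;> omega
  rw [h1, Finset.sum_congr rfl h2, Finset.sum_comm' (s' := fun i => Finset.range (i + 1))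
    (t' := Finset.range n) (by intro i j; simp; omega), blockSum]
  refine Finset.sum_congr rfl fun i _ => ?_
  rw [Finset.sum_const, Finset.card_range, smul_eq_mul]
  ring

end

end UCycle

/-! ### Words, necklaces, and the passage to a smaller prenecklace -/

namespace UCycle

/-- The string `f 0, …, f (n - 1)`. -/
def word (n : ℕ) (f : ℕ → ℕ) : List ℕ := (List.range n).map f

@[simp] theorem length_word (n : ℕ) (f : ℕ → ℕ) : (word n f).length = n := by simp [word]

theorem getD_word {n l : ℕ} (f : ℕ → ℕ) (h : l < n) : (word n f).getD l 0 = f l := by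
  simp [word, h]

theorem word_congr {n : ℕ} {f g : ℕ → ℕ} (h : ∀ l < n, f l = g l) : word n f = word n g :=
  List.map_congr_left fun l hl => h l (List.mem_range.1 hl)

theorem word_getD (y : List ℕ) : word y.length (fun l => y.getD l 0) = y := map_getD_range y

theorem ext_getD {s t : List ℕ} (h : s.length = t.length)
    (hl : ∀ l < t.length, s.getD l 0 = t.getD l 0) : s = t := by
  rw [← word_getD s, ← word_getD t, h]
  exact word_congr hl

theorem lt_iff_lexLt {n : ℕ} {s t : List ℕ} (hs : s.length = n) (ht : t.length = n) :
    s < t ↔ LexLt n (fun l => s.getD l 0) (fun l => t.getD l 0) := by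
  rw [List.lt_iff_exists]
  constructor
  · rintro (⟨-, h⟩ | ⟨i, h1, h2, h3, h4⟩)
    · omega
    · refine ⟨i, by omega, fun l hl => ?_, ?_⟩
      · simpa [List.getD_eq_getElem?_getD, show l < s.length by omega,
          show l < t.length by omega] using h3 l hl
      · simpa [List.getD_eq_getElem?_getD, h1, h2] using h4
  · rintro ⟨i, h1, h2, h3⟩
    refine .inr ⟨i, by omega, by omega, fun l hl => ?_, ?_⟩
    · simpa [List.getD_eq_getElem?_getD, show l < s.length by omega,
        show l < t.length by omega] using h2 l hl
    · simpa [List.getD_eq_getElem?_getD, show i < s.length by omega,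
        show i < t.length by omega] using h3

theorem LexLt.congr {n : ℕ} {f g f' g' : ℕ → ℕ} (h : LexLt n f g) (hf : ∀ l < n, f l = f' l)
    (hg : ∀ l < n, g l = g' l) : LexLt n f' g' := by
  obtain ⟨i, h1, h2, h3⟩ := h
  exact ⟨i, h1, fun l hl => by rw [← hf l (by omega), ← hg l (by omega), h2 l hl],
    by rwa [← hf i h1, ← hg i h1]⟩

theorem word_lt_iff {n : ℕ} {f : ℕ → ℕ} {t : List ℕ} (ht : t.length = n) :
    word n f < t ↔ LexLt n f fun l => t.getD l 0 := by
  rw [lt_iff_lexLt (length_word n f) ht]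
  exact ⟨fun h => h.congr (fun l hl => getD_word f hl) fun _ _ => rfl,
    fun h => h.congr (fun l hl => (getD_word f hl).symm) fun _ _ => rfl⟩

theorem lt_word_iff {n : ℕ} {f : ℕ → ℕ} {t : List ℕ} (ht : t.length = n) :
    t < word n f ↔ LexLt n (fun l => t.getD l 0) f := by
  rw [lt_iff_lexLt ht (length_word n f)]
  exact ⟨fun h => h.congr (fun _ _ => rfl) fun l hl => getD_word f hl,
    fun h => h.congr (fun _ _ => rfl) fun l hl => (getD_word f hl).symm⟩

theorem prefix_of_between {p q q' x : List ℕ} (h1 : p ++ q ≤ x) (h2 : x ≤ p ++ q') :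
    ∃ r, x = p ++ r := by
  induction p generalizing x with
  | nil => exact ⟨x, rfl⟩
  | cons b p ih =>
    rcases x with _ | ⟨c, x⟩
    · exact absurd h1 (by simp)
    · rw [List.cons_append, ← not_lt, List.cons_lt_cons_iff, not_or] at h1 h2
      obtain rfl : b = c := le_antisymm (not_lt.1 h1.1) (not_lt.1 h2.1)
      simp only [true_and, not_lt] at h1 h2
      obtain ⟨r, rfl⟩ := ih h1.2 h2.2
      exact ⟨r, rfl⟩

theorem IsNecklace.le_rotate {s : List ℕ} (h : IsNecklace s) (i : ℕ) : s ≤ s.rotate i := by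
  rcases s.eq_nil_or_concat with rfl | ⟨l, b, rfl⟩
  · simp
  · rw [← List.rotate_mod]
    exact h _ (Nat.mod_lt _ (by simp))

theorem exists_rotate_min {s : List ℕ} (hs : s ≠ []) :
    ∃ i < s.length, IsNecklace (s.rotate i) ∧ ∀ j, s.rotate i ≤ s.rotate j := by
  obtain ⟨i, hi, hmin⟩ := Finset.exists_min_image (Finset.range s.length) (fun i => s.rotate i)
    ⟨0, by simpa [List.length_pos_iff] using hs⟩
  have key : ∀ j, s.rotate i ≤ s.rotate j := fun j => by
    rw [← List.rotate_mod s j]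
    exact hmin _ (Finset.mem_range.2 (Nat.mod_lt _ (List.length_pos_iff.2 hs)))
  refine ⟨i, Finset.mem_range.1 hi, fun j _ => ?_, key⟩
  rw [List.rotate_rotate]
  exact key _

theorem IsNecklace.eq_of_rotate_eq {s t : List ℕ} (hs : IsNecklace s) (ht : IsNecklace t) {i : ℕ}
    (h : s.rotate i = t) : s = t := by
  refine le_antisymm ((hs.le_rotate i).trans_eq h) ?_
  obtain ⟨j, rfl⟩ := (List.IsRotated.symm ⟨i, h⟩ : t ~r s)
  exact ht.le_rotate j

/-- A violation at `d`, `i` would make the rotation by `d` smaller than `s`. -/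
theorem IsNecklace.isPrenecklace {s : List ℕ} (h : IsNecklace s) {n : ℕ} (hn : s.length = n) :
    IsPrenecklace n fun l => s.getD l 0 := by
  intro d i hi hl
  by_contra hlt
  refine absurd (h.le_rotate d) (not_le.2 ?_)
  have e : ∀ l, d + l < n → (s.rotate d).getD l 0 = s.getD (d + l) 0 := fun l hl => by
    rw [getD_rotate (by omega), hn, Nat.mod_eq_of_lt hl]
  rw [lt_iff_lexLt (by simpa using hn) hn]
  refine ⟨i, by omega, fun l hl' => ?_, ?_⟩
  · simp only [e l (by omega), hl l hl']
  · simpa only [e i hi, not_le] using hlt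

theorem sum_rotate (s : List ℕ) (i : ℕ) : (s.rotate i).sum = s.sum :=
  (List.rotate_perm s i).sum_eq

theorem rotate_mem_strings {k n : ℕ} {s : List ℕ} (i : ℕ) :
    s.rotate i ∈ strings k n ↔ s ∈ strings k n := by
  simp [mem_strings]

theorem aboveCount_eq_card {k n : ℕ} (hn : 0 < n) (x : ℕ) (z : ℕ → ℕ) : aboveCount k n x z =
    ((strings k n).filter fun y => x ≤ y.sum ∧ ∀ r < n, word n z < y.rotate r).card := by
  classical
  rw [aboveCount]
  congr 1
  refine Finset.filter_congr fun y hy => and_congr_right fun _ => ?_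
  have hy := (mem_strings.1 hy).1
  have key : ∀ r, word n z < y.rotate r ↔ LexLt n z fun l => y.getD ((r + l) % n) 0 := fun r => by
    rw [word_lt_iff (by simpa using hy)]
    have e : ∀ l < n, (y.rotate r).getD l 0 = y.getD ((r + l) % n) 0 := fun l hl => by
      rw [getD_rotate (by omega), hy]
    exact ⟨fun h => h.congr (fun _ _ => rfl) e, fun h => h.congr (fun _ _ => rfl)
      fun l hl => (e l hl).symm⟩
  simp only [key]
  refine ⟨fun h r _ => h r, fun h r => ?_⟩
  simpa using h (r % n) (Nat.mod_lt _ hn)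

/-- No prenecklace `μ` over the alphabet satisfies `z' < μ ≤ z`: it would agree with `z` in the
first `t` symbols and have `μ t ≤ z t`. But `z` violates the prenecklace condition at some place `d
+ i ≤ t`, as all later symbols are `k`, and `μ` would inherit the violation. Positivity of `μ`
covers the case `z (t - 1) = 0`, in which the subtraction is truncated. -/
theorem lexLt_decrease_iff {k n t : ℕ} {z z' μ : ℕ → ℕ} (ht : 0 < t) (htn : t < n)
    (hz : ∀ l, t < l → l < n → z l = k) (hzk : ∀ l < n, z l ≤ k) (hp : ¬ IsPrenecklace n z)
    (h1 : ∀ l < t - 1, z' l = z l) (h2 : z' (t - 1) = z (t - 1) - 1)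
    (h3 : ∀ l, t ≤ l → l < n → z' l = k) (hμ : IsPrenecklace n μ)
    (hμk : ∀ l < n, 1 ≤ μ l ∧ μ l ≤ k) : LexLt n z' μ ↔ LexLt n z μ := by
  constructor
  · rintro ⟨i, hi, hl, hlt⟩
    by_contra hn
    rcases lt_trichotomy i (t - 1) with h | rfl | h
    · exact hn ⟨i, hi, fun l hl' => by rw [← h1 l (by omega), hl l hl'], by rwa [← h1 i h]⟩
    · rw [h2] at hlt
      have e1 : ∀ l < t - 1, z l = μ l := fun l hl' => by rw [← h1 l hl', hl l hl']
      have e2 : z (t - 1) = μ (t - 1) := by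
        by_contra h
        exact hn ⟨t - 1, hi, e1, by omega⟩
      have e3 : ∀ l < t, z l = μ l := fun l hl' => by
        rcases Nat.lt_or_ge l (t - 1) with h | h
        · exact e1 l h
        · obtain rfl : l = t - 1 := by omega
          exact e2
      have e4 : μ t ≤ z t := by
        by_contra h
        exact hn ⟨t, htn, e3, by omega⟩
      refine hp fun d i hdi hl => ?_
      by_contra hlt
      have hdt : d + i ≤ t := by
        by_contra h
        have := hz (d + i) (by omega) hdi
        have := hzk i (by omega)
        omega
      have hd : d ≠ 0 := by rintro rfl; simp at hlt
      have h5 := hμ d i hdi fun l hl' => by rw [← e3 l (by omega), ← e3 (d + l) (by omega), hl l hl']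
      rw [← e3 i (by omega)] at h5
      rcases hdt.lt_or_eq with h | h
      · rw [← e3 _ h] at h5; omega
      · rw [h] at h5 hlt; omega
    · rw [h3 i (by omega) hi] at hlt
      have := (hμk i hi).2
      omega
  · rintro ⟨i, hi, hl, hlt⟩
    rcases lt_trichotomy i (t - 1) with h | rfl | h
    · exact ⟨i, hi, fun l hl' => by rw [h1 l (by omega), hl l hl'], by rwa [h1 i h]⟩
    · exact ⟨t - 1, hi, fun l hl' => by rw [h1 l hl', hl l hl'], by omega⟩
    · have := hl (t - 1) h
      have := (hμk (t - 1) (by omega)).1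
      exact ⟨t - 1, by omega, fun l hl' => by rw [h1 l hl', hl l (by omega)], by omega⟩

theorem getD_mem {s : List ℕ} {l : ℕ} (h : l < s.length) : s.getD l 0 ∈ s := by
  simp [List.getD_eq_getElem?_getD, h]

/-- If the end of `z` is as large as possible and `z` is not a prenecklace, then one may pass to a
smaller word. -/
theorem aboveCount_decrease {k n t : ℕ} {z z' : ℕ → ℕ} (ht : 0 < t) (htn : t < n)
    (hz : ∀ l, t < l → l < n → z l = k) (hzk : ∀ l < n, z l ≤ k) (hp : ¬ IsPrenecklace n z)
    (h1 : ∀ l < t - 1, z' l = z l) (h2 : z' (t - 1) = z (t - 1) - 1)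
    (h3 : ∀ l, t ≤ l → l < n → z' l = k) (x : ℕ) :
    aboveCount k n x z' = aboveCount k n x z := by
  rw [aboveCount_eq_card (by omega), aboveCount_eq_card (by omega)]
  congr 1
  refine Finset.filter_congr fun y hy => and_congr_right fun _ => ?_
  obtain ⟨hy1, hy2⟩ := mem_strings.1 hy
  obtain ⟨i, hi, hμ, hmin⟩ := exists_rotate_min (s := y) (by rintro rfl; simp at hy1; omega)
  have hlen : (y.rotate i).length = n := by simpa using hy1
  have key : ∀ f, (∀ r < n, word n f < y.rotate r) ↔ LexLt n f fun l => (y.rotate i).getD l 0 :=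
    fun f => by
    rw [← word_lt_iff hlen]
    exact ⟨fun h => h i (by omega), fun h r _ => h.trans_le (hmin r)⟩
  rw [key, key]
  refine lexLt_decrease_iff ht htn hz hzk hp h1 h2 h3 (hμ.isPrenecklace hlen) fun l hl => ?_
  exact hy2 _ (List.mem_rotate.1 (getD_mem (by omega)))

/-- This ends the descent: once all symbols but the first equal `k`, nothing needs to be lowered. -/
theorem isPrenecklace_of_tail {k n : ℕ} {z : ℕ → ℕ} (h : ∀ l, 0 < l → l < n → z l = k)
    (hzk : ∀ l < n, z l ≤ k) : IsPrenecklace n z := fun d i hdi _ => by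
  rcases Nat.eq_zero_or_pos d with rfl | hd
  · simp
  · rw [h (d + i) (by omega) hdi]
    exact hzk i (by omega)

end UCycle

/-! ### Aperiodic prefixes and the blocks of the cyclic sequence -/

namespace UCycle

section Period

theorem rotate_one_iterate (s : List ℕ) (i : ℕ) : (fun l : List ℕ => l.rotate 1)^[i] s = s.rotate i := by
  induction i generalizing s with
  | zero => simp
  | succ i ih => rw [Function.iterate_succ_apply, ih, List.rotate_rotate, add_comm]

theorem isPeriodicPt_rotate {s : List ℕ} {i : ℕ} :
    Function.IsPeriodicPt (fun l : List ℕ => l.rotate 1) i s ↔ s.rotate i = s := by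
  rw [Function.IsPeriodicPt, Function.IsFixedPt, rotate_one_iterate]

theorem eq_flatten_of_append_comm {A B : List ℕ} {i : ℕ} (h : A ++ B = B ++ A)
    (hl : B.length = i * A.length) : B = (List.replicate i A).flatten := by
  induction i generalizing B with
  | zero => simpa using hl
  | succ i ih =>
    obtain ⟨C, rfl⟩ : A <+: B := by
      refine List.prefix_of_prefix_length_le (l₃ := B ++ A) ?_ (List.prefix_append _ _) ?_
      · rw [← h]; exact List.prefix_append _ _
      · rw [hl]; nlinarith
    rw [List.replicate_succ, List.flatten_cons, ← ih]
    · rw [List.append_assoc] at h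
      exact List.append_cancel_left h
    · rw [List.length_append] at hl
      linarith

variable {s : List ℕ}

/-- A string is a power of its prefix of length `p` exactly when `p` divides its length and rotation
by `p` fixes it. The minimal period under rotation by one divides the length, so it is the shortest
choice. -/
theorem aperiodicPrefix_eq (hs : s ≠ []) :
    aperiodicPrefix s = s.take (Function.minimalPeriod (fun l : List ℕ => l.rotate 1) s) := by
  set p := Function.minimalPeriod (fun l : List ℕ => l.rotate 1) s with hp
  have hn : Function.IsPeriodicPt (fun l : List ℕ => l.rotate 1) s.length s :=
    isPeriodicPt_rotate.2 s.rotate_length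
  have hpos : 0 < p := hn.minimalPeriod_pos (List.length_pos_iff.2 hs)
  have hrot : s.rotate p = s := isPeriodicPt_rotate.1 (Function.isPeriodicPt_minimalPeriod _ _)
  obtain ⟨i, hi⟩ : p ∣ s.length := hn.minimalPeriod_dvd
  have hi0 : i ≠ 0 := by
    rintro rfl
    exact hs (List.length_eq_zero_iff.1 (by simpa using hi))
  have hle : p ≤ s.length := by rw [hi]; exact Nat.le_mul_of_pos_right _ (by omega)
  rw [aperiodicPrefix]
  congr 1
  refine le_antisymm (Nat.sInf_le ⟨i, by omega, ?_⟩) (le_csInf ⟨s.length, 1, le_rfl, by simp⟩ ?_)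
  · obtain ⟨i, rfl⟩ := Nat.exists_eq_succ_of_ne_zero hi0
    rw [List.replicate_succ, List.flatten_cons, ← eq_flatten_of_append_comm (B := s.drop p)]
    · exact (List.take_append_drop _ _).symm
    · rw [List.take_append_drop, ← List.rotate_eq_drop_append_take hle, hrot]
    · rw [List.length_drop, List.length_take, min_eq_left hle, hi, Nat.mul_succ,
        Nat.add_sub_cancel, mul_comm]
  · rintro q ⟨j, hj, h⟩
    by_contra! hqp
    have hlen : s.length = j * q := by
      have := congrArg List.length h
      simp only [List.length_flatten, List.map_replicate, List.sum_replicate, List.length_take,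
        smul_eq_mul] at this
      rwa [min_eq_left (by omega)] at this
    have hq : 0 < q := by
      rcases Nat.eq_zero_or_pos q with rfl | h
      · simp at hlen; exact absurd hlen hs
      · exact h
    have hrot' : s.rotate q = s := by
      obtain ⟨j, rfl⟩ := Nat.exists_eq_succ_of_ne_zero (show j ≠ 0 by omega)
      have h1 : s = s.take q ++ (List.replicate j (s.take q)).flatten := by
        conv_lhs => rw [h, List.replicate_succ, List.flatten_cons]
      have h2 : s = (List.replicate j (s.take q)).flatten ++ s.take q := by
        conv_lhs => rw [h, List.replicate_succ', List.flatten_append]; simp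
      have h3 : s.drop q = (List.replicate j (s.take q)).flatten := by
        have := List.take_append_drop q s
        conv_rhs at this => rw [h1]
        exact List.append_cancel_left this
      rw [List.rotate_eq_drop_append_take (by omega), h3, ← h2]
    have := Nat.le_of_dvd hq (isPeriodicPt_rotate.2 hrot').minimalPeriod_dvd
    omega

theorem length_aperiodicPrefix (hs : s ≠ []) : (aperiodicPrefix s).length =
    Function.minimalPeriod (fun l : List ℕ => l.rotate 1) s := by
  rw [aperiodicPrefix_eq hs, List.length_take, min_eq_left]
  exact Nat.le_of_dvd (List.length_pos_iff.2 hs)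
    (isPeriodicPt_rotate.2 s.rotate_length).minimalPeriod_dvd

theorem length_aperiodicPrefix_pos (hs : s ≠ []) : 0 < (aperiodicPrefix s).length := by
  rw [length_aperiodicPrefix hs]
  exact (isPeriodicPt_rotate.2 s.rotate_length).minimalPeriod_pos (List.length_pos_iff.2 hs)

theorem rotate_length_aperiodicPrefix (hs : s ≠ []) : s.rotate (aperiodicPrefix s).length = s := by
  rw [length_aperiodicPrefix hs]
  exact isPeriodicPt_rotate.1 (Function.isPeriodicPt_minimalPeriod _ _)

theorem exists_append_aperiodicPrefix (hs : s ≠ []) :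
    ∃ r, s = aperiodicPrefix s ++ r ∧ s = r ++ aperiodicPrefix s := by
  have h := rotate_length_aperiodicPrefix hs
  have hl : (aperiodicPrefix s).length ≤ s.length := by
    rw [aperiodicPrefix_eq hs]; simp
  have ht : s.take (aperiodicPrefix s).length = aperiodicPrefix s := by
    rw [length_aperiodicPrefix hs, ← aperiodicPrefix_eq hs]
  refine ⟨s.drop (aperiodicPrefix s).length, ?_, ?_⟩
  · conv_lhs => rw [← List.take_append_drop (aperiodicPrefix s).length s, ht]
  · conv_lhs => rw [← h, List.rotate_eq_drop_append_take hl, ht]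

theorem rotate_injOn (hs : s ≠ []) {i j : ℕ} (hi : i < (aperiodicPrefix s).length)
    (hj : j < (aperiodicPrefix s).length) (h : s.rotate i = s.rotate j) : i = j := by
  rw [length_aperiodicPrefix hs] at hi hj
  refine Function.iterate_injOn_Iio_minimalPeriod (f := fun l : List ℕ => l.rotate 1) (x := s)
    hi hj ?_
  simp only [rotate_one_iterate, h]

theorem mem_of_mem_aperiodicPrefix (hs : s ≠ []) {c : ℕ}
    (h : ∀ x ∈ aperiodicPrefix s, x = c) : ∀ x ∈ s, x = c := by
  have hrot := rotate_length_aperiodicPrefix hs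
  have hpos := length_aperiodicPrefix_pos hs
  obtain ⟨r, hr, -⟩ := exists_append_aperiodicPrefix hs
  set p := (aperiodicPrefix s).length
  have key : ∀ l < s.length, s.getD l 0 = c := by
    intro l
    induction l using Nat.strong_induction_on with
    | _ l ih =>
      intro hl
      rcases Nat.lt_or_ge l p with h' | h'
      · have e : s.getD l 0 = (aperiodicPrefix s).getD l 0 := by
          conv_lhs => rw [hr, List.getD_eq_getElem?_getD, List.getElem?_append_left h',
            ← List.getD_eq_getElem?_getD]
        rw [e]
        exact h _ (getD_mem h')
      · rw [← ih (l - p) (by omega) (by omega)]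
        conv_rhs => rw [← hrot, getD_rotate (by omega), Nat.add_sub_cancel' h', Nat.mod_eq_of_lt hl]
  intro x hx
  obtain ⟨l, hl, rfl⟩ := List.mem_iff_getElem.1 hx
  simpa [List.getD_eq_getElem?_getD, hl] using key l hl

end Period

section Reads

/-- The cyclic sequence `u` contains the string `t` at the position `i`. -/
def Reads (u : List ℕ) (i : ℕ) (t : List ℕ) : Prop :=
  ∀ j < t.length, u.getD ((i + j) % u.length) 0 = t.getD j 0

variable {u t t' : List ℕ} {i : ℕ}

theorem getD_append_left {l : ℕ} (h : l < t.length) : (t ++ t').getD l 0 = t.getD l 0 := by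
  simp only [List.getD_eq_getElem?_getD, List.getElem?_append_left h]

theorem getD_append_right {l : ℕ} : (t ++ t').getD (t.length + l) 0 = t'.getD l 0 := by
  simp [List.getD_eq_getElem?_getD, List.getElem?_append_right]

theorem reads_append : Reads u i (t ++ t') ↔ Reads u i t ∧ Reads u (i + t.length) t' := by
  constructor
  · intro h
    refine ⟨fun j hj => ?_, fun j hj => ?_⟩
    · rw [h j (by simp; omega), getD_append_left hj]
    · rw [add_assoc, h _ (by simp; omega), getD_append_right]
  · rintro ⟨h1, h2⟩ j hj
    rw [List.length_append] at hj
    rcases Nat.lt_or_ge j t.length with h | h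
    · rw [h1 j h, getD_append_left h]
    · obtain ⟨l, rfl⟩ := Nat.exists_eq_add_of_le h
      rw [← add_assoc, h2 l (by omega), getD_append_right]

theorem reads_add_length : Reads u (i + u.length) t ↔ Reads u i t := by
  refine forall₂_congr fun j _ => ?_
  rw [add_right_comm, Nat.add_mod_right]

theorem Reads.cyclicSubstring (h : Reads u i t) : cyclicSubstring u t.length i = t := by
  refine ext_getD (by simp [UCycle.cyclicSubstring]) fun l hl => ?_
  rw [← h l hl]
  exact getD_word _ hl

theorem reads_block (A B : List ℕ) : Reads (A ++ (t ++ B)) A.length t := by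
  intro j hj
  rw [Nat.mod_eq_of_lt (by simp; omega), getD_append_right, getD_append_left hj]

end Reads

section Cycle

variable {k n V : ℕ}

/-- The necklaces of weight at least `V`. -/
def necks (k n V : ℕ) : Finset (List ℕ) := (stringsAtLeast k n V).filter IsNecklace

theorem mem_stringsAtLeast {s : List ℕ} :
    s ∈ stringsAtLeast k n V ↔ s ∈ strings k n ∧ V ≤ s.sum := by
  simp only [stringsAtLeast, weight, Finset.mem_filter, Nat.cast_le]

theorem mem_necks {s : List ℕ} :
    s ∈ necks k n V ↔ (s ∈ strings k n ∧ V ≤ s.sum) ∧ IsNecklace s := by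
  rw [necks, Finset.mem_filter, mem_stringsAtLeast]

theorem length_of_mem_necks {s : List ℕ} (h : s ∈ necks k n V) : s.length = n :=
  (mem_strings.1 (mem_necks.1 h).1.1).1

theorem ne_nil_of_mem_necks (hn : 0 < n) {s : List ℕ} (h : s ∈ necks k n V) : s ≠ [] := by
  rintro rfl
  have := length_of_mem_necks h
  simp at this
  omega

theorem le_of_mem_necks {s : List ℕ} (h : s ∈ necks k n V) {x : ℕ} (hx : x ∈ s) : x ≤ k :=
  ((mem_strings.1 (mem_necks.1 h).1.1).2 x hx).2

/-- The total length of the blocks that belong to the necklaces below `x`. -/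
noncomputable def pos (k n V : ℕ) (x : List ℕ) : ℕ :=
  ∑ μ ∈ (necks k n V).filter (· < x), (aperiodicPrefix μ).length

theorem rotate_min_mem_necks {s : List ℕ} (hs : s ∈ strings k n) (hV : V ≤ s.sum) {i : ℕ}
    (h : IsNecklace (s.rotate i)) : s.rotate i ∈ necks k n V :=
  mem_necks.2 ⟨⟨(rotate_mem_strings i).2 hs, by rwa [sum_rotate]⟩, h⟩

/-- The rotations of a necklace by less than the length of its aperiodic prefix are distinct and
exhaust its rotation class, and a class contains only one necklace. This converts positions in the
cyclic sequence into numbers of strings. -/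
theorem sum_length_aperiodicPrefix (hn : 0 < n) (P : List ℕ → Prop) [DecidablePred P]
    [DecidablePred fun y : List ℕ => ∃ i < n, P (y.rotate i) ∧ IsNecklace (y.rotate i)] :
    ∑ μ ∈ (necks k n V).filter P, (aperiodicPrefix μ).length =
    ((stringsAtLeast k n V).filter fun y => ∃ i < n, P (y.rotate i) ∧ IsNecklace (y.rotate i)).card := by
  have h1 : ∀ μ ∈ (necks k n V).filter P, (aperiodicPrefix μ).length =
      ((Finset.range (aperiodicPrefix μ).length).image μ.rotate).card := by
    intro μ hμ
    rw [Finset.card_image_of_injOn, Finset.card_range]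
    intro i hi j hj h
    exact rotate_injOn (ne_nil_of_mem_necks hn (Finset.mem_filter.1 hμ).1)
      (by simpa using hi) (by simpa using hj) h
  rw [Finset.sum_congr rfl h1, ← Finset.card_biUnion]
  · congr 1
    ext y
    simp only [Finset.mem_biUnion, Finset.mem_filter, Finset.mem_image, Finset.mem_range]
    constructor
    · rintro ⟨μ, ⟨hμ, hP⟩, i, -, rfl⟩
      obtain ⟨⟨h1, h2⟩, h3⟩ := mem_necks.1 hμ
      refine ⟨mem_stringsAtLeast.2 ⟨(rotate_mem_strings i).2 h1, by rwa [sum_rotate]⟩, ?_⟩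
      obtain ⟨j, hj⟩ : μ.rotate i ~r μ := List.IsRotated.symm ⟨i, rfl⟩
      refine ⟨j % n, Nat.mod_lt _ hn, ?_⟩
      have : n = (μ.rotate i).length := by rw [List.length_rotate, length_of_mem_necks hμ]
      rw [this, List.rotate_mod, hj]
      exact ⟨hP, h3⟩
    · rintro ⟨hy, i, hi, hP, hN⟩
      obtain ⟨hy1, hy2⟩ := mem_stringsAtLeast.1 hy
      have hμ := rotate_min_mem_necks hy1 hy2 hN
      refine ⟨_, ⟨hμ, hP⟩, ?_⟩
      obtain ⟨j, hj⟩ : y.rotate i ~r y := List.IsRotated.symm ⟨i, rfl⟩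
      have hne := ne_nil_of_mem_necks hn hμ
      refine ⟨j % (aperiodicPrefix (y.rotate i)).length,
        Nat.mod_lt _ (length_aperiodicPrefix_pos hne), ?_⟩
      conv_rhs => rw [← hj]
      rw [← rotate_one_iterate, ← rotate_one_iterate _ j, length_aperiodicPrefix hne,
        Function.iterate_mod_minimalPeriod_eq]
  · intro μ hμ ν hν hne
    rw [Function.onFun, Finset.disjoint_left]
    intro y h1 h2
    simp only [Finset.mem_image, Finset.mem_range] at h1 h2
    obtain ⟨i, -, rfl⟩ := h1
    obtain ⟨j, -, h⟩ := h2
    have : μ ~r ν := (List.IsRotated.trans ⟨i, rfl⟩ (List.IsRotated.symm ⟨j, h⟩))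
    obtain ⟨l, hl⟩ := this
    exact hne ((mem_necks.1 (Finset.mem_filter.1 hμ).1).2.eq_of_rotate_eq
      (mem_necks.1 (Finset.mem_filter.1 hν).1).2 hl)

theorem length_cycleAtLeast (hn : 0 < n) :
    (cycleAtLeast k n V).length = (stringsAtLeast k n V).card := by
  have h := sum_length_aperiodicPrefix (k := k) (V := V) hn (fun _ => True)
  rw [Finset.filter_true_of_mem (by simp), Finset.filter_true_of_mem] at h
  · rw [← h, cycleAtLeast, List.length_flatten, List.map_map]
    have := List.sum_toFinset (fun s => (aperiodicPrefix s).length)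
      (Finset.sort_nodup (necks k n V) (· ≤ ·))
    rw [Finset.sort_toFinset] at this
    exact this.symm
  · intro y hy
    have hy := (mem_strings.1 (mem_stringsAtLeast.1 hy).1).1
    obtain ⟨i, hi, hN, -⟩ := exists_rotate_min (s := y) (by rintro rfl; simp at hy; omega)
    exact ⟨i, by omega, trivial, hN⟩

theorem reads_aperiodicPrefix {ν : List ℕ} (hν : ν ∈ necks k n V) :
    Reads (cycleAtLeast k n V) (pos k n V ν) (aperiodicPrefix ν) := by
  obtain ⟨L₁, L₂, hL⟩ := List.append_of_mem ((Finset.mem_sort (· ≤ ·)).2 hν)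
  have hsort := (Finset.sortedLT_sort (necks k n V)).pairwise
  rw [hL] at hsort
  have hp := List.pairwise_append.1 hsort
  have hset : (necks k n V).filter (· < ν) = L₁.toFinset := by
    ext μ
    rw [Finset.mem_filter, ← Finset.mem_sort (· ≤ ·), hL, List.mem_toFinset]
    constructor
    · rintro ⟨h1, h2⟩
      rcases List.mem_append.1 h1 with h | h
      · exact h
      · rcases List.mem_cons.1 h with rfl | h
        · exact absurd h2 (lt_irrefl _)
        · exact absurd h2 (not_lt.2 ((List.pairwise_cons.1 hp.2.1).1 μ h).le)
    · exact fun h => ⟨List.mem_append_left _ h, hp.2.2 μ h ν (by simp)⟩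
  have hpos : pos k n V ν = ((L₁.map aperiodicPrefix).flatten).length := by
    rw [pos, hset, List.sum_toFinset _ (hp.1.imp fun h => h.ne), List.length_flatten, List.map_map]
    rfl
  have hu : cycleAtLeast k n V = (L₁.map aperiodicPrefix).flatten ++
      (aperiodicPrefix ν ++ (L₂.map aperiodicPrefix).flatten) := by
    change (((necks k n V).sort (· ≤ ·)).map aperiodicPrefix).flatten = _
    rw [hL]
    simp
  rw [hpos, hu]
  exact reads_block _ _

end Cycle

end UCycle

/-! ### What follows and what precedes a block -/

namespace UCycle

section Cycle

variable {k n V : ℕ}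

/-- The string `k, …, k`. -/
abbrev top (k m : ℕ) : List ℕ := List.replicate m k

theorem eq_top {k m : ℕ} {s : List ℕ} (h : s.length = m) (hs : ∀ x ∈ s, x = k) : s = top k m := by
  rw [top, List.eq_replicate_iff]
  exact ⟨h, hs⟩

theorem isNecklace_top (k m : ℕ) : IsNecklace (top k m) := fun i _ => by
  rw [top, List.rotate_replicate]

theorem top_mem_necks {s : List ℕ} (hk : 0 < k) (hs : s ∈ stringsAtLeast k n V) :
    top k n ∈ necks k n V := by
  obtain ⟨h1, h2⟩ := mem_stringsAtLeast.1 hs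
  obtain ⟨h3, h4⟩ := mem_strings.1 h1
  refine mem_necks.2 ⟨⟨mem_strings.2 ⟨by simp, fun x hx => ?_⟩, h2.trans ?_⟩, isNecklace_top k n⟩
  · rw [List.eq_of_mem_replicate hx]; omega
  · have := List.sum_le_card_nsmul s k fun x hx => (h4 x hx).2
    simpa [h3] using this

theorem le_top {s : List ℕ} (hl : s.length = n) (hs : ∀ x ∈ s, x ≤ k) : s ≤ top k n := by
  by_contra h
  obtain ⟨i, hi, -, hlt⟩ := (lt_iff_lexLt (by simp) hl).1 (not_le.1 h)
  have := hs _ (getD_mem (s := s) (l := i) (by omega))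
  simp [List.getD_eq_getElem?_getD, hi] at hlt this
  omega

/-- A necklace that starts with the largest symbol consists of largest symbols. -/
theorem IsNecklace.eq_top {s : List ℕ} (h : IsNecklace s) (hl : s.length = n)
    (hs : ∀ x ∈ s, x ≤ k) (h0 : k ≤ s.getD 0 0) : s = top k n := by
  refine UCycle.eq_top hl fun x hx => le_antisymm (hs x hx) ?_
  obtain ⟨i, hi, rfl⟩ := List.mem_iff_getElem.1 hx
  have := h.isPrenecklace hl i 0 (by omega) (by simp)
  simp only [List.getD_eq_getElem?_getD, add_zero, List.getElem?_eq_getElem hi,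
    Option.getD_some] at this h0
  omega

theorem run_replicate {a : ℕ → ℕ} (hn : 0 < n) {c : ℕ} (h : a 0 < c) (m : ℕ) :
    run n a 0 (List.replicate m c) = some 0 := by
  induction m with
  | zero => rfl
  | succ m ih =>
    rw [List.replicate_succ]
    exact run_cons_eq_some.2 ⟨0, step_eq_some.2 ⟨hn, .inr ⟨h, rfl⟩⟩, ih⟩

/-- The following necklaces share every prefix that is not followed by the largest symbols only. -/
theorem exists_next {p q : List ℕ} (h : p ++ q ∈ necks k n V) (hq : ∃ c ∈ q, c ≠ k) :
    ∃ μ ∈ necks k n V, p ++ q < μ ∧ μ ≤ p ++ top k q.length := by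
  obtain ⟨⟨h1, h2⟩, h3⟩ := mem_necks.1 h
  obtain ⟨h4, h5⟩ := mem_strings.1 h1
  set x := p ++ top k q.length with hx
  have hxl : x.length = n := by rw [← h4]; simp [hx]
  obtain ⟨c, hc, hck⟩ := hq
  have hn : 0 < n := by
    rw [← h4]
    exact List.length_pos_iff.2 (List.ne_nil_of_mem (List.mem_append_right p hc))
  have hx1 : x ∈ strings k n := by
    refine mem_strings.2 ⟨hxl, fun y hy => ?_⟩
    rcases List.mem_append.1 hy with hy | hy
    · exact h5 y (List.mem_append_left _ hy)
    · rw [List.eq_of_mem_replicate hy]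
      have := h5 c (List.mem_append_right _ hc)
      omega
  have hx2 : V ≤ x.sum := by
    refine h2.trans ?_
    rw [hx, List.sum_append, List.sum_append]
    have := List.sum_le_card_nsmul q k fun y hy => (h5 y (List.mem_append_right _ hy)).2
    simpa using this
  obtain ⟨l, hl⟩ : ∃ l, ∃ h : l < q.length, q[l] ≠ k ∧ ∀ i (hi : i < l), q[i] = k := by
    classical
    have hex : ∃ l, ∃ h : l < q.length, q[l] ≠ k := by
      obtain ⟨l, h, rfl⟩ := List.mem_iff_getElem.1 hc
      exact ⟨l, h, hck⟩
    obtain ⟨h1, h2⟩ := Nat.find_spec hex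
    refine ⟨Nat.find hex, h1, h2, fun i hi => ?_⟩
    by_contra hne
    exact Nat.find_min hex hi ⟨by omega, hne⟩
  obtain ⟨hlq, hqk, hbefore⟩ := hl
  set a : ℕ → ℕ := fun l => (p ++ q).getD l 0 with ha
  have hpre : IsPrenecklace n a := h3.isPrenecklace h4
  have hal : a (p.length + l) = q[l] := by
    simp [ha, List.getD_eq_getElem?_getD, hlq]
  have hltk : q[l] < k :=
    lt_of_le_of_ne (h5 _ (List.mem_append_right _ (List.getElem_mem hlq))).2 hqk
  have hlen : p.length + q.length = n := by simpa using h4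
  -- The first symbol of a prenecklace is its smallest one.
  have ha0 : a 0 < k := by
    have := hpre (p.length + l) 0 (by omega) (by simp)
    rw [add_zero, hal] at this
    omega
  have hsplit : x = ((List.range (p.length + l)).map a ++ [k]) ++ top k (q.length - l - 1) := by
    have e1 : (List.range (p.length + l)).map a = p ++ top k l := by
      refine ext_getD (by simp) fun i hi => ?_
      have hi' : i < p.length + l := by simpa using hi
      change (word _ a).getD i 0 = _
      rw [getD_word _ hi', ha]
      rcases Nat.lt_or_ge i p.length with h | h
      · simp only [getD_append_left h]
      · obtain ⟨j, rfl⟩ := Nat.exists_eq_add_of_le h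
        simp only [getD_append_right]
        have hj : j < l := by omega
        simp [List.getD_eq_getElem?_getD, hj, show j < q.length by omega, hbefore j hj]
    rw [e1, hx, List.append_assoc, List.append_assoc, top, top, top]
    congr 1
    rw [← List.replicate_one, List.replicate_append_replicate, List.replicate_append_replicate]
    congr 1
    omega
  -- Reading `x` matches `a` up to the first symbol of `q` other than `k`, where `x` has `k` and
  -- resets the automaton; each further `k` exceeds `a 0` and keeps the state 0. So all rotations of
  -- `x` exceed `p ++ q`.
  have hrun : run n a 0 x = some 0 := by
    rw [hsplit]
    refine run_append_eq_some.2 ⟨0, run_concat_eq_some.2 ⟨p.length + l, ?_, ?_⟩,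
      run_replicate hn ha0 _⟩
    · exact run_of_append (z := []) (by omega) rfl
    · exact step_eq_some.2 ⟨by omega, .inr ⟨by omega, rfl⟩⟩
  have habove := (forall_lexLt_iff hpre hn hxl).2 ⟨0, hn, hrun⟩
  obtain ⟨i, hi, hN, hmin⟩ := exists_rotate_min (s := x) (by rintro h; simp [h] at hxl; omega)
  refine ⟨x.rotate i, rotate_min_mem_necks hx1 hx2 hN, ?_, by simpa using hmin 0⟩
  rw [lt_iff_lexLt h4 (by simpa using hxl)]
  refine (habove i).congr (fun _ _ => rfl) fun l hl => ?_
  rw [getD_rotate (by omega), hxl]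

/-- The necklace after `ν`. -/
theorem exists_succ {ν : List ℕ} (hν : ν ∈ necks k n V) (h : ∃ μ ∈ necks k n V, ν < μ) :
    ∃ γ ∈ necks k n V, ν < γ ∧ pos k n V γ = pos k n V ν + (aperiodicPrefix ν).length ∧
      ∀ μ ∈ necks k n V, ν < μ → γ ≤ μ := by
  obtain ⟨μ, hμ, hlt⟩ := h
  obtain ⟨γ, hγ, hmin⟩ := ((necks k n V).filter (ν < ·)).exists_min_image id
    ⟨μ, Finset.mem_filter.2 ⟨hμ, hlt⟩⟩
  obtain ⟨h1, h2⟩ := Finset.mem_filter.1 hγ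
  have hmin' : ∀ μ ∈ necks k n V, ν < μ → γ ≤ μ := fun μ h3 h4 =>
    hmin μ (Finset.mem_filter.2 ⟨h3, h4⟩)
  refine ⟨γ, h1, h2, ?_, hmin'⟩
  have : (necks k n V).filter (· < γ) = insert ν ((necks k n V).filter (· < ν)) := by
    ext μ
    simp only [Finset.mem_filter, Finset.mem_insert]
    constructor
    · rintro ⟨h3, h4⟩
      rcases lt_trichotomy μ ν with h | h | h
      · exact .inr ⟨h3, h⟩
      · exact .inl h
      · exact absurd (hmin' μ h3 h) (not_le.2 h4)
    · rintro (rfl | ⟨h3, h4⟩)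
      · exact ⟨hν, h2⟩
      · exact ⟨h3, h4.trans h2⟩
  rw [pos, this, Finset.sum_insert (by simp), add_comm]
  rfl

/-- The successor lies between `p ++ q` and `p k…k`, hence it keeps the prefix `p`. -/
theorem exists_succ_of_append {p q : List ℕ} (h : p ++ q ∈ necks k n V) (hq : ∃ c ∈ q, c ≠ k) :
    ∃ r, p ++ r ∈ necks k n V ∧ p ++ q < p ++ r ∧
      pos k n V (p ++ r) = pos k n V (p ++ q) + (aperiodicPrefix (p ++ q)).length := by
  obtain ⟨μ, hμ, h1, h2⟩ := exists_next h hq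
  obtain ⟨γ, hγ, h3, h4, h5⟩ := exists_succ h ⟨μ, hμ, h1⟩
  obtain ⟨r, rfl⟩ := prefix_of_between h3.le ((h5 μ hμ h1).trans h2)
  exact ⟨r, hγ, h3, h4⟩

theorem exists_ne_of_ne_top (hn : 0 < n) {ν : List ℕ} (hν : ν ∈ necks k n V) (h : ν ≠ top k n) :
    ∃ c ∈ aperiodicPrefix ν, c ≠ k := by
  by_contra! hc
  exact h (eq_top (length_of_mem_necks hν)
    (mem_of_mem_aperiodicPrefix (ne_nil_of_mem_necks hn hν) hc))

/-- From the block of a necklace on, the cyclic sequence contains the whole necklace. -/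
theorem reads_necklace (hn : 0 < n) {ν : List ℕ} (hν : ν ∈ necks k n V) (h : ν ≠ top k n) :
    Reads (cycleAtLeast k n V) (pos k n V ν) ν := by
  induction hm : ((necks k n V).filter (ν < ·)).card using Nat.strong_induction_on
    generalizing ν with
  | _ m ih =>
    -- With `β` the aperiodic prefix, `ν = β r = r β`. The second form shows that the next necklace
    -- starts with `r`, as `β` is not all `k`. So after the block `β` the sequence goes on with `r`,
    -- by induction on the number of later necklaces.
    obtain ⟨r, h1, h2⟩ := exists_append_aperiodicPrefix (ne_nil_of_mem_necks hn hν)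
    rw [h2] at hν
    have hb := exists_ne_of_ne_top hn (by rwa [← h2] at hν) h
    obtain ⟨t, h3, h4, h5⟩ := exists_succ_of_append hν hb
    rw [← h2] at hν h4 h5
    have key : Reads (cycleAtLeast k n V) (pos k n V (r ++ t)) r := by
      rcases r with _ | ⟨c, r⟩
      · intro j hj; simp at hj
      -- If the next necklace were `k…k`, then `r`, and with it `ν`, would start with `k`; a
      -- necklace that starts with `k` is `k…k`.
      · have hne : c :: r ++ t ≠ top k n := by
          intro he
          refine h ((mem_necks.1 hν).2.eq_top (length_of_mem_necks hν)
            (fun x hx => le_of_mem_necks hν hx) ?_)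
          have hc : c = k := List.eq_of_mem_replicate (n := n) (by
            rw [← top, ← he]; simp)
          rw [h2, hc]
          simp
        refine (reads_append.1 (ih _ ?_ h3 hne rfl)).1
        rw [← hm]
        refine Finset.card_lt_card (Finset.ssubset_iff_of_subset ?_ |>.2
          ⟨_, Finset.mem_filter.2 ⟨h3, h4⟩, by simp⟩)
        intro μ hμ
        have hμ := Finset.mem_filter.1 hμ
        exact Finset.mem_filter.2 ⟨hμ.1, h4.trans hμ.2⟩
    have h6 := reads_append.2 ⟨reads_aperiodicPrefix hν, by rwa [← h5]⟩
    rwa [← h1] at h6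

theorem suffix_aperiodicPrefix (hn : 0 < n) {p q : List ℕ} (h : p ++ q ∈ necks k n V)
    (hq : q.length ≤ (aperiodicPrefix (p ++ q)).length) :
    ∃ c, aperiodicPrefix (p ++ q) = c ++ q := by
  obtain ⟨r, -, h2⟩ := exists_append_aperiodicPrefix (ne_nil_of_mem_necks hn h)
  obtain ⟨c, hc⟩ := List.suffix_of_suffix_length_le (l₁ := q) (l₂ := aperiodicPrefix (p ++ q))
    (l₃ := p ++ q) (List.suffix_append _ _) ⟨r, h2.symm⟩ hq
  exact ⟨c, hc.symm⟩

/-- Rotations of a necklace that are not split inside its final run of largest symbols. -/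
theorem reads_rotation (hn : 0 < n) {p q : List ℕ} (h : p ++ q ∈ necks k n V)
    (hl : q.length ≤ (aperiodicPrefix (p ++ q)).length) (hq : ∃ c ∈ q, c ≠ k) :
    Reads (cycleAtLeast k n V)
      (pos k n V (p ++ q) + (aperiodicPrefix (p ++ q)).length - q.length) (q ++ p) := by
  obtain ⟨c, hc⟩ := suffix_aperiodicPrefix hn h hl
  have h1 := reads_aperiodicPrefix h
  obtain ⟨r, h3, h4, h5⟩ := exists_succ_of_append h hq
  rw [hc] at h1 h5 ⊢
  rw [List.length_append] at h5 ⊢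
  rw [show pos k n V (p ++ q) + (c.length + q.length) - q.length = pos k n V (p ++ q) + c.length by
    omega, reads_append]
  refine ⟨(reads_append.1 h1).2, ?_⟩
  rw [add_assoc, ← h5]
  rcases p with _ | ⟨b, p⟩
  · intro j hj; simp at hj
  · refine (reads_append.1 (reads_necklace hn h3 fun he => ?_)).1
    have hb : b = k := List.eq_of_mem_replicate (n := n) (by rw [← top, ← he]; simp)
    have := (mem_necks.1 h).2.eq_top (length_of_mem_necks h)
      (fun x hx => le_of_mem_necks h hx) (by simp [hb])
    obtain ⟨x, hx, hxk⟩ := hq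
    exact hxk (List.eq_of_mem_replicate (n := n) (by
      rw [← top, ← this]; exact List.mem_append_right _ hx))

/-- The block before the necklaces with the prefix `p` ends with largest symbols. -/
theorem aperiodicPrefix_eq_append_top (hn : 0 < n) {p : List ℕ} {m : ℕ} (hp : ∀ x ∈ p, x ≤ k)
    (hpm : p.length + m = n) {β : List ℕ} (hβ : β ∈ necks k n V)
    (hlt : β < p ++ List.replicate m 0)
    (hmax : ∀ μ ∈ necks k n V, μ < p ++ List.replicate m 0 → μ ≤ β) :
    ∃ c, aperiodicPrefix β = c ++ top k m := by
  have hlen : (p ++ List.replicate m 0).length = n := by simpa using hpm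
  have hβl := length_of_mem_necks hβ
  obtain ⟨i, hi, heq, hlti⟩ := (lt_iff_lexLt hβl hlen).1 hlt
  have hip : i < p.length := by
    by_contra h
    obtain ⟨j, rfl⟩ := Nat.exists_eq_add_of_le (not_lt.1 h)
    simp only [getD_append_right] at hlti
    simp [List.getD_eq_getElem?_getD, show j < m by omega] at hlti
  have hβk : β.getD i 0 < k := by
    refine hlti.trans_le ?_
    simp only [getD_append_left hip]
    exact hp _ (getD_mem hip)
  -- Otherwise `exists_next` yields a larger necklace with the same first `i + 1` symbols, which is
  -- still below `p 0…0`, against the maximality of `β`.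
  have htail : ∀ x ∈ β.drop (i + 1), x = k := by
    by_contra! hx
    have hβ' := hβ
    rw [← List.take_append_drop (i + 1) β] at hβ'
    obtain ⟨μ, h1, h2, h3⟩ := exists_next hβ' hx
    obtain ⟨r, rfl⟩ := prefix_of_between h2.le h3
    rw [List.take_append_drop] at h2
    refine absurd (hmax _ h1 ?_) (not_le.2 h2)
    rw [lt_iff_lexLt (length_of_mem_necks h1) hlen]
    have e : ∀ l < i + 1, (β.take (i + 1) ++ r).getD l 0 = β.getD l 0 := fun l hl => by
      rw [getD_append_left (by simp; omega)]
      simp [List.getD_eq_getElem?_getD, hl]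
    exact ⟨i, hi, fun l hl => by simp only [e l (by omega), heq l hl],
      by simpa only [e i (by omega)] using hlti⟩
  have hdrop : β.drop (i + 1) = top k (n - (i + 1)) := eq_top (by simp [hβl]) htail
  have hsplit : β = (β.take (i + 1) ++ top k (n - (i + 1) - m)) ++ top k m := by
    conv_lhs => rw [← List.take_append_drop (i + 1) β, hdrop]
    rw [List.append_assoc, top, top, top, List.replicate_append_replicate]
    congr 2
    omega
  -- An aperiodic prefix shorter than the final run of `k` would consist of `k` only, and so would
  -- `β`, although its symbol `i` is smaller.
  rcases Nat.lt_or_ge (aperiodicPrefix β).length m with h | h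
  · exfalso
    obtain ⟨r, -, h2⟩ := exists_append_aperiodicPrefix (ne_nil_of_mem_necks hn hβ)
    have hsuf : aperiodicPrefix β <:+ top k m :=
      List.suffix_of_suffix_length_le (l₃ := β) ⟨r, h2.symm⟩ ⟨_, hsplit.symm⟩ (by simpa using h.le)
    have := mem_of_mem_aperiodicPrefix (ne_nil_of_mem_necks hn hβ)
      (fun x hx => List.eq_of_mem_replicate (hsuf.subset hx)) _ (getD_mem (hβl.symm ▸ hi))
    omega
  · rw [hsplit] at hβ h ⊢
    exact suffix_aperiodicPrefix hn hβ (by simpa using h)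

theorem exists_pred {x : List ℕ} (h : ∃ μ ∈ necks k n V, μ < x) :
    ∃ β ∈ necks k n V, β < x ∧ pos k n V x = pos k n V β + (aperiodicPrefix β).length ∧
      ∀ μ ∈ necks k n V, μ < x → μ ≤ β := by
  obtain ⟨μ, hμ, hlt⟩ := h
  obtain ⟨β, hβ, hmax⟩ := ((necks k n V).filter (· < x)).exists_max_image id
    ⟨μ, Finset.mem_filter.2 ⟨hμ, hlt⟩⟩
  obtain ⟨h1, h2⟩ := Finset.mem_filter.1 hβ
  have hmax' : ∀ μ ∈ necks k n V, μ < x → μ ≤ β := fun μ h3 h4 =>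
    hmax μ (Finset.mem_filter.2 ⟨h3, h4⟩)
  refine ⟨β, h1, h2, ?_, hmax'⟩
  have : (necks k n V).filter (· < x) = insert β ((necks k n V).filter (· < β)) := by
    ext μ
    simp only [Finset.mem_filter, Finset.mem_insert]
    constructor
    · rintro ⟨h3, h4⟩
      rcases (hmax' μ h3 h4).eq_or_lt with h | h
      · exact .inl h
      · exact .inr ⟨h3, h⟩
    · rintro (rfl | ⟨h3, h4⟩)
      · exact ⟨h1, h2⟩
      · exact ⟨h3, h4.trans h2⟩
  rw [pos, this, Finset.sum_insert (by simp), add_comm]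
  rfl

/-- As 0 precedes the alphabet, `p 0…0` marks the place where the necklaces with prefix `p` begin;
it need not be a necklace, nor need any necklace have this prefix. -/
theorem exists_append_top_before (hn : 0 < n) {p : List ℕ} {m : ℕ} (hp : ∀ x ∈ p, x ≤ k)
    (hpm : p.length + m = n) (h : ∃ μ ∈ necks k n V, μ < p ++ List.replicate m 0) :
    m ≤ pos k n V (p ++ List.replicate m 0) ∧
      Reads (cycleAtLeast k n V) (pos k n V (p ++ List.replicate m 0) - m) (top k m) := by
  obtain ⟨β, h1, h2, h3, h4⟩ := exists_pred h
  obtain ⟨c, hc⟩ := aperiodicPrefix_eq_append_top hn hp hpm h1 h2 h4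
  have h5 := reads_aperiodicPrefix h1
  rw [hc] at h3 h5
  rw [List.length_append, top, List.length_replicate] at h3
  refine ⟨by omega, ?_⟩
  rw [show pos k n V (p ++ List.replicate m 0) - m = pos k n V β + c.length by omega]
  exact (reads_append.1 h5).2

theorem aperiodicPrefix_top (hn : 0 < n) : aperiodicPrefix (top k n) = [k] := by
  have hne : top k n ≠ [] := by simp [top]; omega
  have h1 : Function.minimalPeriod (fun l : List ℕ => l.rotate 1) (top k n) = 1 := by
    refine Nat.dvd_one.1 (isPeriodicPt_rotate.2 ?_).minimalPeriod_dvd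
    rw [top, List.rotate_replicate]
  rw [aperiodicPrefix_eq hne, h1, top, List.take_replicate, min_eq_left hn]
  rfl

theorem length_eq_pos_top (hn : 0 < n) (h : top k n ∈ necks k n V) :
    (cycleAtLeast k n V).length = pos k n V (top k n) + 1 := by
  rw [length_cycleAtLeast hn]
  have h1 := sum_length_aperiodicPrefix (k := k) (V := V) hn (fun _ => True)
  rw [Finset.filter_true_of_mem (by simp), Finset.filter_true_of_mem] at h1
  · rw [← h1, pos, ← Finset.sum_filter_add_sum_filter_not (necks k n V) (· < top k n)]
    congr 1
    have : (necks k n V).filter (fun μ => ¬ μ < top k n) = {top k n} := by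
      ext μ
      simp only [Finset.mem_filter, not_lt, Finset.mem_singleton]
      constructor
      · rintro ⟨h1, h2⟩
        exact le_antisymm (le_top (length_of_mem_necks h1) fun x hx => le_of_mem_necks h1 hx) h2
      · rintro rfl
        exact ⟨h, le_rfl⟩
    rw [this, Finset.sum_singleton, aperiodicPrefix_top hn]
    rfl
  · intro y hy
    have hy := (mem_strings.1 (mem_stringsAtLeast.1 hy).1).1
    obtain ⟨i, hi, hN, -⟩ := exists_rotate_min (s := y) (by rintro rfl; simp at hy; omega)
    exact ⟨i, by omega, trivial, hN⟩

/-- The cyclic sequence ends with `n` largest symbols, unless it is a single one. -/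
theorem reads_top (hn : 0 < n) (h : top k n ∈ necks k n V) :
    (necks k n V = {top k n} ∧ cycleAtLeast k n V = [k]) ∨ n ≤ (cycleAtLeast k n V).length ∧
      Reads (cycleAtLeast k n V) ((cycleAtLeast k n V).length - n) (top k n) := by
  by_cases hex : ∃ μ ∈ necks k n V, μ ≠ top k n
  · right
    obtain ⟨μ, hμ, hne⟩ := hex
    obtain ⟨n, rfl⟩ : ∃ m, n = m + 1 := ⟨n - 1, by omega⟩
    have hlow : ∀ μ ∈ necks k (n + 1) V, μ ≠ top k (n + 1) → μ < [k] ++ List.replicate n 0 := by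
      intro μ hμ hne
      have hl := length_of_mem_necks hμ
      rw [lt_iff_lexLt hl (by simp)]
      refine ⟨0, hn, by simp, ?_⟩
      by_contra hk
      exact hne ((mem_necks.1 hμ).2.eq_top hl (fun x hx => le_of_mem_necks hμ hx)
        (by simpa using hk))
    -- Only `k…k` starts with `k`, so the block before the last one ends with all but one of the
    -- required symbols `k`; the last block `[k]` supplies the missing one.
    obtain ⟨h1, h2⟩ := exists_append_top_before hn (p := [k]) (m := n) (by simp)
      (by simp; omega) ⟨μ, hμ, hlow μ hμ hne⟩
    have hpos : pos k (n + 1) V ([k] ++ List.replicate n 0) = pos k (n + 1) V (top k (n + 1)) := by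
      rw [pos, pos]
      congr 1
      refine Finset.filter_congr fun μ hμ => ⟨fun h => lt_of_lt_of_le h ?_, fun h =>
        hlow μ hμ h.ne⟩
      exact le_top (by simp) (by simp)
    rw [hpos] at h1 h2
    have h3 := length_eq_pos_top hn h
    refine ⟨by omega, ?_⟩
    have h4 := reads_aperiodicPrefix h
    rw [aperiodicPrefix_top hn] at h4
    have h5 : Reads (cycleAtLeast k (n + 1) V) (pos k (n + 1) V (top k (n + 1)) - n)
        (top k n ++ [k]) :=
      reads_append.2 ⟨h2, by rwa [top, List.length_replicate, Nat.sub_add_cancel h1]⟩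
    rw [h3, Nat.add_sub_add_right]
    rwa [top, top, ← List.replicate_succ'] at h5
  · left
    push Not at hex
    have h1 : necks k n V = {top k n} :=
      Finset.eq_singleton_iff_unique_mem.2 ⟨h, hex⟩
    refine ⟨h1, ?_⟩
    change (((necks k n V).sort (· ≤ ·)).map aperiodicPrefix).flatten = _
    rw [h1]
    simp [aperiodicPrefix_top hn]

end Cycle

end UCycle

/-! ### Positions as counts, and the universal cycle property -/

namespace UCycle

section Position

variable {k n V : ℕ}

/-- The number of strings with a rotation that does not exceed `x`. -/
noncomputable def upTo (k n V : ℕ) (x : List ℕ) : ℕ :=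
  ((stringsAtLeast k n V).filter fun y => ∃ r < n, y.rotate r ≤ x).card

/-- Some rotation is at most `x` if and only if the least one is. So `upTo` is the position right
after the blocks of the necklaces up to `x`. -/
theorem upTo_eq_sum (hn : 0 < n) (x : List ℕ) :
    upTo k n V x = ∑ μ ∈ (necks k n V).filter (· ≤ x), (aperiodicPrefix μ).length := by
  rw [sum_length_aperiodicPrefix hn, upTo]
  congr 1
  refine Finset.filter_congr fun y hy => ?_
  have hy := (mem_strings.1 (mem_stringsAtLeast.1 hy).1).1
  constructor
  · rintro ⟨r, -, h⟩
    obtain ⟨i, hi, hN, hmin⟩ := exists_rotate_min (s := y) (by rintro rfl; simp at hy; omega)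
    exact ⟨i, by omega, (hmin r).trans h, hN⟩
  · rintro ⟨i, hi, h, -⟩
    exact ⟨i, hi, h⟩

theorem upTo_mono {x y : List ℕ} (h : x ≤ y) : upTo k n V x ≤ upTo k n V y :=
  Finset.card_le_card (Finset.monotone_filter_right _ fun _ _ ⟨r, hr, h'⟩ => ⟨r, hr, h'.trans h⟩)

theorem upTo_le (x : List ℕ) : upTo k n V x ≤ (stringsAtLeast k n V).card :=
  Finset.card_filter_le _ _

theorem aboveCount_add_upTo (hn : 0 < n) (z : ℕ → ℕ) :
    aboveCount k n V z + upTo k n V (word n z) = (stringsAtLeast k n V).card := by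
  rw [aboveCount_eq_card hn, upTo, add_comm,
    ← Finset.card_filter_add_card_filter_not (s := stringsAtLeast k n V)
      (fun y => ∃ r < n, y.rotate r ≤ word n z)]
  congr 2
  ext y
  simp only [Finset.mem_filter, mem_stringsAtLeast, not_exists, not_and, not_le]
  tauto

theorem upTo_eq_pos_add (hn : 0 < n) {ν : List ℕ} (h : ν ∈ necks k n V) :
    upTo k n V ν = pos k n V ν + (aperiodicPrefix ν).length := by
  have : (necks k n V).filter (· ≤ ν) = insert ν ((necks k n V).filter (· < ν)) := by
    ext μ
    simp only [Finset.mem_filter, Finset.mem_insert, le_iff_eq_or_lt]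
    constructor
    · rintro ⟨h1, h2 | h2⟩
      · exact .inl h2
      · exact .inr ⟨h1, h2⟩
    · rintro (rfl | ⟨h1, h2⟩)
      · exact ⟨h, .inl rfl⟩
      · exact ⟨h1, .inr h2⟩
  rw [upTo_eq_sum hn, this, Finset.sum_insert (by simp), add_comm]
  rfl

/-- A word that contains 0 is never one of the necklaces, so `≤` and `<` agree here. -/
theorem upTo_append_zeros (hn : 0 < n) (p : List ℕ) {m : ℕ} (hm : 0 < m) :
    upTo k n V (p ++ List.replicate m 0) = pos k n V (p ++ List.replicate m 0) := by
  rw [upTo_eq_sum hn, pos]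
  congr 1
  refine Finset.filter_congr fun μ hμ => ⟨fun h => lt_of_le_of_ne h ?_, fun h => h.le⟩
  rintro rfl
  have := (mem_strings.1 (mem_necks.1 hμ).1.1).2 0 (by simp; omega)
  omega

/-- The cyclic position that lies `d` places before the position `N`. -/
def posBefore (N d t : ℕ) : ℕ := if N < d then N + t - d else N - d

theorem card_pos {s : List ℕ} (hs : s ∈ stringsAtLeast k n V) : 0 < (stringsAtLeast k n V).card :=
  Finset.card_pos.2 ⟨s, hs⟩

theorem reads_of_eq_singleton {u t : List ℕ} (hu : u = [k]) (ht : ∀ x ∈ t, x = k) (i : ℕ) :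
    Reads u i t := by
  rintro j hj
  rw [ht _ (getD_mem hj), hu]
  simp [Nat.mod_one]

theorem reads_top_suffix (hn : 0 < n) (h : top k n ∈ necks k n V) {m : ℕ} (hm : m ≤ n) :
    Reads (cycleAtLeast k n V) ((cycleAtLeast k n V).length - m) (top k m) := by
  rcases reads_top hn h with ⟨-, h1⟩ | ⟨h1, h2⟩
  · exact reads_of_eq_singleton h1 (fun x hx => List.eq_of_mem_replicate hx) _
  · obtain ⟨l, rfl⟩ := Nat.exists_eq_add_of_le' hm
    rw [top, ← List.replicate_append_replicate, reads_append] at h2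
    rw [show (cycleAtLeast k (l + m) V).length - m =
      (cycleAtLeast k (l + m) V).length - (l + m) + l by omega]
    simpa using h2.2

/-- The position of a string whose smallest rotation is not split inside its final run of largest
symbols. -/
theorem reads_posBefore_rotate (hn : 0 < n) {s : List ℕ} (hs : s ∈ stringsAtLeast k n V) {d m : ℕ}
    (hdn : d ≤ n) (hmin : ∀ j, s.rotate d ≤ s.rotate j)
    (hfirst : ∀ e, 0 < e → e < d → s.rotate e ≠ s.rotate d) (hmd : m < d) (hm : s.getD m 0 ≠ k) :
    d ≤ upTo k n V (s.rotate d) ∧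
      Reads (cycleAtLeast k n V) (upTo k n V (s.rotate d) - d) s := by
  obtain ⟨h1, h2⟩ := mem_stringsAtLeast.1 hs
  have hl := (mem_strings.1 h1).1
  have hν := rotate_min_mem_necks h1 h2 (i := d) fun i _ => by
    rw [List.rotate_rotate]; exact hmin _
  rw [upTo_eq_pos_add hn hν]
  have hne := ne_nil_of_mem_necks hn hν
  -- If `d` exceeded the period, rotation by `d` minus the period would give the same string
  -- earlier.
  have hle : d ≤ (aperiodicPrefix (s.rotate d)).length := by
    by_contra hlt
    have hpos := length_aperiodicPrefix_pos hne
    have hrot := rotate_length_aperiodicPrefix hne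
    set p := (aperiodicPrefix (s.rotate d)).length
    refine hfirst (d - p) (by omega) (by omega) (List.rotate_injective p ?_)
    simp only [hrot]
    rw [List.rotate_rotate, Nat.sub_add_cancel (by omega)]
  refine ⟨by omega, ?_⟩
  rw [List.rotate_eq_drop_append_take (by omega)] at hν hle ⊢
  have hq : ∃ c ∈ s.take d, c ≠ k := by
    refine ⟨s.getD m 0, ?_, hm⟩
    have : (s.take d).getD m 0 = s.getD m 0 := by
      simp [List.getD_eq_getElem?_getD, hmd]
    rw [← this]
    exact getD_mem (by simp; omega)
  have hlq : (s.take d).length = d := by simp; omega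
  have := reads_rotation hn hν (by omega) hq
  rwa [hlq, List.take_append_drop] at this

/-- The position of a string whose smallest rotation is split inside its final run of largest
symbols. -/
theorem reads_posBefore_zeros (hn : 0 < n) (hk : 0 < k) {s : List ℕ}
    (hs : s ∈ stringsAtLeast k n V) {d m : ℕ}
    (hd0 : 0 < d) (hmin : ∀ j, s.rotate d ≤ s.rotate j)
    (hdm : d ≤ m) (hmn : m ≤ n) (hlead : ∀ l < m, s.getD l 0 = k) (hm : m < n → s.getD m 0 ≠ k) :
    posBefore (upTo k n V (s.drop m ++ List.replicate m 0)) m (stringsAtLeast k n V).card <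
      (stringsAtLeast k n V).card ∧ Reads (cycleAtLeast k n V)
      (posBefore (upTo k n V (s.drop m ++ List.replicate m 0)) m (stringsAtLeast k n V).card) s := by
  obtain ⟨h1, h2⟩ := mem_stringsAtLeast.1 hs
  obtain ⟨hl, hsk⟩ := mem_strings.1 h1
  have hcard := card_pos hs
  have htop := top_mem_necks hk hs
  have hlen := length_cycleAtLeast (k := k) (V := V) hn
  have hup := upTo_le (k := k) (n := n) (V := V) (s.drop m ++ List.replicate m 0)
  refine ⟨by unfold posBefore; split_ifs <;> omega, ?_⟩
  have htake : s.take m = top k m := by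
    refine ext_getD (by simp; omega) fun l hl' => ?_
    have hl' : l < m := by simpa using hl'
    rw [show (s.take m).getD l 0 = s.getD l 0 by simp [List.getD_eq_getElem?_getD, hl'],
      hlead l hl']
    simp [List.getD_eq_getElem?_getD, hl']
  have hsplit : s = top k m ++ s.drop m := by rw [← htake, List.take_append_drop]
  rw [upTo_append_zeros hn _ (by omega), posBefore]
  have hplen : (s.drop m).length + m = n := by simp; omega
  have hpk : ∀ x ∈ s.drop m, x ≤ k := fun x hx => (hsk x (List.mem_of_mem_drop hx)).2
  have hbefore := exists_append_top_before (V := V) hn hpk hplen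
  rcases hmn.lt_or_eq with hlt | rfl
  · have hN : IsNecklace (s.rotate d) := fun i _ => by rw [List.rotate_rotate]; exact hmin _
    have hν := rotate_min_mem_necks h1 h2 hN
    have hνl : (s.rotate d).length = n := by simpa using hl
    -- For `d < m` the least rotation would start with `k`, and then all symbols would be `k`.
    have hd : d = m := by
      by_contra hne
      have h0 : (s.rotate d).getD 0 0 = k := by
        rw [getD_rotate (by omega), hl, Nat.mod_eq_of_lt (by omega), add_zero]
        exact hlead d (by omega)
      have := hN.eq_top hνl (fun x hx => le_of_mem_necks hν hx) h0.ge
      refine hm hlt (List.eq_of_mem_replicate (n := n) ?_)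
      rw [← top, ← this]
      exact List.mem_rotate.2 (getD_mem (by omega))
    subst hd
    rw [List.rotate_eq_drop_append_take (by omega), htake] at hν
    have hge : s.drop d ++ List.replicate d 0 ≤ s.drop d ++ top k d := by
      by_contra h
      obtain ⟨i, hi, hl', hlt'⟩ := (lt_iff_lexLt (n := n) (by simp; omega) (by simp; omega)).1
        (not_le.1 h)
      rcases Nat.lt_or_ge i (s.drop d).length with h | h
      · simp only [getD_append_left h] at hlt'; omega
      · obtain ⟨j, rfl⟩ := Nat.exists_eq_add_of_le h
        simp only [getD_append_right] at hlt'
        simp [List.getD_eq_getElem?_getD, show j < d by omega] at hlt'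
    -- The first necklace that is not below the marker lies at most at the least rotation of `s`, so
    -- it has the prefix `s.drop d`; its block starts right at the marker.
    obtain ⟨β, hβ, hmin'⟩ := ((necks k n V).filter
      (s.drop d ++ List.replicate d 0 ≤ ·)).exists_min_image id
      ⟨_, Finset.mem_filter.2 ⟨hν, hge⟩⟩
    obtain ⟨hβ1, hβ2⟩ := Finset.mem_filter.1 hβ
    have hβpos : pos k n V β = pos k n V (s.drop d ++ List.replicate d 0) := by
      rw [pos, pos]
      congr 1
      refine Finset.filter_congr fun μ hμ => ⟨fun h => ?_, fun h => h.trans_le hβ2⟩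
      by_contra h'
      exact absurd (hmin' μ (Finset.mem_filter.2 ⟨hμ, not_lt.1 h'⟩)) (not_le.2 h)
    obtain ⟨r, rfl⟩ := prefix_of_between hβ2 (hmin' _ (Finset.mem_filter.2 ⟨hν, hge⟩))
    have hβne : s.drop d ++ r ≠ top k n := by
      intro he
      refine hm hlt (List.eq_of_mem_replicate (n := n) ?_)
      rw [← top, ← he]
      refine List.mem_append_left _ ?_
      have : (s.drop d).getD 0 0 = s.getD d 0 := by simp [List.getD_eq_getElem?_getD]
      rw [← this]
      exact getD_mem (by omega)
    have hreads := (reads_append.1 (reads_necklace hn hβ1 hβne)).1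
    rw [hβpos] at hreads
    rw [hsplit, reads_append, ← hsplit, top, List.length_replicate]
    by_cases hex : ∃ μ ∈ necks k n V, μ < s.drop d ++ List.replicate d 0
    · obtain ⟨h3, h4⟩ := hbefore hex
      rw [if_neg (by omega), Nat.sub_add_cancel h3]
      exact ⟨h4, hreads⟩
    -- No block precedes: the leading symbols `k` are read at the end of the sequence, and the rest
    -- after wrapping around.
    · have h0 : pos k n V (s.drop d ++ List.replicate d 0) = 0 := by
        rw [pos, Finset.filter_eq_empty_iff.2, Finset.sum_empty]
        exact fun μ hμ h => hex ⟨μ, hμ, h⟩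
      rw [h0] at hreads ⊢
      rw [if_pos hd0, zero_add, ← hlen]
      have hge : n ≤ (cycleAtLeast k n V).length := by
        rcases reads_top hn htop with ⟨h3, -⟩ | ⟨h3, -⟩
        · rw [h3, Finset.mem_singleton] at hβ1
          exact absurd hβ1 hβne
        · exact h3
      rw [Nat.sub_add_cancel (by omega)]
      refine ⟨reads_top_suffix hn htop hmn, ?_⟩
      rw [← zero_add (cycleAtLeast k n V).length]
      exact reads_add_length.2 hreads
  · have hd : s.drop m = [] := List.drop_eq_nil_of_le hl.le
    have hs : s = top k m := by rw [hsplit, hd, List.append_nil]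
    have h0 : pos k m V (s.drop m ++ List.replicate m 0) = 0 := by
      rw [hd, List.nil_append, pos, Finset.filter_eq_empty_iff.2, Finset.sum_empty]
      intro μ hμ h
      obtain ⟨i, hi, -, h⟩ := (lt_iff_lexLt (length_of_mem_necks hμ) (by simp)).1 h
      simp [List.getD_eq_getElem?_getD, hi] at h
    rw [h0, if_pos hn, zero_add, ← hlen, hs]
    exact reads_top_suffix hn htop le_rfl

/-- The rotation amount `d` is the least positive one that gives the least rotation, so `1 ≤ d ≤ n`.
The two cases compare `d` with the number of leading symbols `k`. -/
theorem exists_reads (hn : 0 < n) (hk : 0 < k) {s : List ℕ} (hs : s ∈ stringsAtLeast k n V) :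
    ∃ i < (stringsAtLeast k n V).card, Reads (cycleAtLeast k n V) i s := by
  classical
  have hl := (mem_strings.1 (mem_stringsAtLeast.1 hs).1).1
  have hex : ∃ d, 0 < d ∧ ∀ j, s.rotate d ≤ s.rotate j := by
    obtain ⟨i, -, -, hmin⟩ := exists_rotate_min (s := s) (by rintro rfl; simp at hl; omega)
    refine ⟨i + s.length, by omega, fun j => ?_⟩
    rw [← List.rotate_mod s (i + s.length), Nat.add_mod_right, List.rotate_mod]
    exact hmin j
  obtain ⟨h1, h2⟩ := Nat.find_spec hex
  have hdn : Nat.find hex ≤ n := by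
    by_contra h
    refine Nat.find_min hex (m := Nat.find hex - n) (by omega) ⟨by omega, fun j => ?_⟩
    refine le_of_eq_of_le ?_ (h2 j)
    rw [← List.rotate_mod s (Nat.find hex), ← List.rotate_mod s (Nat.find hex - n), hl,
      ← Nat.mod_eq_sub_mod (by omega)]
  by_cases hlead : ∃ m < n, s.getD m 0 ≠ k ∧ ∀ l < m, s.getD l 0 = k
  · obtain ⟨m, hmn, hm, hlead⟩ := hlead
    rcases Nat.lt_or_ge m (Nat.find hex) with h | h
    · obtain ⟨h3, h4⟩ := reads_posBefore_rotate hn hs hdn h2 (fun e he0 he heq =>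
        Nat.find_min hex he ⟨he0, fun j => by rw [heq]; exact h2 j⟩) h hm
      have := upTo_le (k := k) (n := n) (V := V) (s.rotate (Nat.find hex))
      exact ⟨_, by omega, h4⟩
    · obtain ⟨h3, h4⟩ := reads_posBefore_zeros hn hk hs h1 h2 h hmn.le hlead (fun _ => hm)
      exact ⟨_, h3, h4⟩
  · have hall : ∀ l < n, s.getD l 0 = k := by
      intro l
      induction l using Nat.strong_induction_on with
      | _ l ih =>
        intro hln
        by_contra hne
        exact hlead ⟨l, hln, hne, fun j hj => ih j hj (by omega)⟩
    obtain ⟨h3, h4⟩ := reads_posBefore_zeros hn hk hs h1 h2 hdn le_rfl hall (fun h => absurd h (lt_irrefl _))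
    exact ⟨_, h3, h4⟩

/-- There are as many positions as strings and every string occurs. Equality of cardinalities then
gives both that no string occurs twice and that nothing else occurs. -/
theorem stringsAtLeast_eq_image (hn : 0 < n) (hk : 0 < k) : stringsAtLeast k n V =
    (Finset.range (stringsAtLeast k n V).card).image (cyclicSubstring (cycleAtLeast k n V) n) := by
  refine Finset.eq_of_subset_of_card_le (fun s hs => ?_)
    (Finset.card_image_le.trans_eq (Finset.card_range _))
  obtain ⟨i, hi, h⟩ := exists_reads hn hk hs
  have hl := (mem_strings.1 (mem_stringsAtLeast.1 hs).1).1
  have := h.cyclicSubstring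
  rw [hl] at this
  exact Finset.mem_image.2 ⟨i, Finset.mem_range.2 hi, this⟩

theorem mem_stringsAtLeast_of_reads (hn : 0 < n) (hk : 0 < k) {i : ℕ} {t : List ℕ}
    (hi : i < (stringsAtLeast k n V).card) (ht : t.length = n)
    (h : Reads (cycleAtLeast k n V) i t) : t ∈ stringsAtLeast k n V := by
  rw [stringsAtLeast_eq_image hn hk, ← h.cyclicSubstring, ht]
  exact Finset.mem_image_of_mem _ (Finset.mem_range.2 hi)

theorem isUniversalCycle_cycleAtLeast (hn : 0 < n) (hk : 0 < k) :
    IsUniversalCycle (cycleAtLeast k n V) (stringsAtLeast k n V) := by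
  have hlen := length_cycleAtLeast (k := k) (V := V) hn
  have hinj : Set.InjOn (cyclicSubstring (cycleAtLeast k n V) n)
      (Finset.range (stringsAtLeast k n V).card) := by
    rw [← Finset.card_image_iff, ← stringsAtLeast_eq_image hn hk, Finset.card_range]
  refine ⟨hlen, fun s hs => ?_⟩
  have hl := (mem_strings.1 (mem_stringsAtLeast.1 hs).1).1
  obtain ⟨i, hi, h⟩ := exists_reads hn hk hs
  refine ⟨i + 1, ⟨by omega, by omega, h.cyclicSubstring⟩, fun r ⟨h1, h2, h3⟩ => ?_⟩
  have := hinj (by simpa using by omega) (by simpa using hi)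
    ((hl ▸ h3).trans (hl ▸ h.cyclicSubstring).symm : cyclicSubstring _ n (r - 1) = _)
  omega

/-- The string `α` is the smallest one such that more than `i` strings have a rotation that does
not exceed it. -/
structure IsBlock (k n V i : ℕ) (α : List ℕ) : Prop where
  mem : α ∈ strings k n
  lt : i < upTo k n V α
  le : ∀ y ∈ strings k n, y < α → upTo k n V y ≤ i

/-- `upTo` increases only at necklaces, so the least string where it exceeds `i` is one; minimality
applied to the preceding necklace shows that its block starts at or before `i`. -/
theorem IsBlock.spec (hn : 0 < n) {i : ℕ} {α : List ℕ} (h : IsBlock k n V i α) :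
    α ∈ necks k n V ∧ pos k n V α ≤ i := by
  have hα : α ∈ necks k n V := by
    have hne : ((necks k n V).filter (· ≤ α)).Nonempty := by
      rw [Finset.nonempty_iff_ne_empty]
      intro he
      have := h.lt
      rw [upTo_eq_sum hn, he] at this
      simp at this
    obtain ⟨μ, hμ, hmax⟩ := Finset.exists_max_image _ id hne
    obtain ⟨h1, h2⟩ := Finset.mem_filter.1 hμ
    rcases h2.eq_or_lt with rfl | h3
    · exact h1
    · have h4 := h.le μ (mem_necks.1 h1).1.1 h3
      have h5 : upTo k n V μ = upTo k n V α := by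
        rw [upTo_eq_sum hn, upTo_eq_sum hn]
        congr 1
        refine Finset.filter_congr fun ν hν => ⟨fun h => h.trans h2, fun h => ?_⟩
        exact hmax ν (Finset.mem_filter.2 ⟨hν, h⟩)
      have := h.lt
      omega
  refine ⟨hα, ?_⟩
  by_cases hex : ∃ μ ∈ necks k n V, μ < α
  · obtain ⟨β, h1, h2, h3, -⟩ := exists_pred hex
    rw [h3, ← upTo_eq_pos_add hn h1]
    exact h.le β (mem_necks.1 h1).1.1 h2
  · rw [pos, Finset.filter_eq_empty_iff.2, Finset.sum_empty]
    · exact Nat.zero_le _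
    · exact fun μ hμ h => hex ⟨μ, hμ, h⟩

theorem IsBlock.length_le (hn : 0 < n) {i : ℕ} {α : List ℕ} (h : IsBlock k n V i α) :
    upTo k n V α - i ≤ (aperiodicPrefix α).length ∧ (aperiodicPrefix α).length ≤ n := by
  obtain ⟨h1, h2⟩ := h.spec hn
  rw [upTo_eq_pos_add hn h1]
  refine ⟨by omega, ?_⟩
  rw [← length_of_mem_necks h1, aperiodicPrefix_eq (ne_nil_of_mem_necks hn h1)]
  simp

/-- The string at a position that does not lie in the final run of largest symbols of a block. -/
theorem IsBlock.reads_rotate (hn : 0 < n) {i : ℕ} {α : List ℕ} (h : IsBlock k n V i α)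
    (hq : ∃ c ∈ α.drop (n - (upTo k n V α - i)), c ≠ k) :
    Reads (cycleAtLeast k n V) i (α.rotate (n - (upTo k n V α - i))) := by
  obtain ⟨h1, h2⟩ := h.spec hn
  obtain ⟨h3, h4⟩ := h.length_le hn
  have hl := length_of_mem_necks h1
  have hlt := h.lt
  have hup := upTo_eq_pos_add hn h1
  set e := upTo k n V α - i with he
  have hlen : (α.drop (n - e)).length = e := by simp; omega
  have h5 := reads_rotation (p := α.take (n - e)) (q := α.drop (n - e)) (V := V) hn
    (by rwa [List.take_append_drop]) (by rw [List.take_append_drop, hlen]; exact h3) hq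
  rw [List.take_append_drop, ← hup, hlen, ← List.rotate_eq_drop_append_take (by omega),
    show upTo k n V α - e = i by omega] at h5
  exact h5

/-- The string at a position among the last ones of the cyclic sequence. -/
theorem IsBlock.reads_top_append_of_le (hn : 0 < n) {i : ℕ} {β : List ℕ}
    (hi : i < (stringsAtLeast k n V).card) (hin : (stringsAtLeast k n V).card ≤ i + n)
    (h : IsBlock k n V 0 β) (hk : 0 < k) : Reads (cycleAtLeast k n V) i
      (top k ((stringsAtLeast k n V).card - i) ++
        β.take (n - ((stringsAtLeast k n V).card - i))) := by
  obtain ⟨h1, h2⟩ := h.spec hn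
  have hs := mem_stringsAtLeast.2 (mem_necks.1 h1).1
  have htop := top_mem_necks hk hs
  have hlen := length_cycleAtLeast (k := k) (V := V) hn
  have h3 := reads_top_suffix hn htop (show (stringsAtLeast k n V).card - i ≤ n by omega)
  rw [hlen, show (stringsAtLeast k n V).card - ((stringsAtLeast k n V).card - i) = i by omega] at h3
  refine reads_append.2 ⟨h3, ?_⟩
  rw [top, List.length_replicate, show i + ((stringsAtLeast k n V).card - i) =
    0 + (cycleAtLeast k n V).length by omega, reads_add_length]
  by_cases hβ : β = top k n
  -- If the first necklace is `k…k`, the sequence has length 1. Then either it is `[k]`, which reads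
  -- every run of `k`, or `n = 1` and nothing remains to be read.
  · rcases reads_top hn htop with ⟨-, h4⟩ | ⟨h4, -⟩
    · refine reads_of_eq_singleton h4 (fun x hx => ?_) _
      rw [hβ] at hx
      exact List.eq_of_mem_replicate (List.mem_of_mem_take hx)
    · have := length_eq_pos_top hn htop
      rw [← hβ] at this
      have : n - ((stringsAtLeast k n V).card - i) = 0 := by omega
      rw [this]
      intro j hj
      simp at hj
  · have h4 := reads_necklace hn h1 hβ
    rw [Nat.le_zero.1 h2, ← List.take_append_drop (n - ((stringsAtLeast k n V).card - i)) β] at h4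
    exact (reads_append.1 h4).1

/-- The string at a position in the final run of largest symbols of a block. -/
theorem IsBlock.reads_top_append (hn : 0 < n) {i : ℕ} {α β : List ℕ}
    (h : IsBlock k n V i α) (hin : i + n < (stringsAtLeast k n V).card)
    (hq : ∀ c ∈ α.drop (n - (upTo k n V α - i)), c = k)
    (h' : IsBlock k n V (upTo k n V α) β) (hk : 0 < k) : Reads (cycleAtLeast k n V) i
      (top k (upTo k n V α - i) ++ β.take (n - (upTo k n V α - i))) := by
  obtain ⟨h1, h2⟩ := h.spec hn
  obtain ⟨h3, h4⟩ := h.length_le hn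
  obtain ⟨h1', h2'⟩ := h'.spec hn
  have hlt := h.lt
  have hup := upTo_eq_pos_add hn h1
  have hl := length_of_mem_necks h1
  have hlen := length_cycleAtLeast (k := k) (V := V) hn
  have htop := top_mem_necks hk (mem_stringsAtLeast.2 (mem_necks.1 h1).1)
  have hαβ : α < β := by
    by_contra hle
    have := upTo_mono (k := k) (n := n) (V := V) (not_lt.1 hle)
    have := h'.lt
    omega
  obtain ⟨γ, hγ, hαγ, hpos, hmin⟩ := exists_succ h1 ⟨β, h1', hαβ⟩
  -- `upTo α` is the position where the next block starts, so the block found there is the one of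
  -- the successor.
  obtain rfl : γ = β := by
    refine (hmin β h1' hαβ).antisymm (not_lt.1 fun hlt' => ?_)
    have := h'.le γ (mem_necks.1 hγ).1.1 hlt'
    rw [upTo_eq_pos_add hn hγ] at this
    have := length_aperiodicPrefix_pos (ne_nil_of_mem_necks hn hγ)
    omega
  set e := upTo k n V α - i with he
  have hdrop : α.drop (n - e) = top k e := eq_top (by simp; omega) hq
  have hα := List.take_append_drop (n - e) α
  rw [hdrop] at hα
  obtain ⟨c, hc⟩ := suffix_aperiodicPrefix (V := V) hn (p := α.take (n - e)) (q := top k e)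
    (by rwa [hα]) (by rw [hα]; simpa using h3)
  rw [hα] at hc
  have h5 := reads_aperiodicPrefix h1
  rw [hc] at h5 hup
  rw [List.length_append, top, List.length_replicate] at hup
  have h6 := (reads_append.1 h5).2
  rw [show pos k n V α + c.length = i by omega] at h6
  refine reads_append.2 ⟨h6, ?_⟩
  rw [top, List.length_replicate, show i + e = pos k n V γ by
    have := upTo_eq_pos_add hn h1; omega]
  -- The block of `k…k` is the last symbol of the sequence, and `i + n` lies before the end. So `e =
  -- n` and `α` itself would be `k…k`.
  have hne : γ ≠ top k n := by
    rintro rfl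
    have h7 := length_eq_pos_top hn htop
    have h8 := upTo_eq_pos_add hn h1
    have : e = n := by omega
    rw [this, Nat.sub_self, List.drop_zero] at hdrop
    rw [hdrop] at hαβ
    exact lt_irrefl _ hαβ
  have h9 := reads_necklace hn hγ hne
  rw [← List.take_append_drop (n - e) γ] at h9
  have := (reads_append.1 h9).1
  rwa [List.take_append_drop] at this

end Position

/-! ### Complementation -/

section Complement

variable {k n : ℕ}

theorem complement_complement {s : List ℕ} (h : ∀ x ∈ s, 1 ≤ x ∧ x ≤ k) :
    complement k (complement k s) = s := by
  rw [complement, complement, List.map_map]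
  conv_rhs => rw [← List.map_id s]
  refine List.map_congr_left fun x hx => ?_
  have := h x hx
  simp only [Function.comp, id]
  omega

theorem sum_complement {s : List ℕ} (h : ∀ x ∈ s, 1 ≤ x ∧ x ≤ k) :
    (complement k s).sum + s.sum = (k + 1) * s.length := by
  induction s with
  | nil => simp [complement]
  | cons x s ih =>
    have h1 := ih fun y hy => h y (List.mem_cons_of_mem _ hy)
    have h2 := h x (by simp)
    simp only [complement, List.map_cons, List.sum_cons, List.length_cons] at h1 ⊢
    rw [Nat.mul_succ]
    omega

theorem complement_mem_strings {s : List ℕ} (h : s ∈ strings k n) :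
    complement k s ∈ strings k n := by
  obtain ⟨h1, h2⟩ := mem_strings.1 h
  refine mem_strings.2 ⟨by simpa [complement] using h1, fun x hx => ?_⟩
  obtain ⟨y, hy, rfl⟩ := List.mem_map.1 hx
  have := h2 y hy
  omega

/-- A negative bound selects all strings, just as its truncation to 0 does, since weights are
nonnegative. -/
theorem stringsAtLeast_eq (k n w : ℕ) : stringsAtLeast k n ((k : ℤ) * n - w + n) =
    stringsAtLeast k n ((k * n + n - w : ℕ) : ℤ) := by
  refine Finset.filter_congr fun s _ => ?_
  have : ((k * n : ℕ) : ℤ) = (k : ℤ) * n := by push_cast; rfl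
  rw [← this]
  omega

theorem cycleAtMost_eq (k n w : ℕ) : cycleAtMost k n w =
    complement k (cycleAtLeast k n ((k * n + n - w : ℕ) : ℤ)) := by
  rw [cycleAtMost, cycleAtLeast, necklacesAtLeast, stringsAtLeast_eq]
  rfl

theorem complement_mem_stringsAtMost {w : ℕ} {s : List ℕ}
    (h : s ∈ stringsAtLeast k n ((k * n + n - w : ℕ) : ℤ)) :
    complement k s ∈ stringsAtMost k n w := by
  obtain ⟨h1, h2⟩ := mem_stringsAtLeast.1 h
  obtain ⟨h3, h4⟩ := mem_strings.1 h1
  have := sum_complement h4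
  rw [h3] at this
  refine Finset.mem_filter.2 ⟨complement_mem_strings h1, ?_⟩
  rw [weight, Nat.cast_le]
  rw [add_mul, one_mul] at this
  omega

theorem complement_mem_stringsAtLeast {w : ℕ} {s : List ℕ} (h : s ∈ stringsAtMost k n w) :
    complement k s ∈ stringsAtLeast k n ((k * n + n - w : ℕ) : ℤ) := by
  obtain ⟨h1, h2⟩ := Finset.mem_filter.1 h
  obtain ⟨h3, h4⟩ := mem_strings.1 h1
  have := sum_complement h4
  rw [h3] at this
  refine mem_stringsAtLeast.2 ⟨complement_mem_strings h1, ?_⟩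
  rw [weight, Nat.cast_le] at h2
  rw [add_mul, one_mul] at this
  omega

theorem card_stringsAtMost (k n w : ℕ) : (stringsAtMost k n w).card =
    (stringsAtLeast k n ((k * n + n - w : ℕ) : ℤ)).card := by
  refine Finset.card_bij' (fun s _ => complement k s) (fun s _ => complement k s)
    (fun s => complement_mem_stringsAtLeast) (fun s => complement_mem_stringsAtMost)
    (fun s hs => ?_) (fun s hs => ?_)
  · exact complement_complement (mem_strings.1 (Finset.mem_filter.1 hs).1).2
  · exact complement_complement (mem_strings.1 (mem_stringsAtLeast.1 hs).1).2

theorem HasRank.complement {u s : List ℕ} {r : ℕ} (h : HasRank u s r) :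
    HasRank (complement k u) (complement k s) r := by
  obtain ⟨h1, h2, h3⟩ := h
  refine ⟨h1, by simpa [UCycle.complement] using h2, ?_⟩
  conv_rhs => rw [← h3]
  simp only [cyclicSubstring, UCycle.complement, List.length_map, List.map_map]
  refine List.map_congr_left fun j _ => ?_
  have : (r - 1 + j) % u.length < u.length := Nat.mod_lt _ (by omega)
  simp [List.getD_eq_getElem?_getD, this]

theorem mem_cycleAtLeast {V : ℕ} (hn : 0 < n) {x : ℕ} (hx : x ∈ cycleAtLeast k n V) :
    1 ≤ x ∧ x ≤ k := by
  obtain ⟨l, hl, hxl⟩ := List.mem_flatten.1 hx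
  obtain ⟨μ, hμ, rfl⟩ := List.mem_map.1 hl
  have hμ : μ ∈ necks k n V := (Finset.mem_sort (· ≤ ·)).1 hμ
  rw [aperiodicPrefix_eq (ne_nil_of_mem_necks hn hμ)] at hxl
  exact (mem_strings.1 (mem_necks.1 hμ).1.1).2 x (List.mem_of_mem_take hxl)

theorem hasRank_cycleAtMost {w : ℕ} {s : List ℕ} {r : ℕ}
    (h : HasRank (cycleAtLeast k n ((k * n + n - w : ℕ) : ℤ)) s r) :
    HasRank (cycleAtMost k n w) (complement k s) r := by
  rw [cycleAtMost_eq]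
  exact h.complement

theorem isUniversalCycle_cycleAtMost (hn : 0 < n) (hk : 0 < k) (w : ℕ) :
    IsUniversalCycle (cycleAtMost k n w) (stringsAtMost k n w) := by
  obtain ⟨h1, h2⟩ := isUniversalCycle_cycleAtLeast (V := k * n + n - w) hn hk
  refine ⟨by rw [cycleAtMost_eq, card_stringsAtMost, ← h1]; simp [complement], fun s hs => ?_⟩
  have hs' := complement_complement (mem_strings.1 (Finset.mem_filter.1 hs).1).2
  obtain ⟨r, hr, huniq⟩ := h2 _ (complement_mem_stringsAtLeast hs)
  refine ⟨r, by rw [← hs']; exact hasRank_cycleAtMost hr, fun r' hr' => huniq r' ?_⟩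
  rw [cycleAtMost_eq] at hr'
  have := hr'.complement (k := k)
  rwa [complement_complement fun x hx => mem_cycleAtLeast hn hx] at this

end Complement

end UCycle

/-! ### Programs: lexicographic comparison -/

namespace RAM

open RAM.Expr UCycle

infixr:60 " ;; " => Cmd.seq

/-- Do nothing. -/
def Cmd.skip : Cmd := .assign 63 (lit 0)

/-- Bounds on the parameters that let the programs run within the memory cells `0, …, S - 1` and
the numbers `0, …, W`. -/
structure Fits (S W n k V : ℕ) : Prop where
  pos : 0 < n
  size : 2 * n + n * (V + 1) ≤ S
  le : S ≤ W
  mul : k * n + n + 2 * k + 2 ≤ W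
  pow : 2 * k ^ n ≤ W
  alphabet : 0 < k

/-- Compare `M[b + (e + l) mod n]` and `M[b + (e' + l) mod n]` for `l < m` lexicographically, where
`n, b, e, e', m` are the variables `0, 50, 51, 52, 53`. The variable `54` becomes `2`, `1` or `0` if
the first word is smaller, greater, or equal. -/
def compare : Cmd :=
  .assign 54 (lit 0) ;;
  .for 55 (var 53) (
    .ite (var 54) (lit 1)
      (.ite (cell (var 50 + (var 51 + var 55) % var 0)) (cell (var 50 + (var 52 + var 55) % var 0))
        (.assign 54 (lit 2))
        (.ite (cell (var 50 + (var 52 + var 55) % var 0)) (cell (var 50 + (var 51 + var 55) % var 0))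
          (.assign 54 (lit 1))
          .skip))
      .skip)

section
variable {S W n k V : ℕ} {Q : Store → Prop} {σ : Store}

/-- Each `run_…` lemma takes the postcondition as a continuation `hQ` with a frame clause. Inner
routines use variables with larger numbers, so those of the callers survive. Memory holds a word in
`M[0], …, M[n - 1]`, the word to be counted in `M[n], …, M[2 n - 1]`, and the table from `2 n` on.
-/
theorem run_compare (hp : Fits S W n k V) {b e e' m : ℕ} (h0 : σ.reg 0 = n) (hb : σ.reg 50 = b)
    (he : σ.reg 51 = e) (he' : σ.reg 52 = e') (hm : σ.reg 53 = m) (hbn : b ≤ n) (hen : e ≤ n)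
    (hen' : e' ≤ n) (hmn : m ≤ n)
    (hQ : ∀ τ, (∀ r < 50, τ.reg r = σ.reg r) → τ.mem = σ.mem →
      (1 < τ.reg 54 ↔ LexLt m (fun l => σ.mem (b + (e + l) % n)) fun l => σ.mem (b + (e' + l) % n)) →
      τ.clk ≤ σ.clk + 100 * (m + 1) → Q τ) : Run S W compare Q σ := by
  obtain ⟨hn, hS, hSW, -, -⟩ := hp
  have hnV : 0 < n * (V + 1) := Nat.mul_pos hn (by omega)
  set A : ℕ → ℕ := fun l => σ.mem (b + (e + l) % n) with hA
  set B : ℕ → ℕ := fun l => σ.mem (b + (e' + l) % n) with hB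
  rw [compare, run_seq, run_assign]
  refine ⟨⟨by omega, by simp⟩, Run.for m (fun i r M => (∀ x < 54, r x = σ.reg x) ∧ M = σ.mem ∧
    (r 54 = 0 ∧ (∀ l < i, A l = B l) ∨ r 54 = 1 ∧ (∃ t < i, (∀ l < t, A l = B l) ∧ B t < A t) ∨
      r 54 = 2 ∧ (∃ t < i, (∀ l < t, A l = B l) ∧ A t < B t))) 86 (by omega) (by omega) (by omega)
      ?_ ?_ ?_ ?_⟩
  · refine ⟨fun x hx => ?_, rfl, .inl ⟨by simp, by simp⟩⟩
    simp [show x ≠ 54 by omega, show x ≠ 55 by omega]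
  · rintro i hi ρ ⟨h1, -⟩ -
    simp [h1, hm]
  · rintro i hi ρ ⟨h1, h2, h3⟩ h4
    have d1 := Nat.div_mul_le_self (e + i) n
    have d2 := Nat.div_mul_le_self (e' + i) n
    have m1 := Nat.mod_lt (e + i) hn
    have m2 := Nat.mod_lt (e' + i) hn
    simp [Cmd.skip, h1, h2, h4, h0, hb, he, he']
    have hbi : ρ.reg 54 = 0 → ∀ l < i, A l = B l := fun h => by
      rcases h3 with ⟨-, h3⟩ | ⟨h3, -⟩ | ⟨h3, -⟩
      · exact h3
      · omega
      · omega
    have hfr : ∀ c v : ℕ, c = 54 ∨ c = 63 → ∀ x < 54,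
        (if x = 55 then i + 1 else if x = c then v else ρ.reg x) = σ.reg x := fun c v hc x hx => by
      rw [if_neg (by omega), if_neg (by omega), h1 x hx]
    refine ⟨by omega, fun h => ⟨⟨by omega, by omega⟩, fun hlt => ⟨by omega, hfr _ _ (by simp), ?_⟩,
      fun hle => ⟨⟨by omega, by omega⟩, fun hlt => ⟨by omega, hfr _ _ (by simp), ?_⟩,
      fun hge => ⟨hfr _ _ (by simp), .inl ⟨h, fun l hl => ?_⟩⟩⟩⟩, fun h => ⟨hfr _ _ (by simp), ?_⟩⟩
    · exact ⟨i, le_rfl, hbi h, hlt⟩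
    · exact ⟨i, le_rfl, hbi h, hlt⟩
    · rcases hl.lt_or_eq with hl | rfl
      · exact hbi h l hl
      · exact le_antisymm hge hle
    · rcases h3 with ⟨h3, -⟩ | ⟨h3, t, ht, h5⟩ | ⟨h3, t, ht, h5⟩
      · exact absurd h3 h
      · exact .inr (.inl ⟨h3, t, ht.le, h5⟩)
      · exact .inr (.inr ⟨h3, t, ht.le, h5⟩)
  · rintro ρ ⟨h1, h2, h3⟩ - hk
    refine hQ ρ (fun r hr => h1 r (by omega)) h2 ?_ ?_
    · rcases h3 with ⟨h3, h4⟩ | ⟨h3, t, ht, h4, h5⟩ | ⟨h3, t, ht, h4, h5⟩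
      · simp only [h3]
        refine ⟨by omega, fun ⟨i, hi, _, h6⟩ => ?_⟩
        have := h4 i hi
        omega
      · simp only [h3]
        refine ⟨by omega, fun ⟨i, hi, h6, h7⟩ => ?_⟩
        rcases lt_trichotomy t i with h | rfl | h
        · have := h6 t h; omega
        · omega
        · have := h4 i h; omega
      · simp only [h3]
        exact ⟨fun _ => ⟨t, ht, h4, h5⟩, fun _ => by omega⟩
    · simp at hk; omega

end

end RAM

/-! ### Programs: passage to a prenecklace -/

namespace RAM
open RAM.Expr UCycle

/-- Test whether `M[n], …, M[2 n - 1]` is a prenecklace; the answer, `1` or `0`, is the variable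
`45`. -/
def testPrenecklace : Cmd :=
  .assign 45 (lit 1) ;;
  .for 46 (var 0) (
    .assign 50 (var 0) ;; .assign 51 (var 46) ;; .assign 52 (lit 0) ;;
    .assign 53 (var 0 - var 46) ;; compare ;;
    .ite (lit 1) (var 54) (.assign 45 (lit 0)) .skip)

/-- Replace `M[n], …, M[2 n - 1]` by a prenecklace that is exceeded by the same rotations. -/
def floor : Cmd :=
  .for 44 (var 0) (
    testPrenecklace ;;
    .ite (var 45) (lit 1)
      (.put (var 0 + (var 0 - lit 1 - var 44)) (var 1) ;;
       .put (var 0 + (var 0 - lit 2 - var 44)) (cell (var 0 + (var 0 - lit 2 - var 44)) - lit 1))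
      .skip)

section
variable {S W n k V : ℕ} {Q : Store → Prop} {σ : Store}

/-- A word is a prenecklace if and only if no suffix is smaller than the prefix of the same length;
this takes `n` comparisons of `O(n)` steps. -/
theorem run_testPrenecklace (hp : Fits S W n k V) (h0 : σ.reg 0 = n)
    (hQ : ∀ τ, (∀ r < 45, τ.reg r = σ.reg r) → τ.mem = σ.mem →
      (τ.reg 45 = 0 ↔ ¬ IsPrenecklace n fun l => σ.mem (n + l)) →
      τ.clk ≤ σ.clk + 500 * (n * n) → Q τ) : Run S W testPrenecklace Q σ := by
  obtain ⟨hn, hS, hSW, -, -⟩ := id hp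
  have hnV : 0 < n * (V + 1) := Nat.mul_pos hn (by omega)
  set z : ℕ → ℕ := fun l => σ.mem (n + l) with hz
  rw [testPrenecklace, run_seq, run_assign]
  refine ⟨⟨by omega, by simp; omega⟩, Run.for n (fun i r M => (∀ x < 45, r x = σ.reg x) ∧ M = σ.mem ∧
    (r 45 = 1 ∧ (∀ d < i, ¬ LexLt (n - d) (fun l => z (d + l)) z) ∨
      r 45 = 0 ∧ ∃ d < n, LexLt (n - d) (fun l => z (d + l)) z)) (100 * (n + 1) + 50) (by omega)
      (by omega) (by omega) ?_ ?_ ?_ ?_⟩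
  · refine ⟨fun x hx => ?_, rfl, .inl ⟨by simp, by simp⟩⟩
    simp [show x ≠ 45 by omega, show x ≠ 46 by omega]
  · rintro i hi ρ ⟨h1, -⟩ -
    simp [h1, h0]
  · rintro i hi ρ ⟨h1, h2, h3⟩ h4
    simp only [run_seq]
    simp [h1, h0, h4]
    refine run_compare hp (b := n) (e := i) (e' := 0) (m := n - i) (by simp [h1, h0]) (by simp)
      (by simp) (by simp) (by simp) le_rfl (by omega) (by omega) (by omega) ?_
    intro τ t1 t2 t3 t4
    have e1 : LexLt (n - i) (fun l => z (i + l)) z ↔ 1 < τ.reg 54 := by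
      rw [t3]
      constructor
      · refine fun h => h.congr (fun l hl => ?_) (fun l hl => ?_)
        · simp [hz, h2, Nat.mod_eq_of_lt (show i + l < n by omega)]
        · simp [hz, h2, Nat.mod_eq_of_lt (show l < n by omega)]
      · refine fun h => h.congr (fun l hl => ?_) (fun l hl => ?_)
        · simp [hz, h2, Nat.mod_eq_of_lt (show i + l < n by omega)]
        · simp [hz, h2, Nat.mod_eq_of_lt (show l < n by omega)]
    have f1 : ∀ x < 46, τ.reg x = ρ.reg x := fun x hx => by
      rw [t1 x (by omega)]
      simp [show x ≠ 50 by omega, show x ≠ 51 by omega, show x ≠ 52 by omega, show x ≠ 53 by omega]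
    have f2 : τ.reg 46 = i := by rw [t1 46 (by omega)]; simp [h4]
    have hfr : ∀ c v : ℕ, c = 45 ∨ c = 63 → ∀ x < 45,
        (if x = 46 then i + 1 else if x = c then v else τ.reg x) = σ.reg x := fun c v hc x hx => by
      rw [if_neg (by omega), if_neg (by omega), f1 x (by omega), h1 x hx]
    simp at t2 t4
    simp [Cmd.skip, f2, t2, h2]
    refine ⟨by omega, fun h => ⟨by omega, hfr _ _ (by simp), i, hi, e1.2 h⟩, fun h =>
      ⟨by omega, hfr _ _ (by simp), ?_⟩⟩
    rw [f1 45 (by omega)]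
    rcases h3 with ⟨h3, h5⟩ | h3
    · refine .inl ⟨h3, fun d hd => ?_⟩
      rcases hd.lt_or_eq with hd | rfl
      · exact h5 d hd
      · rw [e1]; omega
    · exact .inr h3
  · rintro ρ ⟨h1, h2, h3⟩ - hk
    have hpre : IsPrenecklace n z ↔ ∀ d < n, ¬ LexLt (n - d) (fun l => z (d + l)) z := by
      constructor
      · rintro h d hd ⟨i, hi, h5, h6⟩
        exact absurd (h d i (by omega) fun l hl => (h5 l hl).symm) (not_le.2 h6)
      · intro h d i hi h5
        by_contra h6
        exact h d (by omega) ⟨i, by omega, fun l hl => (h5 l hl).symm, not_le.1 h6⟩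
    refine hQ ρ h1 h2 ?_ (hk.trans ?_)
    · rw [hpre]
      rcases h3 with ⟨h3, h5⟩ | ⟨h3, h5⟩
      · simp only [h3]
        exact ⟨by omega, fun h => absurd h5 h⟩
      · simp only [h3, true_iff]
        push Not
        exact h5
    · simp
      nlinarith

/-- The word is treated from its end. Before iteration `i` either it is a prenecklace already, or
its last `i` symbols are `k`, and then `aboveCount_decrease` applies with `t = n - 1 - i`. There are
`n` tests of `O(n²)` steps. -/
theorem run_floor (hp : Fits S W n k V) (h0 : σ.reg 0 = n) (h1 : σ.reg 1 = k)
    (hk : ∀ l < n, σ.mem (n + l) ≤ k)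
    (hQ : ∀ τ, (∀ r < 44, τ.reg r = σ.reg r) → (∀ a, a < n ∨ 2 * n ≤ a → τ.mem a = σ.mem a) →
      IsPrenecklace n (fun l => τ.mem (n + l)) → (∀ l < n, τ.mem (n + l) ≤ k) →
      (∀ x, aboveCount k n x (fun l => τ.mem (n + l)) = aboveCount k n x fun l => σ.mem (n + l)) →
      τ.clk ≤ σ.clk + 600 * n ^ 3 → Q τ) : Run S W floor Q σ := by
  obtain ⟨hn, hS, hSW, hkW, -⟩ := id hp
  have hnV : 0 < n * (V + 1) := Nat.mul_pos hn (by omega)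
  rw [floor]
  refine Run.for n (fun i r M => (∀ x < 44, r x = σ.reg x) ∧
    (∀ a, a < n ∨ 2 * n ≤ a → M a = σ.mem a) ∧
    (IsPrenecklace n (fun l => M (n + l)) ∨ ∀ l < n, n ≤ l + i → M (n + l) = k) ∧
    (∀ l < n, M (n + l) ≤ k) ∧
    ∀ x, aboveCount k n x (fun l => M (n + l)) = aboveCount k n x fun l => σ.mem (n + l))
    (500 * (n * n) + 50) (by omega) (by omega) (by omega) ?_ ?_ ?_ ?_
  · refine ⟨fun x hx => ?_, fun _ _ => rfl, .inr fun l hl hl' => by omega, hk, fun _ => rfl⟩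
    simp [show x ≠ 44 by omega]
  · rintro i hi ρ ⟨h2, -⟩ -
    simp [h2, h0]
  · rintro i hi ρ ⟨h2, h3, h4, h5, h6⟩ h7
    rw [run_seq]
    refine run_testPrenecklace hp (by simp [h2, h0]) fun τ t1 t2 t3 t4 => ?_
    have hfr : ∀ v : ℕ, ∀ x < 44,
        (if x = 44 then i + 1 else if x = 63 then v else τ.reg x) = σ.reg x := fun v x hx => by
      rw [if_neg (by omega), if_neg (by omega), t1 x (by omega), h2 x hx]
    have hfr' : ∀ x < 44, (if x = 44 then i + 1 else τ.reg x) = σ.reg x := fun x hx => by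
      rw [if_neg (by omega), t1 x (by omega), h2 x hx]
    have f0 : τ.reg 0 = n := by rw [t1 0 (by omega), h2 0 (by omega), h0]
    have f1 : τ.reg 1 = k := by rw [t1 1 (by omega), h2 1 (by omega), h1]
    have f44 : τ.reg 44 = i := by rw [t1 44 (by omega), h7]
    simp [Cmd.skip, f0, f1, f44, t2]
    refine ⟨by omega, fun h => ?_, fun h => ⟨by omega, hfr _, h3, .inl ?_, h5, h6⟩⟩
    · have hnp := t3.1 h
      have htail := h4.resolve_left hnp
      -- A predecessor to be lowered exists: in the last iteration all symbols but the first are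
      -- `k`.
      have hi1 : i + 1 < n := by
        by_contra hge
        exact hnp (isPrenecklace_of_tail (fun l hl hln => htail l hln (by omega)) h5)
      have e3 : ¬ n - 2 - i = n - 1 - i := by omega
      simp only [e3, if_false]
      refine ⟨⟨by omega, by omega⟩, ⟨⟨by omega, by omega⟩, by omega⟩, by omega,
        hfr', fun a ha => ?_, .inr fun l hl hl' => ?_, fun l hl => ?_, fun x => ?_⟩
      · rw [if_neg (by omega), if_neg (by omega), h3 a ha]
      · split_ifs with h8 h9
        · omega
        · rfl
        · exact htail l hl (by omega)
      · split_ifs with h8 h9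
        · have := h5 (n - 2 - i) (by omega); omega
        · omega
        · exact h5 l hl
      · rw [← h6]
        refine aboveCount_decrease (t := n - 1 - i) (by omega) (by omega)
          (fun l hl hln => htail l hln (by omega)) h5 hnp (fun l hl => ?_) ?_ (fun l hl hln => ?_) x
        · simp only [if_neg (show ¬ l = n - 2 - i by omega), if_neg (show ¬ l = n - 1 - i by omega)]
        · simp only [show n - 1 - i - 1 = n - 2 - i by omega, if_true]
        · split_ifs with h8 h9
          · omega
          · rfl
          · exact htail l hln (by omega)
    · rw [t3, not_not] at h
      exact h
  · rintro ρ ⟨h2, h3, h4, h5, h6⟩ - hc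
    refine hQ ρ h2 h3 (h4.elim id fun h => isPrenecklace_of_tail (fun l _ hl => h l hl (by omega)) h5)
      h5 h6 (hc.trans ?_)
    simp
    have : n ≤ n ^ 3 := Nat.le_self_pow (by omega) n
    have e : n * (n * n) = n ^ 3 := by ring
    nlinarith

end

end RAM

/-! ### Programs: the table and the count -/

namespace RAM
open RAM.Expr UCycle

/-- Add the part of `blockSum` that belongs to the value of the variable `53` to the variable `50`;
the variables `51` and `52` hold the weight of the prefix and the value of `live`. -/
def sumRow : Cmd :=
  .for 54 (var 1 - cell (var 0 + var 53)) (
    .assign 50 (var 50 + (lit 1 + var 42 * var 53) * var 52 *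
      cell (var 0 + var 0 + (var 40 - lit 1 - var 53) * (var 4 + lit 1) +
        (var 41 - var 51 - (cell (var 0 + var 53) + lit 1 + var 54)))))

/-- The sum `blockSum` for `M[n], …, M[2 n - 1]` and the table that starts at `2 n` with rows of
length `V + 1`, where `n, k, V, m, x, f` are the variables `0, 1, 4, 40, 41, 42`. The result is the
variable `50`. -/
def sumBlocks : Cmd :=
  .assign 50 (lit 0) ;; .assign 51 (lit 0) ;; .assign 52 (lit 1) ;;
  .for 53 (var 40) (sumRow ;;
    .assign 51 (var 51 + cell (var 0 + var 53)) ;;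
    .ite (cell (var 0 + var 53)) (lit 1) (.assign 52 (lit 0)) .skip)

/-- Fill the table of the numbers `resetCount`. -/
def fillTable : Cmd :=
  .for 40 (var 0) (.for 41 (var 4 + lit 1) (
    .assign 42 (lit 0) ;; sumBlocks ;;
    .ite (var 40 + var 41) (lit 1) (.assign 50 (var 50 + lit 1)) .skip ;;
    .put (var 0 + var 0 + var 40 * (var 4 + lit 1) + var 41) (var 50)))

/-- Compute `aboveCount` for `M[n], …, M[2 n - 1]` in the variable `50`. -/
def count : Cmd :=
  floor ;; fillTable ;;
  .assign 40 (var 0) ;; .assign 41 (var 4) ;; .assign 42 (lit 1) ;; sumBlocks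

section
variable {S W n k V : ℕ} {Q : Store → Prop} {σ : Store}

theorem table_index_lt {m j y V : ℕ} (hj : j < m) (hy : y ≤ V) :
    j * (V + 1) + y < m * (V + 1) := by
  obtain ⟨d, rfl⟩ := Nat.exists_eq_add_of_lt hj
  nlinarith [Nat.zero_le (d * (V + 1))]

theorem run_sumRow (hp : Fits S W n k V) {U : ℕ → ℕ} {m x f j b p lv A : ℕ}
    (h0 : σ.reg 0 = n) (h1 : σ.reg 1 = k) (h4 : σ.reg 4 = V) (hm : σ.reg 40 = m)
    (hx : σ.reg 41 = x) (hf : σ.reg 42 = f) (hA : σ.reg 50 = A) (hpre : σ.reg 51 = p)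
    (hlv : σ.reg 52 = lv) (hj : σ.reg 53 = j) (hmn : m ≤ n) (hxV : x ≤ V) (hf1 : f ≤ 1)
    (hjm : j < m) (hlv1 : lv ≤ 1) (hb : σ.mem (n + j) = b) (hbk : b ≤ k)
    (hU : ∀ y ≤ V, σ.mem (n + n + (m - 1 - j) * (V + 1) + y) = U y)
    (hW : A + (1 + f * j) * lv * ∑ c ∈ Finset.range (k - b), U (x - p - (b + 1 + c)) ≤ W)
    (hQ : ∀ τ, (∀ r < 50, τ.reg r = σ.reg r) → τ.mem = σ.mem →
      τ.reg 50 = A + (1 + f * j) * lv * ∑ c ∈ Finset.range (k - b), U (x - p - (b + 1 + c)) →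
      τ.reg 51 = p → τ.reg 52 = lv → τ.reg 53 = j →
      τ.clk ≤ σ.clk + 80 * (k + 1) → Q τ) : Run S W sumRow Q σ := by
  obtain ⟨hn, hS, hSW, hkW, -⟩ := hp
  have hnV : V + 1 ≤ n * (V + 1) := Nat.le_mul_of_pos_left _ hn
  have hfj : f * j ≤ n := by
    refine (Nat.mul_le_mul_right j hf1).trans ?_
    omega
  have hcoef : (1 + f * j) * lv ≤ 1 + n := by
    refine (Nat.mul_le_mul_left _ hlv1).trans ?_
    omega
  -- The terms are nonnegative, so a bound for the final sum bounds every intermediate number.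
  have hpart : ∀ c ≤ k - b, A + (1 + f * j) * lv * ∑ c ∈ Finset.range c, U (x - p - (b + 1 + c)) ≤ W :=
    fun c hc => le_trans (Nat.add_le_add_left (Nat.mul_le_mul_left _
      (Finset.sum_le_sum_of_subset (Finset.range_mono hc))) _) hW
  rw [sumRow]
  refine Run.for (k - b) (fun c r M => (∀ x < 50, r x = σ.reg x) ∧ M = σ.mem ∧
      r 50 = A + (1 + f * j) * lv * ∑ c ∈ Finset.range c, U (x - p - (b + 1 + c)) ∧
      r 51 = p ∧ r 52 = lv ∧ r 53 = j) 50
      (by omega) (by omega) (by omega) ?_ ?_ ?_ ?_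
  · refine ⟨fun x hx => ?_, rfl, by simp [hA], by simp [hpre], by simp [hlv], by simp [hj]⟩
    simp [show x ≠ 54 by omega]
  · rintro c hc ρ ⟨g1, g2, -, -, -, g3⟩ -
    simp [g1, g2, g3, h0, h1, hb]
    omega
  · rintro c hc ρ ⟨g1, g2, g3, g4, g5, g6⟩ g7
    have hidx := table_index_lt (show m - 1 - j < n by omega)
      (show x - p - (b + 1 + c) ≤ V by omega)
    have hacc := hpart (c + 1) (by omega)
    rw [Finset.sum_range_succ, mul_add, ← add_assoc] at hacc
    have hUi := hU (x - p - (b + 1 + c)) (by omega)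
    simp [g1, g2, g3, g4, g5, g6, g7, h0, h4, hm, hx, hf, hb, hUi]
    refine ⟨by omega, fun x hx => ?_, ?_⟩
    · rw [if_neg (by omega), if_neg (by omega), g1 x hx]
    · rw [Finset.sum_range_succ, mul_add, ← add_assoc]
  · rintro ρ ⟨g1, g2, g3, g4, g5, g6⟩ - hk
    refine hQ ρ g1 g2 g3 g4 g5 g6 (hk.trans ?_)
    simp
    have : (k - b) * 62 ≤ k * 62 := Nat.mul_le_mul_right _ (Nat.sub_le _ _)
    omega

theorem run_sumBlocks (hp : Fits S W n k V) {a : ℕ → ℕ} {T : ℕ → ℕ → ℕ} {m x f : ℕ}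
    (h0 : σ.reg 0 = n) (h1 : σ.reg 1 = k) (h4 : σ.reg 4 = V) (hm : σ.reg 40 = m)
    (hx : σ.reg 41 = x) (hf : σ.reg 42 = f) (hmn : m ≤ n) (hxV : x ≤ V) (hf1 : f ≤ 1)
    (ha : ∀ l < n, σ.mem (n + l) = a l) (hak : ∀ l < n, a l ≤ k)
    (hT : ∀ j < m, ∀ y ≤ V, σ.mem (2 * n + j * (V + 1) + y) = T j y)
    (hW : blockSum T a k f m x ≤ W)
    (hQ : ∀ τ, (∀ r < 50, τ.reg r = σ.reg r) → τ.mem = σ.mem →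
      τ.reg 50 = blockSum T a k f m x → τ.clk ≤ σ.clk + 120 * (m * (k + 1) + 1) → Q τ) :
    Run S W sumBlocks Q σ := by
  obtain ⟨hn, hS, hSW, hkW, -⟩ := id hp
  have hnV : 0 < n * (V + 1) := Nat.mul_pos hn (by omega)
  have hpre : ∀ j ≤ n, ∑ l ∈ Finset.range j, a l ≤ k * n := fun j hj => by
    refine (Finset.sum_le_card_nsmul _ _ k fun l hl => hak l ?_).trans ?_
    · rw [Finset.mem_range] at hl; omega
    · rw [Finset.card_range, smul_eq_mul, mul_comm]; exact Nat.mul_le_mul_left _ hj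
  have hlive : ∀ j, live a j ≤ 1 := fun j => Finset.prod_le_one (by simp) fun l _ => by
    split_ifs <;> simp
  have hpart : ∀ j ≤ m, ∑ i ∈ Finset.range j, (1 + f * i) * blockTerm T a k m x i ≤ W := fun j hj =>
    (Finset.sum_le_sum_of_subset (Finset.range_mono hj)).trans hW
  rw [sumBlocks]
  simp only [run_seq]
  simp
  refine ⟨by omega, Run.for m (fun i r M => (∀ x < 50, r x = σ.reg x) ∧ M = σ.mem ∧
    r 50 = ∑ j ∈ Finset.range i, (1 + f * j) * blockTerm T a k m x j ∧
    r 51 = ∑ l ∈ Finset.range i, a l ∧ r 52 = live a i) (80 * k + 100)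
      (by omega) (by omega) (by omega) ?_ ?_ ?_ ?_⟩
  · refine ⟨fun x hx => ?_, rfl, by simp, by simp, by simp [live]⟩
    simp [show x ≠ 50 by omega, show x ≠ 51 by omega, show x ≠ 52 by omega, show x ≠ 53 by omega]
  · rintro i hi ρ ⟨h2, -⟩ -
    simp [h2, hm]
  · rintro i hi ρ ⟨h2, h3, h5, h6, h7⟩ h8
    rw [run_seq]
    have hai := hak i (by omega)
    have hnext := hpart (i + 1) hi
    rw [Finset.sum_range_succ, blockTerm, ← mul_assoc] at hnext
    have hp1 := hpre (i + 1) (by omega)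
    rw [Finset.sum_range_succ] at hp1
    refine run_sumRow hp (U := T (m - 1 - i)) (by simp [h2, h0]) (by simp [h2, h1])
      (by simp [h2, h4]) (by simp [h2, hm]) (by simp [h2, hx]) (by simp [h2, hf]) h5 h6 h7 h8 hmn hxV
      hf1 hi (hlive i) (by rw [h3, ha i (by omega)]) hai
      (fun y hy => by rw [h3, ← two_mul]; exact hT _ (by omega) y hy) hnext ?_
    intro τ g1 g2 g3 g4 g5 g6 g7
    have hfr : ∀ c v : ℕ, c = 52 ∨ c = 63 → ∀ x < 50,
        (if x = 53 then i + 1 else if x = c then v else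
          if x = 51 then ∑ l ∈ Finset.range i, a l + a i else τ.reg x) = σ.reg x := fun c v hc x hx => by
      rw [if_neg (by omega), if_neg (by omega), if_neg (by omega), g1 x hx, h2 x hx]
    simp [Cmd.skip, g1, g2, g3, g4, g5, g6, h2, h3, h0, ha i (by omega)]
    rw [Finset.sum_range_succ, Finset.sum_range_succ, blockTerm, ← mul_assoc]
    have hl : live a (i + 1) = live a i * if a i = 0 then 0 else 1 := by
      rw [live, live, Finset.prod_range_succ]
    refine ⟨by omega, by omega, fun h => ⟨by omega, hfr _ _ (by simp), rfl, rfl, by simp [hl, h]⟩,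
      fun h => ⟨by omega, hfr _ _ (by simp), rfl, rfl, by simp [hl, h]⟩⟩
  · rintro ρ ⟨h2, h3, h5, h6, h7⟩ - hk
    refine hQ ρ h2 h3 h5 (hk.trans ?_)
    simp
    nlinarith

end

end RAM

namespace UCycle

theorem card_strings (k n : ℕ) : (strings k n).card = k ^ n := by
  rw [strings, Finset.card_image_of_injective _ List.ofFn_injective]
  simp

theorem resetCount_le (k n : ℕ) (a : ℕ → ℕ) (j m x : ℕ) : resetCount k n a j m x ≤ k ^ m :=
  (Finset.card_filter_le _ _).trans (card_strings k m).le

theorem aboveCount_le (k n x : ℕ) (a : ℕ → ℕ) : aboveCount k n x a ≤ k ^ n := by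
  classical
  exact (Finset.card_filter_le _ _).trans (card_strings k n).le

end UCycle

namespace RAM
open RAM.Expr UCycle

section
variable {S W n k V : ℕ} {Q : Store → Prop} {σ : Store}

theorem table_index_ne {m m' y y' V : ℕ} (hy : y ≤ V) (hy' : y' ≤ V) (h : m ≠ m' ∨ y ≠ y') :
    m * (V + 1) + y ≠ m' * (V + 1) + y' := by
  intro e
  have h1 : (m * (V + 1) + y) / (V + 1) = m := by
    rw [add_comm, Nat.add_mul_div_right _ _ (by omega), Nat.div_eq_of_lt (by omega), zero_add]
  have h2 : (m' * (V + 1) + y') / (V + 1) = m' := by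
    rw [add_comm, Nat.add_mul_div_right _ _ (by omega), Nat.div_eq_of_lt (by omega), zero_add]
  have : m = m' := by rw [← h1, ← h2, e]
  subst this
  omega

/-- The table is filled up to the entry of row `i` and column `x`. -/
def TableUpTo (n k V : ℕ) (a : ℕ → ℕ) (i x : ℕ) (M : ℕ → ℕ) : Prop :=
  ∀ j y, y ≤ V → j < i ∨ j = i ∧ y < x → M (2 * n + j * (V + 1) + y) = resetCount k n a 0 j y

/-- Row `i` depends only on earlier rows and consists of `V + 1` block sums of `O(n k)` steps. Its
entries count strings of length `i`, hence they fit into a word. -/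
theorem run_fillRow (hp : Fits S W n k V) {a : ℕ → ℕ} {i : ℕ} (hi : i < n)
    (h0 : σ.reg 0 = n) (h1 : σ.reg 1 = k) (h4 : σ.reg 4 = V) (hm : σ.reg 40 = i)
    (ha : ∀ l < n, σ.mem (n + l) = a l) (hak : ∀ l < n, a l ≤ k)
    (hT : TableUpTo n k V a i 0 σ.mem)
    (hQ : ∀ τ, (∀ r < 41, τ.reg r = σ.reg r) → (∀ b < 2 * n, τ.mem b = σ.mem b) →
      TableUpTo n k V a (i + 1) 0 τ.mem →
      τ.clk ≤ σ.clk + 500 * ((V + 1) * (n * k)) → Q τ) :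
    Run S W (.for 41 (var 4 + lit 1) (
      .assign 42 (lit 0) ;; sumBlocks ;;
      .ite (var 40 + var 41) (lit 1) (.assign 50 (var 50 + lit 1)) .skip ;;
      .put (var 0 + var 0 + var 40 * (var 4 + lit 1) + var 41) (var 50))) Q σ := by
  obtain ⟨hn, hS, hSW, hkW, hpow, hk⟩ := id hp
  have hnV : V + 1 ≤ n * (V + 1) := Nat.le_mul_of_pos_left _ hn
  have hiV := table_index_lt hi (le_refl V)
  have hle : ∀ x, resetCount k n a 0 i x ≤ W := fun x => by
    have := (resetCount_le k n a 0 i x).trans (Nat.pow_le_pow_right hk hi.le)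
    omega
  refine Run.for (V + 1) (fun x r M => (∀ y < 41, r y = σ.reg y) ∧
    (∀ b < 2 * n, M b = σ.mem b) ∧ TableUpTo n k V a i x M) (120 * (n * (k + 1) + 1) + 50) (by omega)
      (by omega) (by omega) ?_ ?_ ?_ ?_
  · refine ⟨fun x hx => ?_, fun _ _ => rfl, hT⟩
    simp [show x ≠ 41 by omega]
  · rintro x hx ρ ⟨h2, -⟩ -
    simp [h2, h4]
    omega
  · rintro x hx ρ ⟨h2, h3, h5⟩ h6
    have hrec := resetCount_recurrence hak hi.le x
    have hle' := hle x
    simp only [run_seq, run_assign]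
    refine ⟨by simp, run_sumBlocks hp (a := a) (T := resetCount k n a 0) (m := i) (x := x) (f := 0)
      (by simp [h2, h0])
      (by simp [h2, h1]) (by simp [h2, h4]) (by simp [h2, hm]) (by simp [h6]) (by simp)
      hi.le (by omega) (by omega) (fun l hl => ?_) hak (fun j hj y hy => ?_) (by omega) ?_⟩
    · simp [h3 (n + l) (by omega), ha l hl]
    · exact h5 j y hy (.inl hj)
    intro τ g1 g2 g3 g4
    have hi' : i * (k + 1) ≤ n * (k + 1) := Nat.mul_le_mul_right _ hi.le
    have f1 : ∀ y < 41, τ.reg y = σ.reg y := fun y hy => by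
      rw [g1 y (by omega)]; simp [show y ≠ 42 by omega, h2 y hy]
    have f41 : τ.reg 41 = x := by rw [g1 41 (by omega)]; simp [h6]
    have hix := table_index_lt hi (show x ≤ V by omega)
    have hfr : ∀ c v, 41 < c → ∀ y < 41, (if y = 41 then x + 1 else if y = c then v else τ.reg y) = σ.reg y :=
      fun c v hc y hy => by rw [if_neg (by omega), if_neg (by omega), f1 y hy]
    have hmem : ∀ v, ∀ b < 2 * n,
        (if b = n + n + i * (V + 1) + x then v else τ.mem b) = σ.mem b := fun v b hb => by
      rw [if_neg (by omega), g2]; exact h3 b hb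
    have htab : ∀ v, v = resetCount k n a 0 i x → ∀ M : ℕ → ℕ,
        (∀ b, M b = if b = n + n + i * (V + 1) + x then v else τ.mem b) →
        TableUpTo n k V a i (x + 1) M := fun v hv M hM j y hy hjy => by
      rw [hM]
      by_cases hjx : j = i ∧ y = x
      · rw [if_pos (by rw [hjx.1, hjx.2]; omega), hv, hjx.1, hjx.2]
      · have := table_index_ne (m := j) (m' := i) hy (show x ≤ V by omega) (by omega)
        rw [if_neg (by omega), g2]
        exact h5 j y hy (by omega)
    simp at g4
    simp [Cmd.skip, f1, f41, g3, h0, h4, hm]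
    refine ⟨by omega, fun hi0 hx0 => ?_, fun hne => ?_⟩
    · rw [if_pos ⟨hi0, hx0⟩] at hrec
      exact ⟨by omega, by omega, by omega, hfr _ _ (by simp), hmem _, htab _ (by rw [hrec, add_comm]) _ fun b => by simp only [Store.put_mem, Store.tick_mem, Store.set_mem]⟩
    · rw [if_neg (by tauto), zero_add] at hrec
      exact ⟨by omega, by omega, hfr _ _ (by simp), hmem _, htab _ (hrec.symm) _ fun b => by simp only [Store.put_mem, Store.tick_mem, Store.set_mem]⟩
  · rintro ρ ⟨h2, h3, h5⟩ - hc
    refine hQ ρ h2 h3 (fun j y hy hj => h5 j y hy (by omega)) (hc.trans ?_)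
    have e : n * (k + 1) ≤ 2 * (n * k) := by nlinarith
    have e2 : 1 ≤ n * k := Nat.mul_pos hn hk
    simp
    generalize n * k = p at *
    generalize n * (k + 1) = q at *
    nlinarith [Nat.mul_le_mul_left (V + 1) e, Nat.mul_le_mul_left (V + 1) e2]

theorem run_fillTable (hp : Fits S W n k V) {a : ℕ → ℕ}
    (h0 : σ.reg 0 = n) (h1 : σ.reg 1 = k) (h4 : σ.reg 4 = V)
    (ha : ∀ l < n, σ.mem (n + l) = a l) (hak : ∀ l < n, a l ≤ k)
    (hQ : ∀ τ, (∀ r < 40, τ.reg r = σ.reg r) → (∀ b < 2 * n, τ.mem b = σ.mem b) →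
      TableUpTo n k V a n 0 τ.mem →
      τ.clk ≤ σ.clk + 520 * (n * ((V + 1) * (n * k))) → Q τ) :
    Run S W fillTable Q σ := by
  obtain ⟨hn, hS, hSW, hkW, -, hk⟩ := id hp
  have hnV : V + 1 ≤ n * (V + 1) := Nat.le_mul_of_pos_left _ hn
  have hp1 : 1 ≤ (V + 1) * (n * k) := Nat.mul_pos (by omega) (Nat.mul_pos hn hk)
  refine Run.for n (fun i r M => (∀ y < 40, r y = σ.reg y) ∧
    (∀ b < 2 * n, M b = σ.mem b) ∧ TableUpTo n k V a i 0 M) (500 * ((V + 1) * (n * k))) (by omega)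
      (by omega) (by omega) ?_ ?_ ?_ ?_
  · refine ⟨fun x hx => ?_, fun _ _ => rfl, fun j y _ hj => by omega⟩
    simp [show x ≠ 40 by omega]
  · rintro x hx ρ ⟨h2, -⟩ -
    simp [h2, h0]
  · rintro i hi ρ ⟨h2, h3, h5⟩ h6
    refine run_fillRow hp hi (by simp [h2, h0]) (by simp [h2, h1]) (by simp [h2, h4]) h6
      (fun l hl => by rw [h3 _ (by omega), ha l hl]) hak h5 ?_
    intro τ g1 g2 g3 g4
    refine ⟨g4, by rw [g1 40 (by omega), h6], fun y hy => ?_, fun b hb => by rw [g2 b hb, h3 b hb], g3⟩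
    rw [Store.set_reg, if_neg (by omega), g1 y (by omega), h2 y hy]
  · rintro ρ ⟨h2, h3, h5⟩ - hc
    refine hQ ρ h2 h3 h5 (hc.trans ?_)
    simp
    generalize (V + 1) * (n * k) = p at *
    nlinarith

/-- `O(n³)` steps for the passage to a prenecklace, `n (V + 1)` table entries at `O(n k)` each, and
one final sum with weights `1 + j`. Replacing the word does not affect the count. -/
theorem run_count (hp : Fits S W n k V) (hV : V ≤ k * n + n)
    (h0 : σ.reg 0 = n) (h1 : σ.reg 1 = k) (h4 : σ.reg 4 = V)
    (hz : ∀ l < n, σ.mem (n + l) ≤ k)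
    (hQ : ∀ τ, (∀ r < 40, τ.reg r = σ.reg r) → (∀ b < n, τ.mem b = σ.mem b) →
      τ.reg 50 = aboveCount k n V (fun l => σ.mem (n + l)) →
      τ.clk ≤ σ.clk + 3000 * (n ^ 3 * k ^ 2) → Q τ) :
    Run S W count Q σ := by
  obtain ⟨hn, hS, hSW, hkW, hpow, hk⟩ := id hp
  have hnV : V + 1 ≤ n * (V + 1) := Nat.le_mul_of_pos_left _ hn
  rw [count]
  simp only [run_seq]
  refine run_floor hp h0 h1 hz fun ρ f1 f2 f3 f4 f5 f6 => ?_
  rw [run_seq]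
  refine run_fillTable hp (a := fun l => ρ.mem (n + l)) (by simp [f1, h0]) (by simp [f1, h1])
    (by simp [f1, h4]) (fun _ _ => rfl) f4 fun τ g1 g2 g3 g4 => ?_
  have e0 : τ.reg 0 = n := by rw [g1 0 (by omega), f1 0 (by omega), h0]
  have e1 : τ.reg 1 = k := by rw [g1 1 (by omega), f1 1 (by omega), h1]
  have e4 : τ.reg 4 = V := by rw [g1 4 (by omega), f1 4 (by omega), h4]
  have hcount := aboveCount_eq f3 f4 hn V
  have hle := aboveCount_le k n V fun l => ρ.mem (n + l)
  simp [e0, e4]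
  refine ⟨by omega, run_sumBlocks hp (a := fun l => ρ.mem (n + l)) (T := resetCount k n (fun l => ρ.mem (n + l)) 0)
    (m := n) (x := V) (f := 1) (by simp [e0]) (by simp [e1]) (by simp [e4]) (by simp) (by simp)
    (by simp) le_rfl le_rfl le_rfl (fun l hl => by simp [g2 (n + l) (by omega)]) f4
    (fun j hj y hy => g3 j y hy (.inl hj)) (by omega) fun υ u1 u2 u3 u4 => ?_⟩
  simp at u4
  refine hQ υ (fun r hr => ?_) (fun b hb => ?_) (by rw [u3, ← hcount, f5]) (u4.trans ?_)
  · rw [u1 r (by omega)]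
    simp [show r ≠ 40 by omega, show r ≠ 41 by omega, show r ≠ 42 by omega, g1 r hr, f1 r (by omega)]
  · rw [u2]
    simp [g2 b (by omega), f2 b (.inl hb)]
  · have b1 : n ^ 3 ≤ n ^ 3 * k ^ 2 := Nat.le_mul_of_pos_right _ (by positivity)
    -- Here `V + 1 ≤ k n + n + 1 ≤ 3 n k`.
    have b2 : n * ((V + 1) * (n * k)) ≤ 3 * (n ^ 3 * k ^ 2) := by
      calc n * ((V + 1) * (n * k)) ≤ n * (3 * (n * k) * (n * k)) := by
            gcongr; nlinarith
        _ = 3 * (n ^ 3 * k ^ 2) := by ring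
    have b3 : n * (k + 1) ≤ 2 * (n ^ 3 * k ^ 2) := by
      calc n * (k + 1) ≤ n * (2 * k) := by gcongr; omega
        _ = 2 * (n ^ 1 * k ^ 1) := by ring
        _ ≤ _ := by gcongr <;> omega
    have b4 : 1 ≤ n ^ 3 := Nat.pow_pos hn
    omega

end
end RAM

/-! ### Invariants of the search for a block -/

namespace UCycle

/-- The word that starts with `x 0, …, x (j - 1), c` and continues with the symbol `b`. -/
def fillWord (x : ℕ → ℕ) (j c b : ℕ) : ℕ → ℕ := fun l => if l < j then x l else if l = j then c else b

/-- The block at the position `i` starts with `x 0, …, x (j - 1)`, and its symbol `j` lies between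
`lo` and `hi`. -/
structure Search (k n V i : ℕ) (x : ℕ → ℕ) (j lo hi : ℕ) : Prop where
  mem : ∀ l < j, 1 ≤ x l ∧ x l ≤ k
  lt : i < upTo k n V (word n (fillWord x j hi k))
  le : ∀ y ∈ strings k n, y < word n (fillWord x j lo 1) → upTo k n V y ≤ i

variable {k n V i j lo hi : ℕ} {x x' : ℕ → ℕ}

theorem aboveCount_congr {z z' : ℕ → ℕ} (h : ∀ l < n, z l = z' l) (w : ℕ) :
    aboveCount k n w z = aboveCount k n w z' := by
  classical
  rw [aboveCount, aboveCount]
  congr 1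
  refine Finset.filter_congr fun y _ => and_congr_right fun _ => forall_congr' fun r => ?_
  exact ⟨fun h' => h'.congr h fun _ _ => rfl,
    fun h' => h'.congr (fun l hl => (h l hl).symm) fun _ _ => rfl⟩

theorem fillWord_congr (h : ∀ l < j, x l = x' l) (c b : ℕ) : fillWord x j c b = fillWord x' j c b := by
  funext l
  simp only [fillWord]
  split_ifs with h1
  · exact h l h1
  · rfl
  · rfl

theorem Search.congr (h : Search k n V i x j lo hi) (hx : ∀ l < j, x l = x' l) :
    Search k n V i x' j lo hi := by
  refine ⟨fun l hl => by rw [← hx l hl]; exact h.mem l hl, ?_, ?_⟩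
  · rw [← fillWord_congr hx]; exact h.lt
  · rw [← fillWord_congr hx]; exact h.le

theorem upTo_top (hn : 0 < n) : upTo k n V (word n fun _ => k) = (stringsAtLeast k n V).card := by
  rw [upTo, Finset.filter_true_of_mem]
  intro y hy
  obtain ⟨h1, h2⟩ := mem_strings.1 (mem_stringsAtLeast.1 hy).1
  refine ⟨0, hn, ?_⟩
  rw [List.rotate_zero, ← not_lt, word_lt_iff h1]
  rintro ⟨l, hl, -, h3⟩
  have : y.getD l 0 ∈ y := by
    rw [List.getD_eq_getElem _ _ (by omega)]; exact List.getElem_mem _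
  exact absurd (h2 _ this).2 (not_le.2 h3)

theorem Search.start (hn : 0 < n) (h : i < (stringsAtLeast k n V).card) :
    Search k n V i x 0 1 k := by
  refine ⟨fun l hl => by omega, ?_, fun y hy hlt => ?_⟩
  · convert h
    rw [← upTo_top hn]
    congr 2
    funext l
    simp [fillWord]
  · obtain ⟨h1, h2⟩ := mem_strings.1 hy
    rw [lt_word_iff h1] at hlt
    obtain ⟨l, hl, -, h3⟩ := hlt
    have : y.getD l 0 ∈ y := by
      rw [List.getD_eq_getElem _ _ (by omega)]; exact List.getElem_mem _
    have := (h2 _ this).1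
    simp only [fillWord, Nat.not_lt_zero, if_false, ite_self] at h3
    omega

theorem Search.lower (h : Search k n V i x j lo hi) {c : ℕ}
    (hc : i < upTo k n V (word n (fillWord x j c k))) : Search k n V i x j lo c :=
  ⟨h.mem, hc, h.le⟩

/-- A string below `x 0, …, x (j - 1), c + 1, 1, …, 1` is at most `x 0, …, x (j - 1), c, k, …, k`,
and `upTo` is monotone. -/
theorem Search.raise (h : Search k n V i x j lo hi) {c : ℕ}
    (hc : ¬ i < upTo k n V (word n (fillWord x j c k))) : Search k n V i x j (c + 1) hi := by
  refine ⟨h.mem, h.lt, fun y hy hlt => le_trans (upTo_mono ?_) (not_lt.1 hc)⟩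
  obtain ⟨h1, h2⟩ := mem_strings.1 hy
  have hb : ∀ l < n, 1 ≤ y.getD l 0 ∧ y.getD l 0 ≤ k := fun l hl => by
    refine h2 _ ?_
    rw [List.getD_eq_getElem _ _ (by omega)]; exact List.getElem_mem _
  rw [lt_word_iff h1] at hlt
  rw [← not_lt, word_lt_iff h1]
  rintro ⟨l, hl, h3, h4⟩
  obtain ⟨l', hl', h5, h6⟩ := hlt
  simp only [fillWord] at h3 h4 h5 h6
  have b1 := hb l hl
  have b2 := hb l' hl'
  have e1 : ∀ l, j < l → ¬ l < j ∧ ¬ l = j := fun l h => ⟨by omega, by omega⟩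
  rcases lt_trichotomy l l' with hll | rfl | hll
  · have e := h5 l hll
    rcases lt_trichotomy l j with h7 | rfl | h7
    · rw [if_pos h7] at e h4; omega
    · simp only [e1 l' hll, if_false] at h6; omega
    · simp only [e1 l h7, if_false] at h4; omega
  · rcases lt_trichotomy l j with h7 | rfl | h7
    · rw [if_pos h7] at h6 h4; omega
    · simp only [lt_irrefl, if_true, if_false] at h4 h6; omega
    · simp only [e1 l h7, if_false] at h6; omega
  · have e := h3 l' hll
    rcases lt_trichotomy l' j with h7 | rfl | h7
    · rw [if_pos h7] at e h6; omega
    · simp only [e1 l hll, if_false] at h4; omega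
    · simp only [e1 l' h7, if_false] at h6; omega

/-- Once symbol `j` is determined, the two bounding words are those of the search for the following
symbol with the full range from 1 to `k`. -/
theorem Search.next {c : ℕ} (h : Search k n V i x j c c) (hx : x j = c) (hc : 1 ≤ c ∧ c ≤ k) :
    Search k n V i x (j + 1) 1 k := by
  have e : ∀ b, fillWord x (j + 1) b b = fillWord x j c b := fun b => by
    funext l
    simp only [fillWord]
    rcases lt_trichotomy l j with h | rfl | h
    · rw [if_pos (by omega), if_pos h]
    · rw [if_pos (by omega), if_neg (lt_irrefl l), if_pos rfl, hx]
    · rw [if_neg (show ¬ l < j + 1 by omega), ite_self, if_neg (by omega), if_neg (by omega)]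
  refine ⟨fun l hl => ?_, by rw [e]; exact h.lt, by rw [e]; exact h.le⟩
  rcases (Nat.lt_succ_iff.1 hl).lt_or_eq with hl | rfl
  · exact h.mem l hl
  · rwa [hx]

theorem Search.isBlock (h : Search k n V i x n lo hi) : IsBlock k n V i (word n x) := by
  have e : ∀ c b, word n (fillWord x n c b) = word n x := fun c b =>
    word_congr fun l hl => by rw [fillWord, if_pos hl]
  refine ⟨mem_strings.2 ⟨length_word _ _, fun c hc => ?_⟩, by rw [← e]; exact h.lt, ?_⟩
  · simp only [word, List.mem_map, List.mem_range] at hc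
    obtain ⟨l, hl, rfl⟩ := hc
    exact h.mem l hl
  · rw [← e]; exact h.le

end UCycle

/-! ### Programs: binary search for a block -/

namespace RAM
open RAM.Expr UCycle

/-- Copy `M[0], …, M[n - 1]` to `M[n], …, M[2 n - 1]` and compute `aboveCount`. -/
def probe : Cmd := .for 25 (var 0) (.put (var 0 + var 25) (cell (var 25))) ;; count

/-- Search the symbol `21` of a block; the variables `22` and `23` are bounds. -/
def searchSymbol : Cmd :=
  .loop (var 22) (var 23) (
    .assign 24 ((var 22 + var 23) / lit 2) ;; .put (var 21) (var 24) ;; probe ;;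
    .ite (var 20 + var 50) (var 19) (.assign 23 (var 24)) (.assign 22 (var 24 + lit 1)))

/-- Write the block at the position given by the variable `20` to `M[0], …, M[n - 1]`; the variable
`19` holds the length of the cyclic sequence. -/
def findBlock : Cmd :=
  .for 25 (var 0) (.put (var 25) (var 1)) ;;
  .for 21 (var 0) (.assign 22 (lit 1) ;; .assign 23 (var 1) ;; searchSymbol ;;
    .put (var 21) (var 22))

section
variable {S W n k V : ℕ} {Q : Store → Prop} {σ : Store}

theorem run_probe (hp : Fits S W n k V) (hV : V ≤ k * n + n)
    (h0 : σ.reg 0 = n) (h1 : σ.reg 1 = k) (h4 : σ.reg 4 = V) (hz : ∀ l < n, σ.mem l ≤ k)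
    (hQ : ∀ τ, (∀ r < 25, τ.reg r = σ.reg r) → (∀ b < n, τ.mem b = σ.mem b) →
      τ.reg 50 = aboveCount k n V σ.mem → τ.clk ≤ σ.clk + 3050 * (n ^ 3 * k ^ 2) → Q τ) :
    Run S W probe Q σ := by
  obtain ⟨hn, hS, hSW, hkW, hpow, hk⟩ := id hp
  rw [probe, run_seq]
  refine Run.for n (fun i r M => (∀ y < 25, r y = σ.reg y) ∧
    (∀ b < n, M b = σ.mem b) ∧ ∀ l < i, M (n + l) = σ.mem l) 20 (by omega)
      (by omega) (by omega) ?_ ?_ ?_ ?_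
  · refine ⟨fun x hx => ?_, fun _ _ => rfl, fun l hl => by omega⟩
    simp [show x ≠ 25 by omega]
  · rintro x hx ρ ⟨h2, -⟩ -
    simp [h2, h0]
  · rintro i hi ρ ⟨h2, h3, h5⟩ h6
    simp [h2, h0, h6]
    refine ⟨by omega, fun y hy => ?_, fun b hb => ?_, fun l hl => ?_⟩
    · rw [if_neg (by omega), h2 y hy]
    · rw [if_neg (by omega), h3 b hb]
    · split_ifs with h7
      · rw [h7, h3 i hi]
      · exact h5 l (by omega)
  · rintro ρ ⟨h2, h3, h5⟩ - hc
    refine run_count hp hV (by simp [h2, h0]) (by simp [h2, h1]) (by simp [h2, h4])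
      (fun l hl => by rw [h5 l hl]; exact hz l hl) fun τ g1 g2 g3 g4 => ?_
    refine hQ τ (fun r hr => by rw [g1 r (by omega), h2 r hr])
      (fun b hb => by rw [g2 b hb, h3 b hb]) ?_ (g4.trans ?_)
    · rw [g3]
      exact aboveCount_congr h5 _
    · simp at hc
      have b1 : n ≤ n ^ 3 * k ^ 2 := by
        calc n = n ^ 1 * k ^ 0 := by ring
          _ ≤ _ := by gcongr <;> omega
      omega

/-- The bit length of the interval width is the loop measure, so there are at most `k.size` probes
per symbol. -/
theorem size_half_lt {a D : ℕ} (h : a ≤ D / 2) (hD : 0 < D) : a.size < D.size := by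
  have h1 := Nat.size_pos.2 hD
  have h2 := Nat.lt_size_self D
  have h3 : a.size ≤ D.size - 1 := Nat.size_le.2 (by
    rw [show D.size = D.size - 1 + 1 by omega, pow_succ] at h2
    omega)
  omega

/-- The symbols after `j` are kept at `k`, so the probed word is the upper bounding word for the
middle value. As `aboveCount` and `upTo` add up to the total, the test `i + aboveCount < total`
decides `i < upTo`. -/
theorem run_searchSymbol (hp : Fits S W n k V) (hV : V ≤ k * n + n) {i j : ℕ} (hj : j < n)
    (h0 : σ.reg 0 = n) (h1 : σ.reg 1 = k) (h4 : σ.reg 4 = V)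
    (h19 : σ.reg 19 = (stringsAtLeast k n V).card) (h20 : σ.reg 20 = i) (h21 : σ.reg 21 = j)
    (h22 : σ.reg 22 = 1) (h23 : σ.reg 23 = k)
    (hi : i < (stringsAtLeast k n V).card) (hz : ∀ l < n, j ≤ l → σ.mem l = k)
    (hs : Search k n V i σ.mem j 1 k)
    (hQ : ∀ τ c, (∀ r < 22, τ.reg r = σ.reg r) → τ.reg 22 = c → 1 ≤ c → c ≤ k →
      (∀ b < n, b ≠ j → τ.mem b = σ.mem b) → Search k n V i σ.mem j c c →
      τ.clk ≤ σ.clk + k.size * (3200 * (n ^ 3 * k ^ 2)) + 10 → Q τ) :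
    Run S W searchSymbol Q σ := by
  obtain ⟨hn, hS, hSW, hkW, hpow, hk⟩ := id hp
  have hcard : (stringsAtLeast k n V).card ≤ k ^ n :=
    (Finset.card_filter_le _ _).trans (card_strings k n).le
  have hB : 1 ≤ n ^ 3 * k ^ 2 := Nat.mul_pos (Nat.pow_pos hn) (Nat.pow_pos hk)
  rw [searchSymbol]
  refine Run.loop (fun r M => (∀ y < 22, r y = σ.reg y) ∧ (∀ b < n, b ≠ j → M b = σ.mem b) ∧
    1 ≤ r 22 ∧ r 22 ≤ r 23 ∧ r 23 ≤ k ∧ Search k n V i σ.mem j (r 22) (r 23))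
    (fun r => (r 23 - r 22).size) (3050 * (n ^ 3 * k ^ 2) + 50) ?_ ?_ ?_ ?_
  · exact ⟨fun _ _ => rfl, fun _ _ _ => rfl, by omega, by omega, by omega, by rwa [h22, h23]⟩
  · rintro ρ -
    simp
  · rintro ρ ⟨g1, g2, g3, g5, g6, g7⟩ hlt
    simp at hlt
    simp only [run_seq]
    simp [g1, h21]
    refine ⟨by omega, by omega, ?_⟩
    set mid := (ρ.reg 22 + ρ.reg 23) / 2 with hmid
    refine run_probe hp hV (by simp [g1, h0]) (by simp [g1, h1]) (by simp [g1, h4])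
      (fun l hl => ?_) fun τ t1 t2 t3 t4 => ?_
    · simp
      split_ifs with h
      · omega
      · rw [g2 l hl h]
        by_cases hlj : j ≤ l
        · exact (hz l hl hlj).le
        · exact (hs.mem l (by omega)).2
    have hz' := aboveCount_add_upTo (k := k) (V := V) hn
      ((((ρ.set 24 mid).tick 6).put j mid).tick 3).mem
    have e : word n ((((ρ.set 24 mid).tick 6).put j mid).tick 3).mem =
        word n (fillWord σ.mem j mid k) := word_congr fun l hl => by
      simp [fillWord]
      split_ifs with h5 h6 h6
      · omega
      · rfl
      · exact g2 l hl h5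
      · rw [g2 l hl h5, hz l hl (by omega)]
    rw [e] at hz'
    have fr : ∀ y < 24, τ.reg y = ρ.reg y := fun y hy => by
      rw [t1 y (by omega)]; simp [show y ≠ 24 by omega]
    have f24 : τ.reg 24 = mid := by rw [t1 24 (by omega)]; simp
    have fm : ∀ b < n, b ≠ j → τ.mem b = σ.mem b := fun b hb hbj => by
      rw [t2 b hb]; simp [hbj, g2 b hb hbj]
    simp only [← t3] at hz'
    have hfr : ∀ c v, 21 < c → ∀ y < 22, (if y = c then v else τ.reg y) = σ.reg y := fun c v hc y hy => by
      rw [if_neg (by omega), fr y (by omega), g1 y hy]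
    simp [f24, fr, g1, h19, h20]
    simp at t4
    refine ⟨by omega, fun hlt' => ⟨⟨hfr _ _ (by simp), fm, g3, by omega, by omega,
      g7.lower (by omega)⟩, size_half_lt (by omega) (by omega), by omega⟩, fun hge => ⟨by omega,
      ⟨hfr _ _ (by simp), fm, by omega, g6, g7.raise (by omega)⟩,
      size_half_lt (by omega) (by omega), by omega⟩⟩
  · rintro ρ ⟨g1, g2, g3, g5, g6, g7⟩ hge hc
    simp at hge
    have e : ρ.reg 23 = ρ.reg 22 := by omega
    rw [e] at g7
    refine hQ ρ _ g1 rfl g3 (by omega) g2 g7 (hc.trans ?_)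
    simp [h22, h23]
    have hle := Nat.size_le_size (Nat.sub_le k 1)
    generalize n ^ 3 * k ^ 2 = B at *
    nlinarith

/-- Each symbol costs `k.size` counts of `O(n³ k²)` steps, which yields the factor `n log k` of
unranking. -/
theorem run_findBlock (hp : Fits S W n k V) (hV : V ≤ k * n + n) {i : ℕ}
    (h0 : σ.reg 0 = n) (h1 : σ.reg 1 = k) (h4 : σ.reg 4 = V)
    (h19 : σ.reg 19 = (stringsAtLeast k n V).card) (h20 : σ.reg 20 = i)
    (hi : i < (stringsAtLeast k n V).card)
    (hQ : ∀ τ, (∀ r < 21, τ.reg r = σ.reg r) → IsBlock k n V i (word n τ.mem) →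
      τ.clk ≤ σ.clk + n * (k.size * (3300 * (n ^ 3 * k ^ 2))) → Q τ) :
    Run S W findBlock Q σ := by
  obtain ⟨hn, hS, hSW, hkW, hpow, hk⟩ := id hp
  have hB : 1 ≤ n ^ 3 * k ^ 2 := Nat.mul_pos (Nat.pow_pos hn) (Nat.pow_pos hk)
  have hsz : 1 ≤ k.size := Nat.size_pos.2 hk
  have hnV : 0 < n * (V + 1) := Nat.mul_pos hn (by omega)
  rw [findBlock, run_seq]
  refine Run.for n (fun j r M => (∀ y < 21, r y = σ.reg y) ∧ ∀ l < j, M l = k) 20 (by omega)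
      (by omega) (by omega) ?_ ?_ ?_ ?_
  · refine ⟨fun x hx => ?_, fun l hl => by omega⟩
    simp [show x ≠ 25 by omega]
  · rintro x hx ρ ⟨h2, -⟩ -
    simp [h2, h0]
  · rintro j hj ρ ⟨h2, h3⟩ h6
    simp [h2, h1, h6]
    refine ⟨by omega, fun y hy => by rw [if_neg (by omega), h2 y hy], fun l hl hlj => h3 l (by omega)⟩
  rintro π ⟨p1, p2⟩ - pc
  refine Run.for n (fun j r M => (∀ y < 21, r y = σ.reg y) ∧ Search k n V i M j 1 k ∧
    ∀ l < n, j ≤ l → M l = k) (k.size * (3200 * (n ^ 3 * k ^ 2)) + 30) (by omega)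
      (by omega) (by omega) ?_ ?_ ?_ ?_
  · refine ⟨fun x hx => ?_, Search.start hn hi, fun l hl _ => p2 l hl⟩
    simp [show x ≠ 21 by omega, p1 x hx]
  · rintro x hx ρ ⟨h2, -⟩ -
    simp [h2, h0]
  · rintro j hj ρ ⟨h2, h3, h5⟩ h6
    simp only [run_seq]
    simp [h2, h1]
    refine ⟨by omega, run_searchSymbol hp hV hj (by simp [h2, h0]) (by simp [h2, h1])
      (by simp [h2, h4]) (by simp [h2, h19]) (by simp [h2, h20]) (by simp [h6]) (by simp) (by simp)
      hi (by simpa using h5) (by simpa using h3) ?_⟩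
    intro τ c t1 t2 t3 t4 t5 t6 t7
    have fr : ∀ y < 22, τ.reg y = ρ.reg y := fun y hy => by
      rw [t1 y hy]; simp [show y ≠ 22 by omega, show y ≠ 23 by omega]
    simp at t5 t6 t7
    have hnext : Search k n V i (((τ.put j c).tick 3).mem) (j + 1) 1 k := by
      refine (t6.congr fun l hl => ?_).next (by simp) ⟨t3, t4⟩
      simp [show l ≠ j by omega, t5 l (by omega)]
    simp [fr, h6, t2]
    refine ⟨by omega, by omega, fun y hy => ?_, hnext, fun l hl hjl => ?_⟩
    · rw [if_neg (by omega), fr y (by omega), h2 y hy]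
    · rw [if_neg (by omega), t5 l hl (by omega), h5 l hl (by omega)]
  · rintro ρ ⟨h2, h3, h5⟩ - hc
    refine hQ ρ h2 h3.isBlock (hc.trans ?_)
    simp at pc ⊢
    have hC : 1 ≤ k.size * (n ^ 3 * k ^ 2) := Nat.mul_pos hsz hB
    rw [show k.size * (3200 * (n ^ 3 * k ^ 2)) = 3200 * (k.size * (n ^ 3 * k ^ 2)) by ring,
      show k.size * (3300 * (n ^ 3 * k ^ 2)) = 3300 * (k.size * (n ^ 3 * k ^ 2)) by ring]
    generalize k.size * (n ^ 3 * k ^ 2) = B at *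
    nlinarith

end
end RAM

/-! ### Programs: auxiliary loops -/

namespace RAM
open RAM.Expr UCycle

/-- Write the values of `e` for `0, …, n - 1` in the variable `25` to `M[n], …, M[2 n - 1]`. -/
def fill (e : Expr) : Cmd := .for 25 (var 0) (.put (var 0 + var 25) e)

/-- Compute the length of the cyclic sequence in the variable `19`. -/
def countAll : Cmd := fill (lit 0) ;; count ;; .assign 19 (var 50)

/-- Replace `M[0], …, M[n - 1]` by its complement. -/
def complementInput : Cmd := .for 25 (var 0) (.put (var 25) (var 1 + lit 1 - cell (var 25)))

/-- Find the first minimal rotation of `M[0], …, M[n - 1]`, by an amount that is positive. -/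
def minRotation : Cmd :=
  .assign 6 (lit 1) ;;
  .for 25 (var 0) (
    .assign 50 (lit 0) ;; .assign 51 (var 25 + lit 1) ;; .assign 52 (var 6) ;; .assign 53 (var 0) ;;
    compare ;;
    .ite (lit 1) (var 54) (.assign 6 (var 25 + lit 1)) .skip)

/-- Count the symbols `k` at the start of `M[0], …, M[n - 1]`. -/
def leading : Cmd :=
  .assign 7 (lit 0) ;;
  .for 25 (var 0) (
    .ite (cell (var 25)) (var 1) .skip
      (.ite (var 7) (var 25) .skip (.assign 7 (var 25 + lit 1))))

section
variable {S W n k V : ℕ} {Q : Store → Prop} {σ : Store}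

theorem run_fill (hp : Fits S W n k V) (h0 : σ.reg 0 = n) {e : Expr} {f : ℕ → ℕ}
    (he : ∀ l < n, ∀ ρ : Store, (∀ r < 25, ρ.reg r = σ.reg r) → (∀ b < n, ρ.mem b = σ.mem b) →
      ρ.reg 25 = l → e.Safe S W ρ ∧ e.eval ρ = f l)
    (hQ : ∀ τ, (∀ r < 25, τ.reg r = σ.reg r) → (∀ b < n, τ.mem b = σ.mem b) →
      (∀ l < n, τ.mem (n + l) = f l) → τ.clk ≤ σ.clk + (e.cost + 30) * n → Q τ) :
    Run S W (fill e) Q σ := by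
  obtain ⟨hn, hS, hSW, hkW, hpow, hk⟩ := id hp
  refine Run.for n (fun i r M => (∀ y < 25, r y = σ.reg y) ∧
    (∀ b < n, M b = σ.mem b) ∧ ∀ l < i, M (n + l) = f l) (e.cost + 10) (by omega)
      (by omega) (by omega) ?_ ?_ ?_ ?_
  · refine ⟨fun x hx => ?_, fun _ _ => rfl, fun l hl => by omega⟩
    simp [show x ≠ 25 by omega]
  · rintro x hx ρ ⟨h2, -⟩ -
    simp [h2, h0]
  · rintro i hi ρ ⟨h2, h3, h5⟩ h6
    obtain ⟨e1, e2⟩ := he i hi ρ h2 h3 h6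
    simp [h2, h0, h6, e1, e2]
    refine ⟨by omega, by omega, fun y hy => ?_, fun b hb => ?_, fun l hl => ?_⟩
    · rw [if_neg (by omega), h2 y hy]
    · rw [if_neg (by omega), h3 b hb]
    · split_ifs with h7
      · rw [h7]
      · exact h5 l (by omega)
  · rintro ρ ⟨h2, h3, h5⟩ - hc
    refine hQ ρ h2 h3 h5 (hc.trans ?_)
    simp
    nlinarith

/-- Every string lies above the word `0…0`, so counting above it gives the cardinality of the whole
set. -/
theorem run_countAll (hp : Fits S W n k V) (hV : V ≤ k * n + n)
    (h0 : σ.reg 0 = n) (h1 : σ.reg 1 = k) (h4 : σ.reg 4 = V)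
    (hQ : ∀ τ, (∀ r < 25, r ≠ 19 → τ.reg r = σ.reg r) → (∀ b < n, τ.mem b = σ.mem b) →
      τ.reg 19 = (stringsAtLeast k n V).card →
      τ.clk ≤ σ.clk + 3050 * (n ^ 3 * k ^ 2) → Q τ) :
    Run S W countAll Q σ := by
  obtain ⟨hn, hS, hSW, hkW, hpow, hk⟩ := id hp
  rw [countAll, run_seq]
  refine run_fill hp h0 (f := fun _ => 0) (fun l hl ρ _ _ _ => by simp) fun τ t1 t2 t3 t4 => ?_
  rw [run_seq]
  refine run_count hp hV (by simp [t1, h0]) (by simp [t1, h1]) (by simp [t1, h4])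
    (fun l hl => by simp [t3 l hl]) fun υ u1 u2 u3 u4 => ?_
  have hz := aboveCount_add_upTo (k := k) (V := V) hn fun l => τ.mem (n + l)
  have h00 : upTo k n V (word n fun l => τ.mem (n + l)) = 0 := by
    rw [upTo, Finset.card_eq_zero, Finset.filter_eq_empty_iff]
    rintro y hy ⟨r, hr, hle⟩
    obtain ⟨y1, y2⟩ := mem_strings.1 (mem_stringsAtLeast.1 hy).1
    refine not_lt.2 hle ?_
    rw [word_lt_iff (by simpa using y1)]
    refine ⟨0, hn, by simp, ?_⟩
    simp only [t3 0 hn]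
    exact (y2 _ (List.mem_rotate.1 (getD_mem (by rw [List.length_rotate]; omega)))).1
  have b1 : n ≤ n ^ 3 * k ^ 2 := by
    calc n = n ^ 1 * k ^ 0 := by ring
      _ ≤ _ := by gcongr <;> omega
  simp at t4
  refine run_assign.2 ⟨by simp, hQ _ (fun r hr h => ?_) (fun b hb => ?_) ?_ ?_⟩
  · simp [h, u1 r (by omega), t1 r hr]
  · simp [u2 b hb, t2 b hb]
  · simp [u3]; omega
  · simp; omega

theorem run_complementInput (hp : Fits S W n k V) (h0 : σ.reg 0 = n) (h1 : σ.reg 1 = k)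
    (hQ : ∀ τ, (∀ r < 25, τ.reg r = σ.reg r) → (∀ b < n, τ.mem b = k + 1 - σ.mem b) →
      τ.clk ≤ σ.clk + 50 * n → Q τ) : Run S W complementInput Q σ := by
  obtain ⟨hn, hS, hSW, hkW, hpow, hk⟩ := id hp
  refine Run.for n (fun i r M => (∀ y < 25, r y = σ.reg y) ∧
    (∀ b < i, M b = k + 1 - σ.mem b) ∧ ∀ b < n, i ≤ b → M b = σ.mem b) 20 (by omega)
      (by omega) (by omega) ?_ ?_ ?_ ?_
  · refine ⟨fun x hx => ?_, fun l hl => by omega, fun _ _ _ => rfl⟩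
    simp [show x ≠ 25 by omega]
  · rintro x hx ρ ⟨h2, -⟩ -
    simp [h2, h0]
  · rintro i hi ρ ⟨h2, h3, h5⟩ h6
    simp [h2, h1, h6]
    refine ⟨by omega, fun y hy => ?_, fun b hb => ?_, fun b hb hib => ?_⟩
    · rw [if_neg (by omega), h2 y hy]
    · split_ifs with h
      · rw [h, h5 i hi le_rfl]
      · exact h3 b (by omega)
    · rw [if_neg (by omega), h5 b hb (by omega)]
  · rintro ρ ⟨h2, h3, h5⟩ - hc
    refine hQ ρ h2 h3 (hc.trans ?_)
    simp
    omega

/-- The amounts `1, …, n` are tried in order, and the candidate is replaced only by a strictly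
smaller rotation; thus the first minimum is kept. -/
theorem run_minRotation (hp : Fits S W n k V) {s : List ℕ} (h0 : σ.reg 0 = n) (hs : s.length = n)
    (hm : ∀ l < n, σ.mem l = s.getD l 0)
    (hQ : ∀ τ d, (∀ r < 25, r ≠ 6 → τ.reg r = σ.reg r) → τ.mem = σ.mem → τ.reg 6 = d →
      0 < d → d ≤ n → (∀ j, s.rotate d ≤ s.rotate j) →
      (∀ e, 0 < e → e < d → s.rotate e ≠ s.rotate d) →
      τ.clk ≤ σ.clk + 300 * (n * n) → Q τ) : Run S W minRotation Q σ := by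
  obtain ⟨hn, hS, hSW, hkW, hpow, hk⟩ := id hp
  have hrot : ∀ e, ∀ l < n, (s.rotate e).getD l 0 = σ.mem ((e + l) % n) := fun e l hl => by
    rw [getD_rotate (by omega), hm _ (Nat.mod_lt _ hn), hs]
  rw [minRotation, run_seq, run_assign]
  refine ⟨by simp; omega, Run.for n (fun i r M => (∀ y < 25, y ≠ 6 → r y = σ.reg y) ∧
    M = σ.mem ∧ 0 < r 6 ∧ r 6 ≤ n ∧ (∀ e, 0 < e → e ≤ i → s.rotate (r 6) ≤ s.rotate e) ∧
    ∀ e, 0 < e → e < r 6 → s.rotate (r 6) < s.rotate e) (100 * (n + 1) + 40) (by omega)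
      (by omega) (by omega) ?_ ?_ ?_ ?_⟩
  · refine ⟨fun x hx h => ?_, rfl, ?_⟩
    · simp [show x ≠ 25 by omega, h]
    · simp
      exact ⟨hn, fun e h1 h2 => by omega, fun e h1 h2 => by omega⟩
  · rintro x hx ρ ⟨h2, -⟩ -
    simp [h2, h0]
  · rintro i hi ρ ⟨h2, h3, h5, h6, h7, h8⟩ h9
    simp only [run_seq]
    simp [h2, h0, h9]
    refine ⟨by omega, run_compare hp (b := 0) (e := i + 1) (e' := ρ.reg 6) (m := n)
      (by simp [h2, h0]) (by simp) (by simp) (by simp) (by simp) (by omega) (by omega) h6 le_rfl ?_⟩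
    intro τ t1 t2 t3 t4
    have hlt : 1 < τ.reg 54 ↔ s.rotate (i + 1) < s.rotate (ρ.reg 6) := by
      rw [t3, lt_iff_lexLt (n := n) (by simp [hs]) (by simp [hs])]
      simp only [Store.tick_mem, Store.set_mem, h3, zero_add]
      exact ⟨fun h => h.congr (fun l hl => (hrot _ l hl).symm) fun l hl => (hrot _ l hl).symm,
        fun h => h.congr (hrot _) (hrot _)⟩
    have fr : ∀ y < 50, τ.reg y = ρ.reg y := fun y hy => by
      rw [t1 y hy]
      simp [show y ≠ 50 by omega, show y ≠ 51 by omega, show y ≠ 52 by omega, show y ≠ 53 by omega]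
    have hfr : ∀ c v : ℕ, c = 6 ∨ c = 63 → ∀ x < 25, x ≠ 6 →
        (if x = 25 then i + 1 else if x = c then v else τ.reg x) = σ.reg x := fun c v hc x hx h => by
      rw [if_neg (by omega), if_neg (by omega), fr x (by omega), h2 x hx h]
    simp at t4
    simp [Cmd.skip, fr, h9, hlt, t2]
    refine ⟨by omega, fun hlt => ⟨by omega, by omega, hfr _ _ (by simp), h3, hi, fun e he hei => ?_,
      fun e he hei => hlt.trans_le (h7 e he hei)⟩, fun hge => ⟨by omega, hfr _ _ (by simp), h3, h5, h6,
      fun e he hei => ?_, h8⟩⟩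
    · rcases hei.lt_or_eq with h | rfl
      · exact hlt.le.trans (h7 e he (by omega))
      · exact le_rfl
    · rcases hei.lt_or_eq with h | rfl
      · exact h7 e he (by omega)
      · exact hge
  · rintro ρ ⟨h2, h3, h5, h6, h7, h8⟩ - hc
    refine hQ ρ _ h2 h3 rfl h5 h6 (fun j => ?_) (fun e he he' => (h8 e he he').ne') (hc.trans ?_)
    -- Rotation by 0 is not tried, but it equals rotation by `n`.
    · rcases Nat.eq_zero_or_pos (j % n) with h | h
      · have := h7 n hn le_rfl
        rwa [show s.rotate n = s.rotate j by
          rw [← List.rotate_mod s j, hs, h, ← hs, List.rotate_length, List.rotate_zero]] at this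
      · rw [← List.rotate_mod s j, hs]
        exact h7 _ h (Nat.mod_lt _ hn).le
    · simp
      nlinarith

/-- The counter advances only when it equals the loop index; after the first symbol other than `k`
it lags behind for good. -/
theorem run_leading (hp : Fits S W n k V) (h0 : σ.reg 0 = n) (h1 : σ.reg 1 = k)
    (hm : ∀ l < n, σ.mem l ≤ k)
    (hQ : ∀ τ m, (∀ r < 25, r ≠ 7 → τ.reg r = σ.reg r) → τ.mem = σ.mem → τ.reg 7 = m →
      m ≤ n → (∀ l < m, σ.mem l = k) → (m < n → σ.mem m ≠ k) →
      τ.clk ≤ σ.clk + 50 * n → Q τ) : Run S W leading Q σ := by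
  obtain ⟨hn, hS, hSW, hkW, hpow, hk⟩ := id hp
  rw [leading, run_seq, run_assign]
  refine ⟨by simp, Run.for n (fun i r M => (∀ y < 25, y ≠ 7 → r y = σ.reg y) ∧
    M = σ.mem ∧ r 7 ≤ i ∧ (∀ l < r 7, σ.mem l = k) ∧ (r 7 < i → σ.mem (r 7) ≠ k)) 20 (by omega)
      (by omega) (by omega) ?_ ?_ ?_ ?_⟩
  · refine ⟨fun x hx h => ?_, rfl, ?_⟩
    · simp [show x ≠ 25 by omega, h]
    · simp
  · rintro x hx ρ ⟨h2, -⟩ -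
    simp [h2, h0]
  · rintro i hi ρ ⟨h2, h3, h5, h6, h7⟩ h8
    have hi' := hm i hi
    have hfr : ∀ c v : ℕ, c = 7 ∨ c = 63 → ∀ x < 25, ¬ x = 7 →
        (if x = 25 then i + 1 else if x = c then v else ρ.reg x) = σ.reg x := fun c v hc x hx h => by
      rw [if_neg (by omega), if_neg (by omega), h2 x hx h]
    simp [Cmd.skip, h2, h1, h3, h8]
    refine ⟨by omega, fun hlt => ⟨hfr _ _ (by simp), by omega, h6, fun h => ?_⟩, fun hge =>
      ⟨fun hlt => ⟨hfr _ _ (by simp), by omega, h6, fun _ => h7 hlt⟩, fun hle =>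
        ⟨by omega, hfr _ _ (by simp), fun l hl => ?_⟩⟩⟩
    · rcases h.lt_or_eq with h | h
      · exact h7 h
      · rw [h]; omega
    · rcases hl.lt_or_eq with h | rfl
      · exact h6 l (by omega)
      · omega
  · rintro ρ ⟨h2, h3, h5, h6, h7⟩ - hc
    refine hQ ρ _ h2 h3 rfl h5 h6 h7 (hc.trans ?_)
    simp
    omega

end
end RAM

/-! ### The ranking program -/

namespace RAM
open RAM.Expr UCycle

/-- The ranking program: complement the input, find its first minimal rotation and the number of its
leading symbols `k`, and count the strings none of whose rotations precedes the word where the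
string starts. -/
def rankProgram : Cmd :=
  complementInput ;; .assign 4 (var 1 * var 0 + var 0 - var 2) ;; minRotation ;; leading ;;
  countAll ;;
  .ite (var 7) (var 6) (fill (cell ((var 6 + var 25) % var 0)))
    (.assign 6 (var 7) ;;
      fill (cell (var 7 + var 25) * (lit 1 - (lit 1 - (var 0 - (var 7 + var 25)))))) ;;
  count ;; .assign 8 (var 19 - var 50) ;;
  .ite (var 8) (var 6) (.assign 0 (var 8 + var 19 - var 6)) (.assign 0 (var 8 - var 6)) ;;
  .assign 0 (var 0 + lit 1)

section
variable {S W n k V w : ℕ} {Q : Store → Prop} {σ : Store}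

/-- The last part of the ranking program. -/
theorem run_rankTail (hp : Fits S W n k V) (hV : V ≤ k * n + n) {d : ℕ} {z : ℕ → ℕ}
    (h0 : σ.reg 0 = n) (h1 : σ.reg 1 = k) (h4 : σ.reg 4 = V) (h6 : σ.reg 6 = d)
    (h19 : σ.reg 19 = (stringsAtLeast k n V).card)
    (hz : ∀ l < n, σ.mem (n + l) = z l) (hzk : ∀ l < n, z l ≤ k)
    (hQ : ∀ τ, τ.reg 0 = posBefore (upTo k n V (word n z)) d (stringsAtLeast k n V).card + 1 →
      τ.clk ≤ σ.clk + 3050 * (n ^ 3 * k ^ 2) → Q τ) :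
    Run S W (count ;; .assign 8 (var 19 - var 50) ;;
      .ite (var 8) (var 6) (.assign 0 (var 8 + var 19 - var 6)) (.assign 0 (var 8 - var 6)) ;;
      .assign 0 (var 0 + lit 1)) Q σ := by
  obtain ⟨hn, hS, hSW, hkW, hpow, hk⟩ := id hp
  have hcard : (stringsAtLeast k n V).card ≤ k ^ n :=
    (Finset.card_filter_le _ _).trans (card_strings k n).le
  have hB : 1 ≤ n ^ 3 * k ^ 2 := Nat.mul_pos (Nat.pow_pos hn) (Nat.pow_pos hk)
  rw [run_seq]
  refine run_count hp hV h0 h1 h4 (fun l hl => by rw [hz l hl]; exact hzk l hl) fun τ t1 t2 t3 t4 => ?_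
  rw [aboveCount_congr hz] at t3
  have hz' := aboveCount_add_upTo (k := k) (V := V) hn z
  have hsub : (stringsAtLeast k n V).card - aboveCount k n V z = upTo k n V (word n z) := by omega
  simp [t1, h19, h6, t3, hsub]
  refine ⟨fun hlt => ⟨by omega, by omega, hQ _ ?_ ?_⟩, fun hge =>
    ⟨by omega, hQ _ ?_ ?_⟩⟩
  · simp [posBefore, hlt]
  · simp; omega
  · simp [posBefore, not_lt.2 hge]
  · simp; omega

theorem hasRank_of_reads {u s : List ℕ} {i : ℕ} (h : Reads u i s) (hi : i < u.length) :
    HasRank u s (i + 1) := ⟨by omega, hi, h.cyclicSubstring⟩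

/-- Both cases end with the same tail: the offset is `d` with the least rotation as counted word, or
`m` with the marker `c.drop m` followed by zeros. Two counts are needed, one for the total and one
for the position. -/
theorem run_rankProgram (hp : Fits S W n k (k * n + n - w)) {s : List ℕ}
    (hs : s ∈ stringsAtMost k n w) (h0 : σ.reg 0 = n) (h1 : σ.reg 1 = k)
    (h2 : σ.reg 2 = w) (hm : ∀ l < n, σ.mem l = s.getD l 0)
    (hQ : ∀ τ, HasRank (cycleAtMost k n w) s (τ.reg 0) →
      τ.clk ≤ σ.clk + 10000 * (n ^ 3 * k ^ 2) → Q τ) : Run S W rankProgram Q σ := by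
  obtain ⟨hn, hS, hSW, hkW, hpow, hk⟩ := id hp
  have hs' := complement_complement (mem_strings.1 (Finset.mem_filter.1 hs).1).2
  have hc := complement_mem_stringsAtLeast hs
  set V := k * n + n - w with hV
  set c := complement k s with hcdef
  obtain ⟨hl, hck⟩ := mem_strings.1 (mem_stringsAtLeast.1 hc).1
  have hsl := (mem_strings.1 (Finset.mem_filter.1 hs).1).1
  have hcm : ∀ l < n, k + 1 - s.getD l 0 = c.getD l 0 := fun l hl' => by
    simp [hcdef, complement, List.getD_eq_getElem?_getD, hsl ▸ hl']
  have hcb : ∀ l < n, c.getD l 0 ≤ k := fun l hl' => (hck _ (getD_mem (by omega))).2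
  have hlen := length_cycleAtLeast (k := k) (V := V) hn
  rw [rankProgram, run_seq]
  refine run_complementInput hp h0 h1 fun τ t1 t2 t3 => ?_
  rw [run_seq, run_assign]
  refine ⟨by simp [t1, h0, h1]; omega, ?_⟩
  rw [run_seq]
  refine run_minRotation hp (s := c) (by simp [t1, h0]) hl
    (fun l hl' => by simp only [Store.tick_mem, Store.set_mem]; rw [t2 l hl', hm l hl', hcm l hl']) ?_
  intro υ d u1 u2 u3 hd0 hdn hmin hfirst u4
  have um : ∀ l < n, υ.mem l = c.getD l 0 := fun l hl' => by
    rw [u2]; simp only [Store.tick_mem, Store.set_mem]; rw [t2 l hl', hm l hl', hcm l hl']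
  rw [run_seq]
  refine run_leading hp (by simp [u1, t1, h0]) (by simp [u1, t1, h1])
    (fun l hl' => by rw [um l hl']; exact hcb l hl') ?_
  intro φ m f1 f2 f3 hmn hlead hmk f4
  rw [run_seq]
  refine run_countAll hp (by omega) (by simp [f1, u1, t1, h0]) (by simp [f1, u1, t1, h1])
    (by simp [f1, u1, t1, h0, h1, h2, hV]) ?_
  intro ψ p1 p2 p3 p4
  have q0 : ψ.reg 0 = n := by simp [p1, f1, u1, t1, h0]
  have q1 : ψ.reg 1 = k := by simp [p1, f1, u1, t1, h1]
  have q4 : ψ.reg 4 = V := by simp [p1, f1, u1, t1, h0, h1, h2, hV]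
  have q6 : ψ.reg 6 = d := by simp [p1, f1, u3]
  have q7 : ψ.reg 7 = m := by simp [p1, f3]
  have qm : ∀ l < n, ψ.mem l = c.getD l 0 := fun l hl' => by rw [p2 l hl', f2, um l hl']
  have hn2 : n * n ≤ n ^ 3 * k ^ 2 := by
    calc n * n = n ^ 2 * k ^ 0 := by ring
      _ ≤ _ := by gcongr <;> omega
  have hn1 : n ≤ n * n := Nat.le_mul_self n
  simp at u4
  have hclk : ψ.clk ≤ σ.clk + 3500 * (n ^ 3 * k ^ 2) + 7 := by omega
  have fin : ∀ N, N < (stringsAtLeast k n V).card → Reads (cycleAtLeast k n V) N c →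
      HasRank (cycleAtMost k n w) s (N + 1) := fun N hN h => by
    rw [← hs']
    exact hasRank_cycleAtMost (hasRank_of_reads h (hN.trans_eq hlen.symm))
  rw [run_seq, run_ite]
  simp only [eval_var, q6, q7]
  refine ⟨by simp, fun hmd => ?_, fun hdm => ?_⟩
  · refine run_fill hp (by simp [q0]) (f := fun l => (c.rotate d).getD l 0) ?_ ?_
    · intro l hl' ρ r1 r2 r3
      simp at r1 r2
      have d1 := Nat.div_mul_le_self (d + l) n
      have m1 := Nat.mod_lt (d + l) hn
      simp only [safe_cell, safe_mod, safe_add, safe_var, eval_cell, eval_mod, eval_add, eval_var, r1,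
        r3, q0, q6, Nat.reduceLT]
      rw [r2 _ m1, qm _ m1, getD_rotate (by omega), hl]
      exact ⟨⟨⟨⟨trivial, trivial, by omega⟩, trivial, by omega⟩, by omega⟩, rfl⟩
    intro κ k1 k2 k3 k4
    simp at k1 k4
    refine run_rankTail hp (by omega) (d := d) (by simp [k1, q0]) (by simp [k1, q1]) (by simp [k1, q4])
      (by simp [k1, q6]) (by simp [k1, p3]) k3 (fun l hl' => ?_) fun τ e1 e2 => ?_
    · exact (hck _ (List.mem_rotate.1 (getD_mem (by rw [List.length_rotate]; omega)))).2
    have hw' : word n (fun l => (c.rotate d).getD l 0) = c.rotate d := by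
      have := word_getD (c.rotate d)
      rwa [List.length_rotate, hl] at this
    rw [hw'] at e1
    obtain ⟨a1, a2⟩ := reads_posBefore_rotate hn hc hdn hmin hfirst hmd
      (by rw [← um m (by omega)]; exact f2 ▸ hmk (by omega))
    refine hQ τ ?_ (by omega)
    rw [e1, posBefore, if_neg (by omega)]
    refine fin _ ?_ a2
    have := upTo_le (k := k) (n := n) (V := V) (c.rotate d)
    omega
  · rw [run_seq, run_assign]
    refine ⟨by simp, ?_⟩
    have hdm : d ≤ m := by omega
    refine run_fill hp (by simp [q0]) (f := fun l => (c.drop m ++ List.replicate m 0).getD l 0) ?_ ?_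
    -- Because of truncation, `1 - (1 - t)` is 1 for `t > 0` and 0 for `t = 0`. So the factor turns
    -- into 0 what is read beyond the end of the string.
    · intro l hl' ρ r1 r2 r3
      have e1 : (c.drop m ++ List.replicate m 0).getD l 0 = if m + l < n then c.getD (m + l) 0 else 0 := by
        simp only [List.getD_eq_getElem?_getD]
        split_ifs with h
        · rw [List.getElem?_append_left (by simp; omega), List.getElem?_drop]
        · rw [List.getElem?_append_right (by simp; omega)]
          rcases h' : (List.replicate m 0)[l - (c.drop m).length]? with _ | v
          · rfl
          · exact (List.mem_replicate.1 (List.mem_of_getElem? h')).2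
      simp [r3] at r1 r2 ⊢
      simp [r1, q0, q7]
      rw [← List.getD_eq_getElem?_getD, e1]
      split_ifs with h
      · have h5 := hcb (m + l) h
        rw [r2 _ h, qm _ h, show 1 - (1 - (n - (m + l))) = 1 by omega]
        omega
      · rw [show 1 - (1 - (n - (m + l))) = 0 by omega]
        omega
    intro κ k1 k2 k3 k4
    simp at k1 k4
    refine run_rankTail hp (by omega) (d := m) (by simp [k1, q0]) (by simp [k1, q1]) (by simp [k1, q4])
      (by simp [k1, q7]) (by simp [k1, p3]) k3 (fun l hl' => ?_) fun τ e1 e2 => ?_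
    · have h3 : ∀ x ∈ c.drop m ++ List.replicate m 0, x ≤ k := fun x hx => by
        rcases List.mem_append.1 hx with h | h
        · exact (hck _ (List.mem_of_mem_drop h)).2
        · rw [(List.mem_replicate.1 h).2]; omega
      exact h3 _ (getD_mem (by simp; omega))
    have hw' : word n (fun l => (c.drop m ++ List.replicate m 0).getD l 0) =
        c.drop m ++ List.replicate m 0 := by
      have := word_getD (c.drop m ++ List.replicate m 0)
      have e2 : (c.drop m ++ List.replicate m 0).length = n := by simp; omega
      rwa [e2] at this
    rw [hw'] at e1
    obtain ⟨a1, a2⟩ := reads_posBefore_zeros hn hk hc hd0 hmin hdm hmn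
      (fun l hl' => by rw [← um l (by omega)]; exact f2 ▸ hlead l hl')
      (fun h => by rw [← um m h]; exact f2 ▸ hmk h)
    simp only [Store.tick_clk] at e2
    refine hQ τ ?_ (by omega)
    rw [e1]
    exact fin _ a1 a2

end
end RAM

/-! ### The unranking program -/

namespace RAM
open RAM.Expr UCycle

/-- Test whether one of the last symbols of `M[0], …, M[n - 1]` differs from `k`; their number is the
variable `5`, and the answer, `1` or `0`, is the variable `6`. -/
def testSuffix : Cmd :=
  .assign 6 (lit 0) ;;
  .for 25 (var 0) (
    .ite (var 25) (var 0 - var 5) .skip (.ite (cell (var 25)) (var 1) (.assign 6 (lit 1)) .skip))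

/-- Write the complement of `M[n], …, M[2 n - 1]` to `M[0], …, M[n - 1]`. -/
def complementOutput : Cmd :=
  .for 25 (var 0) (.put (var 25) (var 1 + lit 1 - cell (var 0 + var 25)))

/-- The string that starts at the position `20`, in `M[n], …, M[2 n - 1]`, when the last symbols of
its block are known to be `k`; their number is the variable `5`. -/
def topString : Cmd :=
  .ite (var 20 + var 5) (var 19) (.assign 20 (var 20 + var 5)) (.assign 20 (lit 0)) ;;
  findBlock ;;
  fill (var 1 * (lit 1 - (lit 1 - (var 5 - var 25))) +
    cell (var 25 - var 5) * (lit 1 - (var 5 - var 25)))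

/-- The unranking program: find the block that the position belongs to, and continue it. -/
def unrankProgram : Cmd :=
  .assign 4 (var 1 * var 0 + var 0 - var 2) ;; countAll ;; .assign 20 (var 3 - lit 1) ;;
  findBlock ;; probe ;; .assign 5 (var 19 - var 50 - var 20) ;; testSuffix ;;
  .ite (var 20 + var 0) (var 19) .skip (.assign 5 (var 19 - var 20) ;; .assign 6 (lit 0)) ;;
  .ite (lit 0) (var 6) (fill (cell ((var 0 - var 5 + var 25) % var 0))) topString ;;
  complementOutput

section
variable {S W n k V w : ℕ} {Q : Store → Prop} {σ : Store}

theorem run_testSuffix (hp : Fits S W n k V) {e : ℕ} (h0 : σ.reg 0 = n) (h1 : σ.reg 1 = k)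
    (h5 : σ.reg 5 = e) (hm : ∀ l < n, σ.mem l ≤ k)
    (hQ : ∀ τ, (∀ r < 25, r ≠ 6 → τ.reg r = σ.reg r) → τ.mem = σ.mem →
      (0 < τ.reg 6 ↔ ∃ l < n, n - e ≤ l ∧ σ.mem l ≠ k) →
      τ.clk ≤ σ.clk + 60 * n → Q τ) : Run S W testSuffix Q σ := by
  obtain ⟨hn, hS, hSW, hkW, hpow, hk⟩ := id hp
  rw [testSuffix, run_seq, run_assign]
  refine ⟨by simp, Run.for n (fun i r M => (∀ y < 25, y ≠ 6 → r y = σ.reg y) ∧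
    M = σ.mem ∧ (0 < r 6 ↔ ∃ l < i, n - e ≤ l ∧ σ.mem l ≠ k)) 20 (by omega)
      (by omega) (by omega) ?_ ?_ ?_ ?_⟩
  · refine ⟨fun x hx h => ?_, rfl, ?_⟩
    · simp [show x ≠ 25 by omega, h]
    · simp
  · rintro x hx ρ ⟨h2, -⟩ -
    simp [h2, h0]
  · rintro i hi ρ ⟨h2, h3, h6⟩ h8
    have hi' := hm i hi
    have hfr : ∀ c v : ℕ, c = 6 ∨ c = 63 → ∀ x < 25, ¬ x = 6 →
        (if x = 25 then i + 1 else if x = c then v else ρ.reg x) = σ.reg x := fun c v hc x hx h => by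
      rw [if_neg (by omega), if_neg (by omega), h2 x hx h]
    have hstep : (n ≤ i + e → σ.mem i = k) →
        (0 < ρ.reg 6 ↔ ∃ l ≤ i, n ≤ l + e ∧ ¬ σ.mem l = k) := fun h => by
      rw [h6]
      constructor
      · rintro ⟨l, hl, h7, h9⟩
        exact ⟨l, by omega, by omega, h9⟩
      · rintro ⟨l, hl, h7, h9⟩
        rcases hl.lt_or_eq with hl | rfl
        · exact ⟨l, hl, by omega, h9⟩
        · exact absurd (h h7) h9
    simp [Cmd.skip, h2, h0, h1, h5, h3, h8, Nat.lt_succ_iff]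
    exact ⟨fun hlt => ⟨fun x hx => hfr _ _ (by simp) x (by omega), hstep (by omega)⟩, fun hle =>
      ⟨by omega, fun hlt => ⟨by omega, fun x hx => hfr _ _ (by simp) x (by omega),
        i, le_rfl, hle, hlt.ne⟩, fun hge => ⟨fun x hx => hfr _ _ (by simp) x (by omega),
        hstep fun _ => le_antisymm hi' hge⟩⟩⟩
  · rintro ρ ⟨h2, h3, h5⟩ - hc
    refine hQ ρ h2 h3 h5 (hc.trans ?_)
    simp
    omega

theorem run_complementOutput (hp : Fits S W n k V) (h0 : σ.reg 0 = n) (h1 : σ.reg 1 = k)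
    (hQ : ∀ τ, (∀ b < n, τ.mem b = k + 1 - σ.mem (n + b)) →
      τ.clk ≤ σ.clk + 50 * n → Q τ) : Run S W complementOutput Q σ := by
  obtain ⟨hn, hS, hSW, hkW, hpow, hk⟩ := id hp
  refine Run.for n (fun i r M => (∀ y < 25, r y = σ.reg y) ∧
    (∀ b < i, M b = k + 1 - σ.mem (n + b)) ∧ ∀ b, n ≤ b → M b = σ.mem b) 20 (by omega)
      (by omega) (by omega) ?_ ?_ ?_ ?_
  · refine ⟨fun x hx => ?_, fun l hl => by omega, fun _ _ => rfl⟩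
    simp [show x ≠ 25 by omega]
  · rintro x hx ρ ⟨h2, -⟩ -
    simp [h2, h0]
  · rintro i hi ρ ⟨h2, h3, h5⟩ h6
    simp [h2, h0, h1, h6]
    refine ⟨by omega, fun y hy => ?_, fun b hb => ?_, fun b hb => ?_⟩
    · rw [if_neg (by omega), h2 y hy]
    · split_ifs with h
      · rw [h, h5 _ (by omega)]
      · exact h3 b (by omega)
    · rw [if_neg (by omega), h5 b hb]
  · rintro ρ ⟨h2, h3, h5⟩ - hc
    refine hQ ρ h3 (hc.trans ?_)
    simp
    omega

theorem run_topString (hp : Fits S W n k V) (hV : V ≤ k * n + n) {i e : ℕ}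
    (h0 : σ.reg 0 = n) (h1 : σ.reg 1 = k) (h4 : σ.reg 4 = V) (h5 : σ.reg 5 = e)
    (h19 : σ.reg 19 = (stringsAtLeast k n V).card) (h20 : σ.reg 20 = i) (he : e ≤ n)
    (hi : i < (stringsAtLeast k n V).card)
    (hQ : ∀ τ β, (∀ r < 19, τ.reg r = σ.reg r) →
      IsBlock k n V (if i + e < (stringsAtLeast k n V).card then i + e else 0) β →
      word n (fun l => τ.mem (n + l)) = top k e ++ β.take (n - e) →
      τ.clk ≤ σ.clk + n * (k.size * (3400 * (n ^ 3 * k ^ 2))) → Q τ) :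
    Run S W topString Q σ := by
  obtain ⟨hn, hS, hSW, hkW, hpow, hk⟩ := id hp
  have hnV : 0 < n * (V + 1) := Nat.mul_pos hn (by omega)
  have hcard : (stringsAtLeast k n V).card ≤ k ^ n :=
    (Finset.card_filter_le _ _).trans (card_strings k n).le
  have hB : 1 ≤ k.size * (n ^ 3 * k ^ 2) :=
    Nat.mul_pos (Nat.size_pos.2 hk) (Nat.mul_pos (Nat.pow_pos hn) (Nat.pow_pos hk))
  have key : ∀ ρ : Store, (∀ r < 19, ρ.reg r = σ.reg r) → ρ.reg 19 = (stringsAtLeast k n V).card →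
      ρ.reg 20 = (if i + e < (stringsAtLeast k n V).card then i + e else 0) → ρ.clk ≤ σ.clk + 20 →
      Run S W (findBlock ;; fill (var 1 * (lit 1 - (lit 1 - (var 5 - var 25))) +
        cell (var 25 - var 5) * (lit 1 - (var 5 - var 25)))) Q ρ := by
    intro ρ r1 r2 r3 r4
    rw [run_seq]
    refine run_findBlock hp hV (by simp [r1, h0]) (by simp [r1, h1]) (by simp [r1, h4]) r2 r3
      (by split_ifs <;> omega) fun τ t1 t2 t3 => ?_
    obtain ⟨a1, a2⟩ := mem_strings.1 t2.mem
    refine run_fill hp (by simp [t1, r1, h0])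
      (f := fun l => (top k e ++ (word n τ.mem).take (n - e)).getD l 0) ?_ ?_
    · intro l hl κ k1 k2 k3
      have b1 : l - e < n := by omega
      have b2 := (a2 _ (getD_mem (s := word n τ.mem) (l := l - e) (by rw [a1]; exact b1))).2
      have b3 : (top k e ++ (word n τ.mem).take (n - e)).getD l 0 =
          if l < e then k else (word n τ.mem).getD (l - e) 0 := by
        simp only [List.getD_eq_getElem?_getD, top]
        split_ifs with h
        · rw [List.getElem?_append_left (by simpa using h), List.getElem?_replicate, if_pos h]; rfl
        · rw [List.getElem?_append_right (by simpa using h), List.length_replicate,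
            List.getElem?_take_of_lt (by omega)]
      rw [b3]
      rw [getD_word _ b1] at b2 ⊢
      simp [k1, k3, t1, r1, h1, h5, k2 _ b1]
      -- The truncated differences are the indicators of `l < e` and `e ≤ l`, so exactly one summand
      -- is present.
      by_cases h : l < e
      · rw [if_pos h, show 1 - (1 - (e - l)) = 1 by omega, show 1 - (e - l) = 0 by omega]
        omega
      · rw [if_neg h, show 1 - (1 - (e - l)) = 0 by omega, show 1 - (e - l) = 1 by omega]
        omega
    · intro κ k1 k2 k3 k4
      refine hQ κ (word n τ.mem) (fun r hr => by rw [k1 r (by omega), t1 r (by omega), r1 r hr])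
        t2 ?_ ?_
      · rw [word_congr k3]
        have e2 : (top k e ++ (word n τ.mem).take (n - e)).length = n := by simp [top]; omega
        have := word_getD (top k e ++ (word n τ.mem).take (n - e))
        rwa [e2] at this
      · refine k4.trans ?_
        simp
        rw [show k.size * (3300 * (n ^ 3 * k ^ 2)) = 3300 * (k.size * (n ^ 3 * k ^ 2)) by ring] at t3
        rw [show k.size * (3400 * (n ^ 3 * k ^ 2)) = 3400 * (k.size * (n ^ 3 * k ^ 2)) by ring]
        generalize k.size * (n ^ 3 * k ^ 2) = B at *
        nlinarith
  rw [topString, run_seq]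
  simp [h19, h20, h5]
  refine ⟨by omega, fun hlt => ⟨by omega, run_seq.1 (key _ (fun r hr => ?_) ?_ ?_ ?_)⟩,
    fun hge => run_seq.1 (key _ (fun r hr => ?_) ?_ ?_ ?_)⟩
  · simp [show r ≠ 20 by omega]
  · simp [h19]
  · simp [hlt]
  · simp
  · simp [show r ≠ 20 by omega]
  · simp [h19]
  · simp [not_lt.2 hge]
  · simp

/-- With `e` symbols of the block of `α` left from the position on, there are three cases. If these
symbols are not all `k`, the string is a rotation of `α`. If they are, it is a run of `e` symbols
`k` followed by the start of the next necklace. Among the last `n` positions only symbols `k` remain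
before the sequence wraps around to its first necklace, and this case overrides the others. -/
theorem run_unrankProgram (hp : Fits S W n k (k * n + n - w)) {r : ℕ} (hr1 : 1 ≤ r)
    (hr2 : r ≤ (stringsAtMost k n w).card) (h0 : σ.reg 0 = n) (h1 : σ.reg 1 = k)
    (h2 : σ.reg 2 = w) (h3 : σ.reg 3 = r)
    (hQ : ∀ τ, word n τ.mem ∈ stringsAtMost k n w →
      HasRank (cycleAtMost k n w) (word n τ.mem) r →
      τ.clk ≤ σ.clk + 20000 * (n * (k.size * (n ^ 3 * k ^ 2))) → Q τ) :
    Run S W unrankProgram Q σ := by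
  obtain ⟨hn, hS, hSW, hkW, hpow, hk⟩ := id hp
  rw [card_stringsAtMost] at hr2
  set V := k * n + n - w with hV
  have hVle : V ≤ k * n + n := Nat.sub_le _ _
  have hcard : (stringsAtLeast k n V).card ≤ k ^ n :=
    (Finset.card_filter_le _ _).trans (card_strings k n).le
  have hlen := length_cycleAtLeast (k := k) (V := V) hn
  have hnV : 0 < n * (V + 1) := Nat.mul_pos hn (by omega)
  have hsz := Nat.size_pos.2 hk
  set B := n * (k.size * (n ^ 3 * k ^ 2)) with hB
  have hB1 : n ^ 3 * k ^ 2 ≤ B := by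
    rw [hB, ← mul_assoc]; exact Nat.le_mul_of_pos_left _ (Nat.mul_pos hn hsz)
  have hB2 : n ≤ B := Nat.le_mul_of_pos_right _
    (Nat.mul_pos hsz (Nat.mul_pos (Nat.pow_pos hn) (Nat.pow_pos hk)))
  have hB3 : n * (k.size * (3300 * (n ^ 3 * k ^ 2))) = 3300 * B := by rw [hB]; ring
  have hB4 : n * (k.size * (3400 * (n ^ 3 * k ^ 2))) = 3400 * B := by rw [hB]; ring
  obtain ⟨i, rfl⟩ : ∃ i, r = i + 1 := ⟨r - 1, by omega⟩
  have hi : i < (stringsAtLeast k n V).card := hr2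
  have fin : ∀ (t : List ℕ) (τ : Store), t.length = n → Reads (cycleAtLeast k n V) i t →
      (∀ l < n, τ.mem l = k + 1 - t.getD l 0) → τ.clk ≤ σ.clk + 20000 * B → Q τ := by
    intro t τ ht h hm hclk
    have e : word n τ.mem = complement k t := ext_getD (by simp [complement, ht]) fun l hl => by
      rw [complement, List.length_map, ht] at hl
      rw [getD_word _ hl, hm l hl]
      simp [complement, List.getD_eq_getElem?_getD, ht, hl]
    refine hQ τ ?_ ?_ hclk
    · rw [e]
      exact complement_mem_stringsAtMost (mem_stringsAtLeast_of_reads hn hk hi ht h)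
    · rw [e]
      exact hasRank_cycleAtMost (hasRank_of_reads h (hi.trans_eq hlen.symm))
  rw [unrankProgram, run_seq, run_assign]
  refine ⟨by simp [h0, h1]; omega, ?_⟩
  rw [run_seq]
  refine run_countAll hp hVle (by simp [h0]) (by simp [h1]) (by simp [h0, h1, h2, hV])
    fun υ u1 u2 u3 u4 => ?_
  simp at u1 u4
  have v0 : υ.reg 0 = n := by simp [u1, h0]
  have v1 : υ.reg 1 = k := by simp [u1, h1]
  have v3 : υ.reg 3 = i + 1 := by simp [u1, h3]
  have v4 : υ.reg 4 = V := by simp [u1, h0, h1, h2, hV]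
  clear u1
  rw [run_seq, run_assign]
  refine ⟨by simp; omega, ?_⟩
  rw [run_seq]
  refine run_findBlock hp hVle (i := i) (by simp [v0]) (by simp [v1]) (by simp [v4]) (by simp [u3])
    (by simp [v3]) hi fun φ f1 f2 f3 => ?_
  set α := word n φ.mem with hα
  obtain ⟨a1, a2⟩ := mem_strings.1 f2.mem
  have fm : ∀ l < n, φ.mem l = α.getD l 0 := fun l hl => (getD_word _ hl).symm
  have ab : ∀ l < n, α.getD l 0 ≤ k := fun l hl => (a2 _ (getD_mem (by omega))).2
  rw [run_seq]
  refine run_probe hp hVle (by simp [f1, v0]) (by simp [f1, v1]) (by simp [f1, v4])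
    (fun l hl => by rw [fm l hl]; exact ab l hl) fun ψ p1 p2 p3 p4 => ?_
  have hg := aboveCount_add_upTo (k := k) (V := V) hn φ.mem
  rw [← p3, ← hα] at hg
  obtain ⟨l1, l2⟩ := f2.length_le hn
  have hlt := f2.lt
  obtain ⟨e, he⟩ : ∃ e, e = upTo k n V α - i := ⟨_, rfl⟩
  rw [← he] at l1
  rw [run_seq, run_assign]
  refine ⟨by simp, ?_⟩
  have pm : ∀ l < n, ψ.mem l = α.getD l 0 := fun l hl => by rw [p2 l hl, fm l hl]
  have w19 : ψ.reg 19 = (stringsAtLeast k n V).card := by simp [p1, f1, u3]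
  have w20 : ψ.reg 20 = i := by simp [p1, f1, v3]
  rw [run_seq]
  refine run_testSuffix hp (e := e) (by simp [p1, f1, v0]) (by simp [p1, f1, v1])
    (by simp [w19, w20]; omega) (fun l hl => by simp [pm l hl]; exact ab l hl)
    fun π q1 q2 q3 q4 => ?_
  simp at f3 q4
  have hclk : π.clk ≤ σ.clk + 10000 * B := by omega
  have x0 : π.reg 0 = n := by simp [q1, p1, f1, v0]
  have x1 : π.reg 1 = k := by simp [q1, p1, f1, v1]
  have x4 : π.reg 4 = V := by simp [q1, p1, f1, v4]
  have x5 : π.reg 5 = e := by simp [q1, w19, w20]; clear q3; omega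
  have x19 : π.reg 19 = (stringsAtLeast k n V).card := by simp [q1, w19]
  have x20 : π.reg 20 = i := by simp [q1, w20]
  have xm : ∀ l < n, π.mem l = α.getD l 0 := fun l hl => by rw [q2]; simp [pm l hl]
  have out : ∀ (ρ : Store) (t : List ℕ), ρ.reg 0 = n → ρ.reg 1 = k → t.length = n →
      Reads (cycleAtLeast k n V) i t → (∀ l < n, ρ.mem (n + l) = t.getD l 0) →
      ρ.clk ≤ σ.clk + 15000 * B → Run S W complementOutput Q ρ := fun ρ t r0 r1 ht h hm hc =>
    run_complementOutput hp r0 r1 fun τ t1 t2 =>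
      fin t τ ht h (fun l hl => by rw [t1 l hl, hm l hl]) (by omega)
  have outTop : ∀ (ρ : Store) (e : ℕ), (∀ r < 25, r ≠ 5 → r ≠ 6 → ρ.reg r = π.reg r) →
      ρ.reg 5 = e → ρ.clk ≤ π.clk + 50 → e ≤ n → (∀ β,
      IsBlock k n V (if i + e < (stringsAtLeast k n V).card then i + e else 0) β →
      Reads (cycleAtLeast k n V) i (top k e ++ β.take (n - e))) →
      Run S W topString (fun τ => Run S W complementOutput Q (τ.tick 1)) ρ := by
    intro ρ e r1 r2 r3 hen hβ
    clear q3
    refine run_topString hp hVle (i := i) (e := e) (by simp [r1, x0]) (by simp [r1, x1])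
      (by simp [r1, x4]) r2 (by simp [r1, x19]) (by simp [r1, x20]) hen hi fun τ β t1 t2 t3 t4 => ?_
    have b1 := (mem_strings.1 t2.mem).1
    refine out _ _ (by simp [t1, r1, x0]) (by simp [t1, r1, x1]) (by simp [top]; omega) (hβ β t2)
      (fun l hl => ?_) (by simp; omega)
    rw [← t3, getD_word _ hl]
    rfl
  rw [run_seq, run_ite]
  simp only [eval_add, eval_var, x0, x19, x20]
  refine ⟨by simp [x0, x20]; omega, fun hin => ?_, fun hin => ?_⟩
  · rw [Cmd.skip, run_assign, run_seq, run_ite]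
    simp only [Store.tick_mem, Store.set_mem] at q3
    refine ⟨by simp, by simp, fun hlt6 => ?_, fun hge6 => ?_⟩
    · simp at hlt6
      obtain ⟨l, hl, hle, hne⟩ := q3.1 hlt6
      clear q3
      rw [pm l hl] at hne
      have hread := f2.reads_rotate hn (by
        rw [← he]
        refine ⟨_, getD_mem (l := l - (n - e)) (by simp; omega), ?_⟩
        rw [List.getD_eq_getElem?_getD, List.getElem?_drop, ← List.getD_eq_getElem?_getD,
          show n - e + (l - (n - e)) = l by omega]
        exact hne)
      rw [← he] at hread
      refine run_fill hp (by simp [x0]) (f := fun l => (α.rotate (n - e)).getD l 0) ?_ ?_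
      · intro l hl' ρ r1 r2 r3
        simp at r1 r2
        have d1 := Nat.div_mul_le_self (n - e + l) n
        have m1 := Nat.mod_lt (n - e + l) hn
        simp only [safe_cell, safe_mod, safe_add, safe_sub, safe_var, eval_cell, eval_mod, eval_add,
          eval_sub, eval_var, r3]
        rw [r1 0 (by omega), r1 5 (by omega)]
        simp only [Nat.reduceEqDiff, if_false, x0, x5]
        rw [r2 _ m1, xm _ m1, getD_rotate (by omega), a1]
        exact ⟨⟨⟨⟨⟨by omega, by omega⟩, by omega, by omega⟩, by omega, by omega⟩, by omega⟩, rfl⟩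
      · intro κ k1 k2 k3 k4
        simp at k1 k4
        exact out κ _ (by simp [k1, x0]) (by simp [k1, x1]) (by simpa using a1) hread k3 (by omega)
    · simp at hge6
      refine outTop _ e (fun r hr h5 h6 => ?_) (by simp [x5]) (by simp) (by omega) fun β hβ => ?_
      · simp [show r ≠ 63 by omega]
      -- The position `i + e` is the start of the following block.
      · rw [if_pos (by omega), show i + e = upTo k n V α by omega] at hβ
        rw [he]
        refine f2.reads_top_append hn hin (fun c hc => ?_) hβ hk
        rw [← he] at hc
        obtain ⟨j, hj, rfl⟩ := List.mem_iff_getElem.1 hc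
        by_contra hne
        rw [List.length_drop, a1] at hj
        have := q3.2 ⟨n - e + j, by omega, by omega, by
          rw [pm _ (by omega), List.getD_eq_getElem _ _ (by omega)]
          rwa [List.getElem_drop] at hne⟩
        omega
  · rw [run_seq, run_assign]
    refine ⟨by simp, run_assign.2 ⟨by simp, run_seq.2 (run_ite.2 ⟨by simp, fun h => by simp at h, fun _ =>
      outTop _ ((stringsAtLeast k n V).card - i) (fun r hr h5 h6 => ?_) (by simp [x19, x20])
        (by simp) (by omega) fun β hβ => ?_⟩)⟩⟩
    · simp [h5, h6]
    · rw [if_neg (by omega)] at hβ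
      exact hβ.reads_top_append_of_le hn hi (by omega) hk

end
end RAM

/-! ### Word size, memory and the final constants -/

namespace RAM
open RAM.Expr UCycle

variable {n k w C : ℕ}

/-- The base is at least 2, so sixteen of its factors absorb `65536 = 2 ^ 16`; fourth powers suffice
for all quantities that the programs need. -/
theorem le_word (hn : 1 ≤ n) (hk : 1 ≤ k) (hC : 20 ≤ C) : 65536 * (n + k + w + k ^ n) ^ 4 ≤ (n + k + w + k ^ n) ^ C := by
  have hpow := Nat.pow_pos (n := n) hk
  have h2 : 2 ≤ n + k + w + k ^ n := by omega
  generalize n + k + w + k ^ n = X at h2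
  calc 65536 * X ^ 4 = 2 ^ 16 * X ^ 4 := rfl
    _ ≤ X ^ 16 * X ^ 4 := Nat.mul_le_mul_right _ (Nat.pow_le_pow_left h2 16)
    _ = X ^ 20 := (pow_add X 16 4).symm
    _ ≤ X ^ C := Nat.pow_le_pow_right (by omega) hC

/-- `C` is both the factor of the memory bound and the exponent of the word bound. It has to be
large for the former, while `C ≤ 2 ^ 16` lets all addresses fit into a word. -/
theorem fits (hn : 1 ≤ n) (hk : 1 ≤ k) (hC : 20 ≤ C) (hC' : C ≤ 65536) :
    Fits (C * (n ^ 3 * k)) ((n + k + w + k ^ n) ^ C) n k (k * n + n - w) := by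
  have hW := le_word (w := w) hn (show 1 ≤ k by omega) hC
  have hpow := Nat.pow_pos (n := n) hk
  set X := n + k + w + k ^ n with hX
  have hX1 : X ≤ X ^ 4 := Nat.le_self_pow (by omega) X
  have hX2 : k * n ≤ X ^ 4 := by
    calc k * n ≤ X * X := by gcongr <;> omega
      _ = X ^ 2 := by ring
      _ ≤ X ^ 4 := Nat.pow_le_pow_right (by omega) (by omega)
  have h3 : n ^ 3 * k ≤ X ^ 4 := by
    calc n ^ 3 * k ≤ X ^ 3 * X := by gcongr <;> omega
      _ = X ^ 4 := by ring
  refine ⟨hn, ?_, ?_, by omega, by omega, hk⟩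
  · have h1 : n * (k * n + n - w + 1) ≤ n * (k * n) + n * n + n := by
      calc n * (k * n + n - w + 1) ≤ n * (k * n + n + 1) := by gcongr; omega
        _ = n * (k * n) + n * n + n := by ring
    have e1 : n * (k * n) ≤ n ^ 3 * k := by
      calc n * (k * n) = n ^ 2 * k := by ring
        _ ≤ n ^ 3 * k := by gcongr ; omega
    have e2 : n * n ≤ n ^ 3 * k := by
      calc n * n = n ^ 2 * 1 := by ring
        _ ≤ n ^ 3 * k := by gcongr ; omega
    have e3 : n ≤ n * n := Nat.le_mul_self n
    have e4 : 20 * (n ^ 3 * k) ≤ C * (n ^ 3 * k) := Nat.mul_le_mul_right _ hC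
    omega
  · calc C * (n ^ 3 * k) ≤ 65536 * X ^ 4 := Nat.mul_le_mul hC' h3
      _ ≤ X ^ C := hW

/-- `k.size - 1` is at most `log k / log 2`, and for `k ≥ 2` the remaining 1 is also at most `log k
/ log 2`; finally `2 / log 2 < 3`. -/
theorem size_le_log (hk : 2 ≤ k) : (k.size : ℝ) ≤ 3 * Real.log k := by
  have h1 : 2 ^ (k.size - 1) ≤ k := Nat.lt_size.1 (by have := Nat.size_pos.2 (show 0 < k by omega); omega)
  have h2 : ((k.size - 1 : ℕ) : ℝ) * Real.log 2 ≤ Real.log k := by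
    rw [← Real.log_pow]
    exact Real.log_le_log (by positivity) (by exact_mod_cast h1)
  have h3 : Real.log 2 ≤ Real.log k := Real.log_le_log (by norm_num) (by exact_mod_cast hk)
  have h4 := Real.log_two_gt_d9
  have h5 : (k.size : ℝ) = ((k.size - 1 : ℕ) : ℝ) + 1 := by
    have := Nat.size_pos.2 (show 0 < k by omega)
    exact_mod_cast (by omega : k.size = k.size - 1 + 1)
  have h6 : (0 : ℝ) ≤ ((k.size - 1 : ℕ) : ℝ) := Nat.cast_nonneg _
  rw [h5]
  nlinarith

theorem haltsIn_rankProgram (hn : 1 ≤ n) (hk : 1 ≤ k) (hC : 20000 ≤ C) (hC' : C ≤ 65536)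
    {s : List ℕ} (hs : s ∈ stringsAtMost k n w) :
    ∃ (t : ℕ) (σ : State), HaltsIn (rankProgram.code 0) (C * (n ^ 3 * k)) ((n + k + w + k ^ n) ^ C)
      (initial [n, k, w] s) t σ ∧ t ≤ C * (n ^ 3 * k ^ 2) ∧
      HasRank (cycleAtMost k n w) s (σ.reg 0) := by
  have hf : Fits _ ((n + k + w + k ^ n) ^ C) n k (k * n + n - w) := fits hn hk (by omega) hC'
  have hW := le_word (w := w) hn (show 1 ≤ k by omega) (show 20 ≤ C by omega)
  have hX1 : n + k + w + k ^ n ≤ (n + k + w + k ^ n) ^ 4 := Nat.le_self_pow (by omega) _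
  have hsk := (mem_strings.1 (Finset.mem_filter.1 hs).1).2
  have hsl := (mem_strings.1 (Finset.mem_filter.1 hs).1).1
  obtain ⟨t, σ, τ, h1, ⟨h2, h3⟩, h4, h5, -⟩ := Run.haltsIn (x := [n, k, w]) (y := s)
    (run_rankProgram hf (σ := ⟨(initial [n, k, w] s).reg, (initial [n, k, w] s).mem, 0⟩) hs rfl rfl rfl
      (fun _ _ => rfl) (Q := fun τ => HasRank (cycleAtMost k n w) s (τ.reg 0) ∧
        τ.clk ≤ 0 + 10000 * (n ^ 3 * k ^ 2)) fun τ t1 t2 => ⟨t1, t2⟩)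
    (by simp; omega) (fun a ha => by have := hsk a ha; omega)
  refine ⟨t, σ, h1, ?_, by rw [h5 0 (by omega)]; exact h2⟩
  rw [← h4]
  have : 20000 * (n ^ 3 * k ^ 2) ≤ C * (n ^ 3 * k ^ 2) := Nat.mul_le_mul_right _ hC
  omega

theorem haltsIn_unrankProgram (hn : 1 ≤ n) (hk : 2 ≤ k) (hC : 60000 ≤ C) (hC' : C ≤ 65536)
    {r : ℕ} (hr : 1 ≤ r) (hr' : r ≤ (stringsAtMost k n w).card) :
    ∃ (t : ℕ) (σ : State), HaltsIn (unrankProgram.code 0) (C * (n ^ 3 * k)) ((n + k + w + k ^ n) ^ C)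
      (initial [n, k, w, r] []) t σ ∧ (t : ℝ) ≤ C * ((n : ℝ) ^ 4 * (k : ℝ) ^ 2 * Real.log k) ∧
      (List.range n).map σ.mem ∈ stringsAtMost k n w ∧
      HasRank (cycleAtMost k n w) ((List.range n).map σ.mem) r := by
  have hf : Fits _ ((n + k + w + k ^ n) ^ C) n k (k * n + n - w) :=
    fits hn (by omega) (by omega) hC'
  have hW := le_word (w := w) hn (show 1 ≤ k by omega) (show 20 ≤ C by omega)
  have hX1 : n + k + w + k ^ n ≤ (n + k + w + k ^ n) ^ 4 := Nat.le_self_pow (by omega) _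
  have hrk : r ≤ k ^ n := hr'.trans ((Finset.card_filter_le _ _).trans (card_strings k n).le)
  obtain ⟨t, σ, τ, h1, ⟨h2, h3, h4⟩, h5, -, h6⟩ := Run.haltsIn (x := [n, k, w, r]) (y := [])
    (run_unrankProgram hf (σ := ⟨(initial [n, k, w, r] []).reg, (initial [n, k, w, r] []).mem, 0⟩)
      hr hr' rfl rfl rfl rfl (Q := fun τ => word n τ.mem ∈ stringsAtMost k n w ∧
        HasRank (cycleAtMost k n w) (word n τ.mem) r ∧
        τ.clk ≤ 0 + 20000 * (n * (k.size * (n ^ 3 * k ^ 2)))) fun τ t1 t2 t3 => ⟨t1, t2, t3⟩)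
    (by simp; omega) (by simp)
  refine ⟨t, σ, h1, ?_, by rw [h6]; exact h2, by rw [h6]; exact h3⟩
  rw [h5, zero_add] at h4
  have hlog := size_le_log hk
  have hlog0 : 0 ≤ Real.log k := Real.log_nonneg (by exact_mod_cast (by omega : 1 ≤ k))
  calc (t : ℝ) ≤ ((20000 * (n * (k.size * (n ^ 3 * k ^ 2))) : ℕ) : ℝ) := by exact_mod_cast h4
    _ = 20000 * ((n : ℝ) ^ 4 * (k : ℝ) ^ 2 * k.size) := by push_cast; ring
    _ ≤ 20000 * ((n : ℝ) ^ 4 * (k : ℝ) ^ 2 * (3 * Real.log k)) := by gcongr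
    _ = 60000 * ((n : ℝ) ^ 4 * (k : ℝ) ^ 2 * Real.log k) := by ring
    _ ≤ C * ((n : ℝ) ^ 4 * (k : ℝ) ^ 2 * Real.log k) := by
      gcongr
      exact_mod_cast hC

end RAM

theorem mainTheorem5 :
    -- the complemented sequence is a universal cycle for the strings of weight at most `w`
    (∀ n k w : ℕ, 1 ≤ n → 1 ≤ k →
      UCycle.IsUniversalCycle (UCycle.cycleAtMost k n w) (UCycle.stringsAtMost k n w)) ∧
    -- ranking: input `n, k, w` in registers and the string in memory, output in register 0
    (∃ (P : List RAM.Instr) (C : ℕ), ∀ n k w : ℕ, 1 ≤ n → 1 ≤ k →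
      ∀ s ∈ UCycle.stringsAtMost k n w,
        ∃ (t : ℕ) (σ : RAM.State),
          RAM.HaltsIn P (C * (n ^ 3 * k)) ((n + k + w + k ^ n) ^ C)
            (RAM.initial [n, k, w] s) t σ ∧
          t ≤ C * (n ^ 3 * k ^ 2) ∧
          UCycle.HasRank (UCycle.cycleAtMost k n w) s (σ.reg 0)) ∧
    -- unranking: input `n, k, w, r` in registers, output in the first `n` memory cells
    (∃ (P : List RAM.Instr) (C : ℕ), ∀ n k w : ℕ, 1 ≤ n → 2 ≤ k →
      ∀ r : ℕ, 1 ≤ r → r ≤ (UCycle.stringsAtMost k n w).card →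
        ∃ (t : ℕ) (σ : RAM.State),
          RAM.HaltsIn P (C * (n ^ 3 * k)) ((n + k + w + k ^ n) ^ C)
            (RAM.initial [n, k, w, r] []) t σ ∧
          (t : ℝ) ≤ C * ((n : ℝ) ^ 4 * (k : ℝ) ^ 2 * Real.log k) ∧
          (List.range n).map σ.mem ∈ UCycle.stringsAtMost k n w ∧
          UCycle.HasRank (UCycle.cycleAtMost k n w) ((List.range n).map σ.mem) r) := by
  -- `60000 = 3 · 20000`: the step count of unranking times the constant of `size_le_log`. Only the
  -- two inequalities are retained, so `C` stays abstract as an exponent.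
  obtain ⟨C, hC, hC'⟩ : ∃ C, 60000 ≤ C ∧ C ≤ 65536 := ⟨60000, le_rfl, by omega⟩
  exact ⟨fun n k w hn hk => UCycle.isUniversalCycle_cycleAtMost hn hk w,
    ⟨_, C, fun n k w hn hk s hs => RAM.haltsIn_rankProgram hn hk (by omega) hC' hs⟩,
    ⟨_, C, fun n k w hn hk r hr hr' => RAM.haltsIn_unrankProgram hn hk hC hC' hr hr'⟩⟩
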